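/- Let $T>0$, $d\le m$, and let $W=(W_t)_{t\in[0,T]}$ be an $m$-dimensional Brownian motion on a probability space $(\Omega,\mathcal F,P)$; let $\mathbb F$ be the filtration generated by $W$, augmented by the $P$-null sets, and let $\lambda$ be Lebesgue measure on $[0,T]$. Let $b$ ($\mathbb R^d$-valued) and $\sigma$ ($\mathbb R^{d\times m}$-valued) be $\mathbb F$-predictable processes such that, $\lambda\otimes P$-a.e., $b$ is bounded by a constant and $\varepsilon I_d\le\sigma\sigma^{tr}\le K I_d$ with constants $K>\varepsilon>0$. Put $\theta_t=\sigma_t^{tr}(\sigma_t\sigma_t^{tr})^{-1}b_t$. Let $\tilde C\subseteq\mathbb R^d$ be closed and nonempty (not necessarily convex), $C_t(\omega)=\tilde C\sigma_t(\omega)=\{c\,\sigma_t(\omega):c\in\tilde C\}\subseteq\mathbb R^m$ (with $c$ a row vector), and for a set $C\subseteq\mathbb R^m$ and $a\in\mathbb R^m$ let $\mathrm{dist}(a,C)=\inf_{c\in C}|a-c|$ and $\Pi_C(a)=\{c\in C:|a-c|=\mathrm{dist}(a,C)\}$. Let $\mathcal A_l$ be the set of $\mathbb R^m$-valued $\mathbb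 F$-predictable processes $\rho$ with $E\int_0^T|\rho_s|^2ds<\infty$ and $\rho_t\in C_t$ $\lambda\otimes P$-a.e. Let $x>0$. For every $\rho\in\mathcal A_l$ the wealth equation $$X_t=x+\int_0^tX_s\rho_s\,(dW_s+\theta_s\,ds),\qquad t\in[0,T],$$ has a continuous adapted solution $X^{(\rho)}$, unique up to indistinguishability; it is strictly positive on $[0,T]$ almost surely, and $\log X^{(\rho)}_T$ is integrable. Put $V(x)=\sup_{\rho\in\mathcal A_l}E[\log X_T^{(\rho)}]$ and $$f(t)=\tfrac12\,\mathrm{dist}^2(\theta_t,C_t)-\tfrac12|\theta_t|^2 .$$ Then $f$ is $\lambda\otimes P$-integrable, the supremum $V(x)$ is finite, and $$V(x)=\log x-E\Big[\int_0^Tf(s)\,ds\Big].$$ Moreover, there exists an $\mathbb F$-predictable process $\rho^*$ with $\rho^*_t\in\Pi_{C_t}(\theta_t)$ $\lambda\otimes P$-a.e., and every such $\rho^*$ belongs to $\mathcal A_l$ and is optimal: $E[\log X_T^{(\rho^*)}]=V(x)$. -/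

import Mathlib

open MeasureTheory ProbabilityTheory Filter Topology
open scoped NNReal ENNReal Matrix

noncomputable section

namespace LogUtility

/-- `ℝᵏ` with the Euclidean norm. -/
abbrev Vec (k : ℕ) : Type := EuclideanSpace ℝ (Fin k)

variable {Ω : Type*} [mΩ : MeasurableSpace Ω] {d m : ℕ}

/-- Lebesgue measure on the time interval `[0, t]`, as a measure on `ℝ≥0`. -/
def leb (t : ℝ≥0) : Measure ℝ≥0 :=
  (volume.restrict (Set.Icc (0 : ℝ) t)).map Real.toNNReal

instance (t : ℝ≥0) : IsFiniteMeasure (leb t) := by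
  unfold leb; infer_instance

/-- `W` is an `m`-dimensional standard Brownian motion on `[0, T]` under `P`. Nothing is required
of the values `W t` for `t > T` beyond measurability (one may take `W t = 0` there). -/
structure IsBrownianMotion (W : ℝ≥0 → Ω → Vec m) (T : ℝ≥0) (P : Measure Ω) : Prop where
  measurable : ∀ t, StronglyMeasurable (W t)
  zero : ∀ᵐ ω ∂P, W 0 ω = 0
  law_increment : ∀ s t, s ≤ t → t ≤ T →
    HasLaw (fun ω i ↦ W t ω i - W s ω i)
      (Measure.pi fun _ : Fin m ↦ gaussianReal 0 (t - s)) P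
  indep_increment : ∀ s t, s ≤ t → t ≤ T →
    IndepFun (fun ω ↦ W t ω - W s ω) (fun ω (r : Set.Iic s) ↦ W r ω) P
  continuous_paths : ∀ᵐ ω ∂P, ContinuousOn (fun t ↦ W t ω) (Set.Icc 0 T)

/-- The filtration generated by `W`, augmented by the `P`-null sets. -/
def augmentedFiltration (W : ℝ≥0 → Ω → Vec m) (hW : ∀ t, StronglyMeasurable (W t))
    (P : Measure Ω) : Filtration ℝ≥0 mΩ :=
  Filtration.natural W hW ⊔
    Filtration.const ℝ≥0 (MeasurableSpace.generateFrom {N : Set Ω | MeasurableSet N ∧ P N = 0})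
      (MeasurableSpace.generateFrom_le fun _ hN ↦ hN.1)

/-! ### The Itô integral -/

/-- A simple predictable process `∑ k, ξ k · 1_{(left k, right k]}` with each `ξ k` bounded and
measurable with respect to the σ-algebra at time `left k`. -/
structure SimpleProcess (𝓕 : Filtration ℝ≥0 mΩ) (m : ℕ) where
  n : ℕ
  left : Fin n → ℝ≥0
  right : Fin n → ℝ≥0
  left_le_right : ∀ k, left k ≤ right k
  ξ : Fin n → Ω → Vec m
  measurable_ξ : ∀ k, StronglyMeasurable[𝓕 (left k)] (ξ k)
  bounded_ξ : ∀ k, ∃ c : ℝ, ∀ ω, ‖ξ k ω‖ ≤ c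

/-- The process defined by a `SimpleProcess`. -/
def SimpleProcess.eval {𝓕 : Filtration ℝ≥0 mΩ} (H : SimpleProcess 𝓕 m)
    (s : ℝ≥0) (ω : Ω) : Vec m :=
  ∑ k, (Set.Ioc (H.left k) (H.right k)).indicator (fun _ ↦ H.ξ k ω) s

/-- The elementary stochastic integral `∫₀ᵗ H dW` of a simple predictable process. -/
def SimpleProcess.integral {𝓕 : Filtration ℝ≥0 mΩ} (H : SimpleProcess 𝓕 m)
    (W : ℝ≥0 → Ω → Vec m) (t : ℝ≥0) (ω : Ω) : ℝ :=
  ∑ k, inner ℝ (H.ξ k ω) (W (min (H.right k) t) ω - W (min (H.left k) t) ω)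

/-- `I` is (a version of) the Itô integral process `(∫₀ᵗ H_s dW_s)_{0 ≤ t ≤ T}`: almost surely
`∫₀ᵀ |H_s|² ds < ∞`, and there are simple predictable processes `Hₙ` such that
`∫₀ᵀ |Hₙ - H|² ds → 0` and `sup_{t ≤ T} |∫₀ᵗ Hₙ dW - I_t| → 0`, both in probability. -/
structure IsItoIntegral (𝓕 : Filtration ℝ≥0 mΩ) (P : Measure Ω) (T : ℝ≥0)
    (W : ℝ≥0 → Ω → Vec m) (H : ℝ≥0 → Ω → Vec m) (I : ℝ≥0 → Ω → ℝ) : Prop where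
  sq_integrable : ∀ᵐ ω ∂P, MemLp (fun s ↦ H s ω) 2 (leb T)
  approx : ∃ Hn : ℕ → SimpleProcess 𝓕 m,
    (∀ ε : ℝ≥0∞, 0 < ε →
      Tendsto (fun n ↦ P {ω | ε ≤ ∫⁻ s, ‖(Hn n).eval s ω - H s ω‖ₑ ^ 2 ∂(leb T)})
        atTop (𝓝 0)) ∧
    (∀ ε : ℝ, 0 < ε →
      Tendsto (fun n ↦ P {ω | ∃ t ≤ T, ε ≤ |(Hn n).integral W t ω - I t ω|}) atTop (𝓝 0))

/-! ### The market -/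

/-- The drift `b` and the volatility matrix `σ` are predictable, `b` is bounded and `σ σᵗʳ` is
uniformly elliptic and bounded: `K I ≥ σ σᵗʳ ≥ ε I` (so that `σ` is bounded and of full rank);
the bounds hold `λ ⊗ P`-almost everywhere on `[0, T] × Ω`. -/
structure IsMarket (𝓕 : Filtration ℝ≥0 mΩ) (P : Measure Ω) (T : ℝ≥0)
    (b : ℝ≥0 → Ω → Vec d) (σ : ℝ≥0 → Ω → Matrix (Fin d) (Fin m) ℝ) : Prop where
  predictable_b : IsStronglyPredictable 𝓕 b
  predictable_σ : IsStronglyPredictable 𝓕 σ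
  bounded_b : ∃ c : ℝ, ∀ᵐ z ∂((leb T).prod P), ‖b z.1 z.2‖ ≤ c
  elliptic : ∃ ε K : ℝ, 0 < ε ∧ ε < K ∧ ∀ᵐ z ∂((leb T).prod P),
    (σ z.1 z.2 * (σ z.1 z.2)ᵀ - ε • (1 : Matrix (Fin d) (Fin d) ℝ)).PosSemidef ∧
    (K • (1 : Matrix (Fin d) (Fin d) ℝ) - σ z.1 z.2 * (σ z.1 z.2)ᵀ).PosSemidef

/-- The market price of risk `θ = σᵗʳ (σ σᵗʳ)⁻¹ b`. -/
def marketPrice (b : ℝ≥0 → Ω → Vec d) (σ : ℝ≥0 → Ω → Matrix (Fin d) (Fin m) ℝ)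
    (t : ℝ≥0) (ω : Ω) : Vec m :=
  WithLp.toLp 2 ((σ t ω)ᵀ *ᵥ ((σ t ω * (σ t ω)ᵀ)⁻¹ *ᵥ (b t ω).ofLp))

/-- The constraint set `C_t(ω) = C σ_t(ω) ⊆ ℝᵐ`, where `C ⊆ ℝᵈ` consists of row vectors. -/
def constraintSet (C : Set (Vec d)) (σ : ℝ≥0 → Ω → Matrix (Fin d) (Fin m) ℝ)
    (t : ℝ≥0) (ω : Ω) : Set (Vec m) :=
  (fun c : Vec d ↦ WithLp.toLp 2 (c.ofLp ᵥ* σ t ω)) '' C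

/-- The set `Π_C(a)` of points of `C` at minimal distance from `a`. -/
def proj (C : Set (Vec m)) (a : Vec m) : Set (Vec m) :=
  {c ∈ C | dist a c = Metric.infDist a C}

/-- Admissible strategies `ρ = ρ̃ σ`, where `ρ̃ⁱ` is the proportion of wealth held in stock `i`. -/
structure IsAdmissible (𝓕 : Filtration ℝ≥0 mΩ) (P : Measure Ω) (T : ℝ≥0)
    (σ : ℝ≥0 → Ω → Matrix (Fin d) (Fin m) ℝ) (C : Set (Vec d))
    (ρ : ℝ≥0 → Ω → Vec m) : Prop where
  predictable : IsStronglyPredictable 𝓕 ρ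
  sq_integrable : ∫⁻ ω, ∫⁻ s, ‖ρ s ω‖ₑ ^ 2 ∂(leb T) ∂P < ∞
  mem_constraint : ∀ᵐ z ∂((leb T).prod P), ρ z.1 z.2 ∈ constraintSet C σ z.1 z.2

/-- `X` is a wealth process on `[0, T]` of the strategy `ρ` with initial capital `x`, that is, a
continuous adapted solution of `X_t = x + ∫₀ᵗ X_s ρ_s (dW_s + θ_s ds)`. -/
structure IsWealthProcess (𝓕 : Filtration ℝ≥0 mΩ) (P : Measure Ω) (T : ℝ≥0)
    (W θ : ℝ≥0 → Ω → Vec m) (x : ℝ) (ρ : ℝ≥0 → Ω → Vec m) (X : ℝ≥0 → Ω → ℝ) : Prop where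
  adapted : ∀ t ≤ T, StronglyMeasurable[𝓕 t] (X t)
  continuous_paths : ∀ᵐ ω ∂P, ContinuousOn (fun t ↦ X t ω) (Set.Icc 0 T)
  drift_integrable : ∀ᵐ ω ∂P, Integrable (fun s ↦ X s ω * inner ℝ (ρ s ω) (θ s ω)) (leb T)
  equation : ∃ I : ℝ≥0 → Ω → ℝ,
    IsItoIntegral 𝓕 P T W (fun s ω ↦ X s ω • ρ s ω) I ∧
    ∀ᵐ ω ∂P, ∀ t ≤ T,
      X t ω = x + I t ω + ∫ s, X s ω * inner ℝ (ρ s ω) (θ s ω) ∂(leb t)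

/-! ### The optimization problem -/

/-- The expected logarithmic utilities `E[log X_T]` of the wealth processes of admissible
strategies with initial capital `x`. -/
def expectedUtilities (𝓕 : Filtration ℝ≥0 mΩ) (P : Measure Ω) (T : ℝ≥0)
    (W : ℝ≥0 → Ω → Vec m) (b : ℝ≥0 → Ω → Vec d)
    (σ : ℝ≥0 → Ω → Matrix (Fin d) (Fin m) ℝ) (C : Set (Vec d)) (x : ℝ) : Set ℝ :=
  {u | ∃ ρ X, IsAdmissible 𝓕 P T σ C ρ ∧ IsWealthProcess 𝓕 P T W (marketPrice b σ) x ρ X ∧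
    u = ∫ ω, Real.log (X T ω) ∂P}

/-- The value function `V(x) = sup_ρ E[log X_T]`. -/
def valueFunction (𝓕 : Filtration ℝ≥0 mΩ) (P : Measure Ω) (T : ℝ≥0)
    (W : ℝ≥0 → Ω → Vec m) (b : ℝ≥0 → Ω → Vec d)
    (σ : ℝ≥0 → Ω → Matrix (Fin d) (Fin m) ℝ) (C : Set (Vec d)) (x : ℝ) : ℝ :=
  sSup (expectedUtilities 𝓕 P T W b σ C x)

/-- `f = ½ dist²(θ, C) - ½ |θ|²`. -/
def driver (b : ℝ≥0 → Ω → Vec d) (σ : ℝ≥0 → Ω → Matrix (Fin d) (Fin m) ℝ)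
    (C : Set (Vec d)) (t : ℝ≥0) (ω : Ω) : ℝ :=
  1 / 2 * Metric.infDist (marketPrice b σ t ω) (constraintSet C σ t ω) ^ 2
    - 1 / 2 * ‖marketPrice b σ t ω‖ ^ 2

/-- `ρ` is a predictable selection of the projections `Π_{C_t}(θ_t)`. -/
def IsProjectionSelection (𝓕 : Filtration ℝ≥0 mΩ) (P : Measure Ω) (T : ℝ≥0)
    (b : ℝ≥0 → Ω → Vec d) (σ : ℝ≥0 → Ω → Matrix (Fin d) (Fin m) ℝ)
    (C : Set (Vec d)) (ρ : ℝ≥0 → Ω → Vec m) : Prop :=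
  IsStronglyPredictable 𝓕 ρ ∧
    ∀ᵐ z ∂((leb T).prod P),
      ρ z.1 z.2 ∈ proj (constraintSet C σ z.1 z.2) (marketPrice b σ z.1 z.2)

end LogUtility

end

set_option linter.unusedSectionVars false

noncomputable section

namespace LogUtility

variable {Ω : Type*} [mΩ : MeasurableSpace Ω] {d m : ℕ}

/-! ### Lebesgue measure on `[0, t]` -/

/-! The wealth equation is linear, so its solution is a stochastic exponential `X = x * exp U` with
`U_t = ∫ ρ dW + ∫ (ρ·θ - ½|ρ|²) ds`. For square integrable `ρ` the stochastic integral has mean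
zero, hence `E log X_T = log x + E ∫ (ρ·θ - ½|ρ|²) ds`. Completing the square
(`inner_sub_half_norm_sq`), the integrand is `½|θ|² - ½|θ - ρ|²`. For `ρ_t ∈ C_t` this is at most
`-f(t)`, with equality exactly when `ρ_t` is a nearest point of `C_t` to `θ_t`. The problem is thus
solved pointwise in `(t, ω)`, and the supremum is attained once nearest points can be chosen
predictably. Convexity plays no role: nearest points need to exist, not to be unique.

The choice is made in the fixed closed set `C ⊆ ℝᵈ`, by minimizing `c ↦ |θ - cσ|`. Ellipticity makes
this function coercive, so the minimizers form a compact valued multifunction, and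
`exists_measurable_argmin` selects from it by minimizing the coordinates in turn. Boundedness of `θ`
and of its distance to `C_t` makes every selection admissible.

The rest is stochastic calculus for an integral defined only through simple approximations
converging in probability. Borel–Cantelli upgrades these to almost sure convergence along suitable
sequences, and `isItoIntegral_of_tendsto` shows that the integral is closed under almost sure
limits. A Lenglart inequality gives uniqueness (`IsItoIntegral.eq_zero`); the Itô isometry and the
maximal inequality give existence for square integrable predictable integrands
(`IsFilteredBrownian.exists_isItoIntegral`).

The product rule comes from the summation by parts identity `mul_sub_eq_riemannSum` together with
the quadratic variation of Brownian motion (`tendstoUniformlyOn_crossSum`). It is carried from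
coordinates to simple processes, then to general integrals, then to Itô processes
(`IsItoProcess.mul`). Repeated products give Itô's formula for polynomials, and Taylor polynomials
give it for `exp`. Existence of the wealth process is Itô's formula for `exp U`. Uniqueness holds
because the product rule leaves `X * exp (-U)` with neither a `dW` term nor a drift. -/

lemma leb_restrict_Iic {t T : ℝ≥0} (h : t ≤ T) : (leb T).restrict (Set.Iic t) = leb t := by
  unfold leb
  rw [Measure.restrict_map measurable_real_toNNReal measurableSet_Iic,
    Measure.restrict_restrict (measurable_real_toNNReal measurableSet_Iic)]
  congr 2
  ext x
  have : (t : ℝ) ≤ T := h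
  simp only [Set.mem_inter_iff, Set.mem_preimage, Set.mem_Iic, Real.toNNReal_le_iff_le_coe,
    Set.mem_Icc]
  constructor
  · rintro ⟨h1, h2, h3⟩; exact ⟨h2, h1⟩
  · rintro ⟨h1, h2⟩; exact ⟨h2, h1, h2.trans this⟩

lemma leb_Ioc (T a b : ℝ≥0) :
    leb T (Set.Ioc a b) = ENNReal.ofReal ((min b T : ℝ≥0) - (min a T : ℝ≥0)) := by
  unfold leb
  rw [Measure.map_apply measurable_real_toNNReal measurableSet_Ioc,
    Measure.restrict_apply (measurable_real_toNNReal measurableSet_Ioc)]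
  have : Real.toNNReal ⁻¹' Set.Ioc a b ∩ Set.Icc (0 : ℝ) T
      = Set.Ioc ((min a T : ℝ≥0) : ℝ) ((min b T : ℝ≥0) : ℝ) := by
    ext x
    have ha : (0 : ℝ) ≤ a := a.2
    simp only [Set.mem_inter_iff, Set.mem_preimage, Set.mem_Ioc, Real.toNNReal_le_iff_le_coe,
      Set.mem_Icc, Real.lt_toNNReal_iff_coe_lt, NNReal.coe_min, min_lt_iff, le_min_iff]
    constructor
    · rintro ⟨⟨h1, h2⟩, h3, h4⟩; exact ⟨Or.inl h1, h2, h4⟩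
    · rintro ⟨h1, h2, h3⟩
      rcases h1 with h1 | h1
      · exact ⟨⟨h1, h2⟩, (ha.trans h1.le), h3⟩
      · exact absurd h3 (not_le.2 h1)
  rw [this, Real.volume_Ioc]

lemma ae_leb_le (T : ℝ≥0) : ∀ᵐ s ∂(leb T), s ≤ T := by
  have h := leb_restrict_Iic (le_refl T)
  rw [← h]
  exact ae_restrict_mem measurableSet_Iic

lemma leb_univ (T : ℝ≥0) : leb T Set.univ = T := by
  unfold leb
  rw [Measure.map_apply measurable_real_toNNReal MeasurableSet.univ]
  simp

lemma leb_singleton_zero (T : ℝ≥0) : leb T {0} = 0 := by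
  unfold leb
  rw [Measure.map_apply measurable_real_toNNReal (measurableSet_singleton _),
    Measure.restrict_apply (measurable_real_toNNReal (measurableSet_singleton _))]
  have : Real.toNNReal ⁻¹' {0} ∩ Set.Icc (0 : ℝ) T ⊆ {0} := by
    rintro x ⟨hx, hx'⟩
    simp only [Set.mem_preimage, Set.mem_singleton_iff, Real.toNNReal_eq_zero] at hx
    exact le_antisymm hx hx'.1
  exact measure_mono_null this (by simp)

lemma ae_leb_of_forall_le {T : ℝ≥0} {p : ℝ≥0 → Prop} (h : ∀ s ≤ T, p s) :
    ∀ᵐ s ∂(leb T), p s := (ae_leb_le T).mono h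

/-- Continuous functions on `[0, T]` are almost everywhere strongly measurable. -/
lemma aestronglyMeasurable_of_continuousOn {E : Type*} [TopologicalSpace E]
    [TopologicalSpace.PseudoMetrizableSpace E] {T : ℝ≥0} {u : ℝ≥0 → E}
    (hu : ContinuousOn u (Set.Iic T)) : AEStronglyMeasurable u (leb T) := by
  rw [← leb_restrict_Iic (le_refl T)]
  exact hu.aestronglyMeasurable measurableSet_Iic

lemma exists_bound_of_continuousOn {T : ℝ≥0} {u : ℝ≥0 → ℝ}
    (hu : ContinuousOn u (Set.Iic T)) : ∃ R : ℝ, 0 ≤ R ∧ ∀ s ≤ T, |u s| ≤ R := by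
  have hc : IsCompact (Set.Iic T) := by
    rw [← Set.Icc_bot]; exact isCompact_Icc
  obtain ⟨R, hR⟩ := hc.exists_bound_of_continuousOn hu
  exact ⟨max R 0, le_max_right _ _, fun s hs ↦ (hR s hs).trans (le_max_left _ _)⟩

/-! ### Pathwise convergence in `L²` -/

section L2

variable {α E : Type*} [MeasurableSpace α] {μ : Measure α} [NormedAddCommGroup E]

lemma enorm_add_sq_le (a b : E) : ‖a + b‖ₑ ^ 2 ≤ 2 * ‖a‖ₑ ^ 2 + 2 * ‖b‖ₑ ^ 2 := by
  calc ‖a + b‖ₑ ^ 2 ≤ (‖a‖ₑ + ‖b‖ₑ) ^ 2 := by gcongr; exact enorm_add_le a b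
    _ ≤ 2 * ‖a‖ₑ ^ 2 + 2 * ‖b‖ₑ ^ 2 := by
      simp only [enorm]
      norm_cast
      have := two_mul_le_add_sq ‖a‖₊ ‖b‖₊
      calc (‖a‖₊ + ‖b‖₊) ^ 2 = ‖a‖₊ ^ 2 + ‖b‖₊ ^ 2 + 2 * ‖a‖₊ * ‖b‖₊ := by ring
        _ ≤ ‖a‖₊ ^ 2 + ‖b‖₊ ^ 2 + (‖a‖₊ ^ 2 + ‖b‖₊ ^ 2) := by gcongr
        _ = _ := by ring

lemma lintegral_enorm_add_sq_le {f g : α → E} (hg : AEStronglyMeasurable g μ) :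
    ∫⁻ x, ‖f x + g x‖ₑ ^ 2 ∂μ ≤ 2 * ∫⁻ x, ‖f x‖ₑ ^ 2 ∂μ + 2 * ∫⁻ x, ‖g x‖ₑ ^ 2 ∂μ := by
  calc ∫⁻ x, ‖f x + g x‖ₑ ^ 2 ∂μ ≤ ∫⁻ x, (2 * ‖f x‖ₑ ^ 2 + 2 * ‖g x‖ₑ ^ 2) ∂μ :=
        lintegral_mono fun x ↦ enorm_add_sq_le _ _
    _ = _ := by
      rw [lintegral_add_right' _ ((hg.enorm.pow_const 2).const_mul 2),
        lintegral_const_mul' _ _ (by simp), lintegral_const_mul' _ _ (by simp)]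

lemma memLp_two_iff {f : α → E} (hf : AEStronglyMeasurable f μ) :
    MemLp f 2 μ ↔ ∫⁻ x, ‖f x‖ₑ ^ 2 ∂μ < ∞ := by
  unfold MemLp
  rw [eLpNorm_lt_top_iff_lintegral_rpow_enorm_lt_top (by simp) (by simp)]
  simp [hf]

lemma _root_.MeasureTheory.MemLp.lintegral_enorm_sq_lt_top {f : α → E} (hf : MemLp f 2 μ) :
    ∫⁻ x, ‖f x‖ₑ ^ 2 ∂μ < ∞ := (memLp_two_iff hf.1).1 hf

lemma tendsto_lintegral_sq_add {f g : ℕ → α → E} {f' g' : α → E}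
    (hf : Tendsto (fun n ↦ ∫⁻ x, ‖f n x - f' x‖ₑ ^ 2 ∂μ) atTop (𝓝 0))
    (hg : Tendsto (fun n ↦ ∫⁻ x, ‖g n x - g' x‖ₑ ^ 2 ∂μ) atTop (𝓝 0))
    (hm : ∀ n, AEStronglyMeasurable (fun x ↦ g n x - g' x) μ) :
    Tendsto (fun n ↦ ∫⁻ x, ‖(f n x + g n x) - (f' x + g' x)‖ₑ ^ 2 ∂μ) atTop (𝓝 0) := by
  have h : Tendsto (fun n ↦ 2 * ∫⁻ x, ‖f n x - f' x‖ₑ ^ 2 ∂μ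
      + 2 * ∫⁻ x, ‖g n x - g' x‖ₑ ^ 2 ∂μ) atTop (𝓝 0) := by
    simpa using (ENNReal.Tendsto.const_mul hf (Or.inr (by simp : (2 : ℝ≥0∞) ≠ ∞))).add
      (ENNReal.Tendsto.const_mul hg (Or.inr (by simp : (2 : ℝ≥0∞) ≠ ∞)))
  refine tendsto_of_tendsto_of_tendsto_of_le_of_le tendsto_const_nhds h (fun _ ↦ zero_le) ?_
  intro n
  have := lintegral_enorm_add_sq_le (μ := μ) (f := fun x ↦ f n x - f' x) (hm n)
  refine le_trans (le_of_eq ?_) this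
  refine lintegral_congr fun x ↦ ?_
  congr 2; abel

/-- Uniform convergence of scalar factors and `L²` convergence give `L²` convergence of the
products. -/
lemma tendsto_lintegral_sq_smul [NormedSpace ℝ E] {s : Set α} (hs : ∀ᵐ x ∂μ, x ∈ s)
    {u : ℕ → α → ℝ} {u' : α → ℝ}
    {f : ℕ → α → E} {f' : α → E} (hu : TendstoUniformlyOn u u' atTop s)
    {R : ℝ} (hR : ∀ x ∈ s, |u' x| ≤ R)
    (hf : Tendsto (fun n ↦ ∫⁻ x, ‖f n x - f' x‖ₑ ^ 2 ∂μ) atTop (𝓝 0)) (hf' : MemLp f' 2 μ) :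
    Tendsto (fun n ↦ ∫⁻ x, ‖u n x • f n x - u' x • f' x‖ₑ ^ 2 ∂μ) atTop (𝓝 0) := by
  have hfin := hf'.lintegral_enorm_sq_lt_top
  have key : ∀ ε : ℝ≥0, 0 < ε → ∀ᶠ n in atTop, ∫⁻ x, ‖u n x • f n x - u' x • f' x‖ₑ ^ 2 ∂μ ≤
      2 * (ENNReal.ofReal (R + 1) ^ 2 * ∫⁻ x, ‖f n x - f' x‖ₑ ^ 2 ∂μ)
        + 2 * ((ε : ℝ≥0∞) ^ 2 * ∫⁻ x, ‖f' x‖ₑ ^ 2 ∂μ) := by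
    intro ε hε
    -- Closeness within 1 keeps `|u n|` below `R + 1`; closeness within `ε` controls the term
    -- carrying `f'`.
    have h1 := Metric.tendstoUniformlyOn_iff.1 hu (min ε 1) (by positivity)
    filter_upwards [h1] with n hn
    calc ∫⁻ x, ‖u n x • f n x - u' x • f' x‖ₑ ^ 2 ∂μ
        ≤ ∫⁻ x, (2 * (ENNReal.ofReal (R + 1) ^ 2 * ‖f n x - f' x‖ₑ ^ 2)
          + 2 * ((ε : ℝ≥0∞) ^ 2 * ‖f' x‖ₑ ^ 2)) ∂μ := by
          refine lintegral_mono_ae ?_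
          filter_upwards [hs] with x hx
          have h2 := hn x hx
          have e : u n x • f n x - u' x • f' x
            = u n x • (f n x - f' x) + (u n x - u' x) • f' x := by
            rw [smul_sub, sub_smul]; abel
          rw [e]
          refine (enorm_add_sq_le _ _).trans ?_
          rw [enorm_smul, enorm_smul, mul_pow, mul_pow]
          rw [Real.dist_eq, abs_sub_comm] at h2
          have h3 : |u n x - u' x| ≤ ε := h2.le.trans (min_le_left _ _)
          have h4 : |u n x| ≤ R + 1 := by
            have h5 : |u n x - u' x| ≤ 1 := h2.le.trans (min_le_right _ _)
            have h6 := abs_add_le (u n x - u' x) (u' x)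
            rw [sub_add_cancel] at h6
            linarith [hR x hx]
          have h3' : ‖u n x - u' x‖ₑ ≤ ε := by
            rw [← ofReal_norm, Real.norm_eq_abs]
            exact (ENNReal.ofReal_le_ofReal h3).trans (by simp)
          have h4' : ‖u n x‖ₑ ≤ ENNReal.ofReal (R + 1) := by
            rw [← ofReal_norm, Real.norm_eq_abs]
            exact ENNReal.ofReal_le_ofReal h4
          gcongr
      _ = _ := by
          rw [lintegral_add_right' _ (((hf'.1.enorm.pow_const 2).const_mul _).const_mul _),
            lintegral_const_mul' _ _ (by simp), lintegral_const_mul' _ _ (by finiteness),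
            lintegral_const_mul' _ _ (by simp), lintegral_const_mul' _ _ (by finiteness)]
  rw [ENNReal.tendsto_nhds_zero]
  intro δ hδ
  set G := ∫⁻ x, ‖f' x‖ₑ ^ 2 ∂μ
  obtain ⟨ε, hε, hεδ⟩ : ∃ ε : ℝ≥0, 0 < ε ∧ 2 * ((ε : ℝ≥0∞) ^ 2 * G) ≤ δ / 2 := by
    have : Tendsto (fun ε : ℝ≥0∞ ↦ 2 * (ε ^ 2 * G)) (𝓝 0) (𝓝 0) := by
      have h : Tendsto (fun ε : ℝ≥0∞ ↦ 2 * (ε ^ 2 * G)) (𝓝 0) (𝓝 (2 * ((0 : ℝ≥0∞) ^ 2 * G))) :=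
        ENNReal.Tendsto.const_mul (ENNReal.Tendsto.mul_const
          ((ENNReal.continuous_pow 2).tendsto 0) (Or.inr hfin.ne)) (Or.inr (by simp))
      simpa using h
    have h2 := (ENNReal.tendsto_nhds_zero.1 this) (δ / 2) (by simp [hδ.ne'])
    rw [ENNReal.nhds_zero_basis.eventually_iff] at h2
    obtain ⟨a, ha, h3⟩ := h2
    obtain ⟨ε, h4, h5⟩ := ENNReal.lt_iff_exists_nnreal_btwn.1 ha
    exact ⟨ε, by exact_mod_cast h4, h3 h5⟩
  have h6 : Tendsto (fun n ↦ 2 * (ENNReal.ofReal (R + 1) ^ 2 * ∫⁻ x, ‖f n x - f' x‖ₑ ^ 2 ∂μ))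
      atTop (𝓝 0) := by
    simpa using ENNReal.Tendsto.const_mul (ENNReal.Tendsto.const_mul hf
      (Or.inr (by finiteness : ENNReal.ofReal (R + 1) ^ 2 ≠ ∞))) (Or.inr (by simp : (2 : ℝ≥0∞) ≠ ∞))
  filter_upwards [key ε hε, (ENNReal.tendsto_nhds_zero.1 h6) (δ / 2) (by simp [hδ.ne'])] with n h7 h8
  calc _ ≤ _ := h7
    _ ≤ δ / 2 + δ / 2 := add_le_add h8 hεδ
    _ = δ := ENNReal.add_halves δ

end L2

/-! ### Operations on simple processes -/

namespace SimpleProcess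

variable {𝓕 : Filtration ℝ≥0 mΩ}

/-- The sum of two simple processes. -/
def add (H K : SimpleProcess 𝓕 m) : SimpleProcess 𝓕 m where
  n := H.n + K.n
  left := Fin.append H.left K.left
  right := Fin.append H.right K.right
  left_le_right k := by
    refine Fin.addCases (fun i ↦ ?_) (fun i ↦ ?_) k
    · simpa using H.left_le_right i
    · simpa using K.left_le_right i
  ξ := Fin.append H.ξ K.ξ
  measurable_ξ k := by
    refine Fin.addCases (fun i ↦ ?_) (fun i ↦ ?_) k
    · rw [Fin.append_left, Fin.append_left]; exact H.measurable_ξ i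
    · rw [Fin.append_right, Fin.append_right]; exact K.measurable_ξ i
  bounded_ξ k := by
    refine Fin.addCases (fun i ↦ ?_) (fun i ↦ ?_) k
    · simpa using H.bounded_ξ i
    · simpa using K.bounded_ξ i

lemma add_eval (H K : SimpleProcess 𝓕 m) (s : ℝ≥0) (ω : Ω) :
    (H.add K).eval s ω = H.eval s ω + K.eval s ω := by
  refine (Fin.sum_univ_add (a := H.n) (b := K.n) _).trans ?_
  simp [eval, add]

lemma add_integral (H K : SimpleProcess 𝓕 m) (W : ℝ≥0 → Ω → Vec m) (t : ℝ≥0) (ω : Ω) :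
    (H.add K).integral W t ω = H.integral W t ω + K.integral W t ω := by
  refine (Fin.sum_univ_add (a := H.n) (b := K.n) _).trans ?_
  simp [integral, add]

/-- The zero process. -/
def zero : SimpleProcess 𝓕 m where
  n := 0
  left := Fin.elim0
  right := Fin.elim0
  left_le_right k := k.elim0
  ξ := fun k ↦ k.elim0
  measurable_ξ k := k.elim0
  bounded_ξ k := k.elim0

lemma zero_eval (s : ℝ≥0) (ω : Ω) : (zero : SimpleProcess 𝓕 m).eval s ω = 0 := by
  simp [eval, zero]

lemma zero_integral (W : ℝ≥0 → Ω → Vec m) (t : ℝ≥0) (ω : Ω) :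
    (zero : SimpleProcess 𝓕 m).integral W t ω = 0 := by
  simp [integral, zero]

/-- The process `ξ 1_{(l, r]}`. -/
def single (l r : ℝ≥0) (hlr : l ≤ r) (ξ : Ω → Vec m) (hξ : StronglyMeasurable[𝓕 l] ξ)
    (hb : ∃ c : ℝ, ∀ ω, ‖ξ ω‖ ≤ c) : SimpleProcess 𝓕 m where
  n := 1
  left := fun _ ↦ l
  right := fun _ ↦ r
  left_le_right _ := hlr
  ξ := fun _ ↦ ξ
  measurable_ξ _ := hξ
  bounded_ξ _ := hb

lemma single_eval {l r : ℝ≥0} (hlr : l ≤ r) {ξ : Ω → Vec m} (hξ : StronglyMeasurable[𝓕 l] ξ)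
    (hb : ∃ c : ℝ, ∀ ω, ‖ξ ω‖ ≤ c) (s : ℝ≥0) (ω : Ω) :
    (single l r hlr ξ hξ hb).eval s ω = (Set.Ioc l r).indicator (fun _ ↦ ξ ω) s := by
  simp only [eval, single]
  exact Fin.sum_univ_one _

lemma single_integral {l r : ℝ≥0} (hlr : l ≤ r) {ξ : Ω → Vec m} (hξ : StronglyMeasurable[𝓕 l] ξ)
    (hb : ∃ c : ℝ, ∀ ω, ‖ξ ω‖ ≤ c) (W : ℝ≥0 → Ω → Vec m) (t : ℝ≥0) (ω : Ω) :
    (single l r hlr ξ hξ hb).integral W t ω = inner ℝ (ξ ω) (W (min r t) ω - W (min l t) ω) := by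
  simp only [integral, single]
  exact Fin.sum_univ_one _

/-- The process `η 1_{(l, ∞)} H`. -/
def start (H : SimpleProcess 𝓕 m) (l : ℝ≥0) (η : Ω → ℝ) (hη : StronglyMeasurable[𝓕 l] η)
    (hb : ∃ c : ℝ, ∀ ω, |η ω| ≤ c) : SimpleProcess 𝓕 m where
  n := H.n
  left := fun k ↦ max (H.left k) l
  right := fun k ↦ max (H.right k) l
  left_le_right k := max_le_max_right _ (H.left_le_right k)
  ξ := fun k ω ↦ η ω • H.ξ k ω
  measurable_ξ k := (hη.mono (𝓕.mono (le_max_right _ _))).smul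
    ((H.measurable_ξ k).mono (𝓕.mono (le_max_left _ _)))
  bounded_ξ k := by
    obtain ⟨c, hc⟩ := hb
    obtain ⟨c', hc'⟩ := H.bounded_ξ k
    refine ⟨c * c', fun ω ↦ ?_⟩
    rw [norm_smul]
    exact mul_le_mul (hc ω) (hc' ω) (norm_nonneg _) ((abs_nonneg _).trans (hc ω))

lemma start_eval (H : SimpleProcess 𝓕 m) {l : ℝ≥0} {η : Ω → ℝ} (hη : StronglyMeasurable[𝓕 l] η)
    (hb : ∃ c : ℝ, ∀ ω, |η ω| ≤ c) (s : ℝ≥0) (ω : Ω) :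
    (H.start l η hη hb).eval s ω = (Set.Ioi l).indicator (fun _ ↦ η ω) s • H.eval s ω := by
  simp only [eval, start, Finset.smul_sum]
  refine Finset.sum_congr rfl fun k _ ↦ ?_
  simp only [Set.indicator_apply, Set.mem_Ioc, Set.mem_Ioi, max_lt_iff, le_max_iff]
  by_cases h : l < s
  · simp [h, not_le.2 h]
  · simp [h]

lemma start_integral (H : SimpleProcess 𝓕 m) {l : ℝ≥0} {η : Ω → ℝ}
    (hη : StronglyMeasurable[𝓕 l] η) (hb : ∃ c : ℝ, ∀ ω, |η ω| ≤ c) (W : ℝ≥0 → Ω → Vec m)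
    (t : ℝ≥0) (ω : Ω) :
    (H.start l η hη hb).integral W t ω
      = η ω * (H.integral W t ω - H.integral W (min l t) ω) := by
  simp only [integral, start, ← Finset.sum_sub_distrib, Finset.mul_sum]
  refine Finset.sum_congr rfl fun k _ ↦ ?_
  -- At both endpoints the same term `W (min l t)` appears, and it cancels in the difference.
  have key : ∀ u : ℝ≥0, W (min (max u l) t) ω = W (min u t) ω + W (min l t) ω
      - W (min u (min l t)) ω := by
    intro u
    rcases le_total u l with h | h
    · rw [max_eq_right h, ← min_assoc, min_eq_left h]; abel
    · rw [max_eq_left h, ← min_assoc, min_eq_right h]; abel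
  rw [key, key, real_inner_smul_left, ← inner_sub_right]
  congr 2
  abel

lemma integral_zero (H : SimpleProcess 𝓕 m) (W : ℝ≥0 → Ω → Vec m) (ω : Ω) :
    H.integral W 0 ω = 0 := by
  simp [integral]

lemma measurable_eval (H : SimpleProcess 𝓕 m) :
    StronglyMeasurable (fun z : ℝ≥0 × Ω ↦ H.eval z.1 z.2) := by
  unfold eval
  refine Finset.stronglyMeasurable_fun_sum _ fun k _ ↦ ?_
  have : (fun z : ℝ≥0 × Ω ↦ (Set.Ioc (H.left k) (H.right k)).indicator (fun _ ↦ H.ξ k z.2) z.1)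
      = (Set.Ioc (H.left k) (H.right k) ×ˢ (Set.univ : Set Ω)).indicator
        (fun z ↦ H.ξ k z.2) := by
    ext1 z; simp [Set.indicator_apply]
  rw [this]
  exact (((H.measurable_ξ k).mono (𝓕.le _)).comp_measurable measurable_snd).indicator
    (measurableSet_Ioc.prod MeasurableSet.univ)

lemma exists_bound (H : SimpleProcess 𝓕 m) : ∃ c : ℝ, 0 ≤ c ∧ ∀ s ω, ‖H.eval s ω‖ ≤ c := by
  choose c hc using H.bounded_ξ
  refine ⟨∑ k, |c k|, by positivity, fun s ω ↦ ?_⟩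
  refine (norm_sum_le _ _).trans (Finset.sum_le_sum fun k _ ↦ ?_)
  refine (norm_indicator_le_norm_self _ _).trans ((hc k ω).trans (le_abs_self _))

lemma memLp_eval (H : SimpleProcess 𝓕 m) (T : ℝ≥0) (ω : Ω) :
    MemLp (fun s ↦ H.eval s ω) 2 (leb T) := by
  obtain ⟨c, -, hc⟩ := H.exists_bound
  exact MemLp.of_bound (H.measurable_eval.comp_measurable measurable_prodMk_right).aestronglyMeasurable
    c (Eventually.of_forall fun s ↦ hc s ω)

lemma continuousOn_integral (H : SimpleProcess 𝓕 m) {W : ℝ≥0 → Ω → Vec m} {T : ℝ≥0} {ω : Ω}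
    (hW : ContinuousOn (fun t ↦ W t ω) (Set.Iic T)) :
    ContinuousOn (fun t ↦ H.integral W t ω) (Set.Iic T) := by
  unfold integral
  refine continuousOn_finsetSum _ fun k _ ↦ ?_
  have h : ∀ u : ℝ≥0, ContinuousOn (fun t ↦ W (min u t) ω) (Set.Iic T) := by
    intro u
    refine hW.comp (f := fun t ↦ min u t) (by fun_prop) ?_
    intro t ht
    exact (min_le_right u t).trans (Set.mem_Iic.1 ht)
  exact ContinuousOn.inner (𝕜 := ℝ) continuousOn_const ((h _).sub (h _))

/-- Intervals that begin after `t` contribute zero, so no coefficient `ξ` from the future enters. -/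
lemma stronglyMeasurable_integral (H : SimpleProcess 𝓕 m) {W : ℝ≥0 → Ω → Vec m}
    (hW : ∀ t, StronglyMeasurable[𝓕 t] (W t)) (t : ℝ≥0) :
    StronglyMeasurable[𝓕 t] (fun ω ↦ H.integral W t ω) := by
  unfold integral
  refine Finset.stronglyMeasurable_fun_sum _ fun k _ ↦ ?_
  rcases le_total (H.left k) t with h | h
  · exact ((H.measurable_ξ k).mono (𝓕.mono h)).inner
      (((hW _).mono (𝓕.mono (min_le_right _ _))).sub ((hW _).mono (𝓕.mono (min_le_right _ _))))
  · have : (fun ω ↦ inner ℝ (H.ξ k ω) (W (min (H.right k) t) ω - W (min (H.left k) t) ω))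
        = fun _ ↦ 0 := by
      ext ω
      rw [min_eq_right h, min_eq_right (h.trans (H.left_le_right k))]
      simp
    rw [this]
    exact stronglyMeasurable_const

end SimpleProcess

/-! ### Closure properties of the Itô integral -/

lemma tendsto_measure_zero_of_ae {P : Measure Ω} [IsFiniteMeasure P] {A : ℕ → Set Ω}
    (hA : ∀ n, MeasurableSet (A n)) (h : ∀ᵐ ω ∂P, ∀ᶠ n in atTop, ω ∉ A n) :
    Tendsto (fun n ↦ P (A n)) atTop (𝓝 0) := by
  have := tendsto_measure_of_ae_tendsto_indicator_of_isFiniteMeasure (μ := P) (L := atTop)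
    (A := ∅) (As := A) MeasurableSet.empty hA
    (by
      filter_upwards [h] with ω hω
      filter_upwards [hω] with n hn
      simp [hn])
  simpa using this

/-- A dense sequence in `[0, T]`. -/
def denseTimes (T : ℝ≥0) (j : ℕ) : ℝ≥0 :=
  (TopologicalSpace.denseSeq (Set.Iic T) j : Set.Iic T)

lemma denseTimes_le (T : ℝ≥0) (j : ℕ) : denseTimes T j ≤ T :=
  (TopologicalSpace.denseSeq (Set.Iic T) j).2

lemma abs_le_of_denseTimes {T : ℝ≥0} {u : ℝ≥0 → ℝ} (hu : ContinuousOn u (Set.Iic T)) {c : ℝ}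
    (h : ∀ j, |u (denseTimes T j)| ≤ c) {t : ℝ≥0} (ht : t ≤ T) : |u t| ≤ c := by
  have hc : IsClosed {x : Set.Iic T | |u x| ≤ c} :=
    isClosed_le (continuousOn_iff_continuous_domRestrict.1 hu).abs continuous_const
  exact (TopologicalSpace.denseRange_denseSeq (Set.Iic T)).induction_on
    (p := fun x : Set.Iic T ↦ |u x| ≤ c) ⟨t, ht⟩ hc h


variable {𝓕 : Filtration ℝ≥0 mΩ} {P : Measure Ω} [IsProbabilityMeasure P] {T : ℝ≥0}
  {W : ℝ≥0 → Ω → Vec m} {H K : ℝ≥0 → Ω → Vec m} {I J : ℝ≥0 → Ω → ℝ}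

/-- `H` is only known pathwise, so the set in question need not be measurable. The Cauchy tails `E
n`, built from simple processes alone, are measurable and tend to zero almost surely; letting the
second index tend to infinity bounds the distance to `H` by `2 * E n`. -/
lemma tendsto_measure_lintegral_sq
    (hH : ∀ᵐ ω ∂P, MemLp (fun s ↦ H s ω) 2 (leb T)) (Hn : ℕ → SimpleProcess 𝓕 m)
    (h1 : ∀ᵐ ω ∂P, Tendsto (fun n ↦ ∫⁻ s, ‖(Hn n).eval s ω - H s ω‖ₑ ^ 2 ∂(leb T)) atTop (𝓝 0))
    (ε : ℝ≥0∞) (hε : 0 < ε) :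
    Tendsto (fun n ↦ P {ω | ε ≤ ∫⁻ s, ‖(Hn n).eval s ω - H s ω‖ₑ ^ 2 ∂(leb T)})
      atTop (𝓝 0) := by
  let E : ℕ → Ω → ℝ≥0∞ := fun n ω ↦
    ⨆ k : ℕ, ∫⁻ s, ‖(Hn n).eval s ω - (Hn (n + k)).eval s ω‖ₑ ^ 2 ∂(leb T)
  have hEm : ∀ n, Measurable (E n) := by
    intro n
    refine Measurable.iSup fun k ↦ ?_
    have h : Measurable (fun z : ℝ≥0 × Ω ↦
        ‖(Hn n).eval z.1 z.2 - (Hn (n + k)).eval z.1 z.2‖ₑ ^ 2) :=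
      (((Hn n).measurable_eval.sub (Hn (n + k)).measurable_eval).enorm).pow_const 2
    exact h.lintegral_prod_left'
  have key : Tendsto (fun n ↦ P {ω | ε / 2 ≤ 2 * E n ω}) atTop (𝓝 0) := by
    refine tendsto_measure_zero_of_ae
      (fun n ↦ measurableSet_le measurable_const ((hEm n).const_mul 2)) ?_
    filter_upwards [h1, hH] with ω hω hHω
    -- The minimum with 1 is there because `ε` may be infinite. The two estimates of the tail and
    -- the factor in front add up to 8, so 16 leaves a strict margin.
    have hh : 0 < min ε 1 / 2 / 16 := by simp [hε.ne']
    have h3 := eventually_atTop.1 ((tendsto_order.1 hω).2 _ hh)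
    obtain ⟨N, hN⟩ := h3
    filter_upwards [eventually_ge_atTop N] with n hn
    simp only [not_le]
    have h4 : E n ω ≤ 2 * (min ε 1 / 2 / 16) + 2 * (min ε 1 / 2 / 16) := by
      refine iSup_le fun k ↦ ?_
      have e : ∀ s, (Hn n).eval s ω - (Hn (n + k)).eval s ω =
          ((Hn n).eval s ω - H s ω) + (H s ω - (Hn (n + k)).eval s ω) := by intro s; abel
      simp_rw [e]
      refine (lintegral_enorm_add_sq_le (g := fun s ↦ H s ω - (Hn (n + k)).eval s ω)
        (hHω.1.sub ((Hn (n + k)).memLp_eval T ω).1)).trans ?_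
      simp_rw [enorm_sub_rev (H _ ω)]
      gcongr
      · exact (hN n hn).le
      · exact (hN (n + k) (by omega)).le
    calc 2 * E n ω ≤ 2 * (2 * (min ε 1 / 2 / 16) + 2 * (min ε 1 / 2 / 16)) := by gcongr
      _ = 8 * (min ε 1 / 2 / 16) := by ring
      _ < 16 * (min ε 1 / 2 / 16) := by
        refine ENNReal.mul_lt_mul_left (hh.ne') ?_ (by norm_num)
        have : min ε 1 ≤ 1 := min_le_right _ _
        have h5 : min ε 1 ≠ ∞ := (this.trans_lt (by simp)).ne
        finiteness
      _ = min ε 1 / 2 := ENNReal.mul_div_cancel (by norm_num) (by norm_num)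
      _ ≤ ε / 2 := by gcongr; exact min_le_left _ _
  refine tendsto_of_tendsto_of_tendsto_of_le_of_le tendsto_const_nhds key (fun _ ↦ zero_le) ?_
  intro n
  refine measure_mono_ae ?_
  filter_upwards [h1, hH] with ω hω hHω
  change ε ≤ _ → ε / 2 ≤ _
  intro hle
  refine (ENNReal.half_le_self).trans (hle.trans ?_)
  have h6 : Tendsto (fun k ↦ 2 * E n ω
      + 2 * ∫⁻ s, ‖(Hn (n + k)).eval s ω - H s ω‖ₑ ^ 2 ∂(leb T)) atTop (𝓝 (2 * E n ω + 2 * 0)) := by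
    refine tendsto_const_nhds.add (ENNReal.Tendsto.const_mul ?_ (Or.inr (by simp)))
    exact hω.comp (tendsto_add_atTop_nat n |>.congr fun k ↦ add_comm _ _)
  rw [mul_zero, add_zero] at h6
  refine ge_of_tendsto' h6 fun k ↦ ?_
  have e : ∀ s, (Hn n).eval s ω - H s ω =
      ((Hn n).eval s ω - (Hn (n + k)).eval s ω) + ((Hn (n + k)).eval s ω - H s ω) := by
    intro s; abel
  simp_rw [e]
  refine (lintegral_enorm_add_sq_le (g := fun s ↦ (Hn (n + k)).eval s ω - H s ω)
    (((Hn (n + k)).memLp_eval T ω).1.sub hHω.1)).trans ?_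
  gcongr
  exact le_iSup (fun k : ℕ ↦ ∫⁻ s, ‖(Hn n).eval s ω - (Hn (n + k)).eval s ω‖ₑ ^ 2 ∂(leb T)) k

/-- As before, `I` is replaced by later members of the sequence, and path continuity reduces the
supremum over `t` to a countable dense set of times. This gives measurable sets `A n` that contain
the given ones up to null sets. -/
lemma tendsto_measure_sup_abs (hWc : ∀ᵐ ω ∂P, ContinuousOn (fun t ↦ W t ω) (Set.Iic T))
    (hWa : ∀ t, StronglyMeasurable[𝓕 t] (W t)) (Hn : ℕ → SimpleProcess 𝓕 m)
    (h2 : ∀ᵐ ω ∂P, TendstoUniformlyOn (fun n t ↦ (Hn n).integral W t ω) (fun t ↦ I t ω)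
      atTop (Set.Iic T)) (ε : ℝ) (hε : 0 < ε) :
    Tendsto (fun n ↦ P {ω | ∃ t ≤ T, ε ≤ |(Hn n).integral W t ω - I t ω|}) atTop (𝓝 0) := by
  let A : ℕ → Set Ω := fun n ↦ ⋃ k : ℕ, ⋃ j : ℕ,
    {ω | ε / 2 ≤ |(Hn n).integral W (denseTimes T j) ω - (Hn (n + k)).integral W (denseTimes T j) ω|}
  have hAm : ∀ n, MeasurableSet (A n) := by
    intro n
    refine MeasurableSet.iUnion fun k ↦ MeasurableSet.iUnion fun j ↦ ?_
    refine measurableSet_le measurable_const ?_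
    have h := fun n ↦ (((Hn n).stronglyMeasurable_integral hWa (denseTimes T j)).mono
      (𝓕.le _)).measurable
    exact ((h n).sub (h (n + k))).abs
  have key : Tendsto (fun n ↦ P (A n)) atTop (𝓝 0) := by
    refine tendsto_measure_zero_of_ae hAm ?_
    filter_upwards [h2] with ω hω
    obtain ⟨N, hN⟩ := eventually_atTop.1 (Metric.tendstoUniformlyOn_iff.1 hω (ε / 4) (by positivity))
    filter_upwards [eventually_ge_atTop N] with n hn
    simp only [A, Set.mem_iUnion, Set.mem_ofPred_eq, not_exists, not_le]
    intro k j
    have h3 := hN n hn _ (denseTimes_le T j)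
    have h4 := hN (n + k) (by omega) _ (denseTimes_le T j)
    rw [Real.dist_eq] at h3 h4
    rw [abs_lt] at *
    constructor <;> linarith [h3.1, h3.2, h4.1, h4.2]
  refine tendsto_of_tendsto_of_tendsto_of_le_of_le tendsto_const_nhds key (fun _ ↦ zero_le) ?_
  intro n
  refine measure_mono_ae ?_
  filter_upwards [h2, hWc] with ω hω hc
  change (∃ t ≤ T, _) → ω ∈ A n
  rintro ⟨t, ht, hle⟩
  by_contra hcon
  simp only [A, Set.mem_iUnion, Set.mem_ofPred_eq, not_exists, not_le] at hcon
  obtain ⟨N, hN⟩ := eventually_atTop.1 (Metric.tendstoUniformlyOn_iff.1 hω (ε / 4) (by positivity))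
  have h3 := hN (n + N) (by omega) t ht
  have h4 : |(Hn n).integral W t ω - (Hn (n + N)).integral W t ω| ≤ ε / 2 :=
    abs_le_of_denseTimes (((Hn n).continuousOn_integral hc).sub
      ((Hn (n + N)).continuousOn_integral hc)) (fun j ↦ (hcon N j).le) ht
  rw [Real.dist_eq] at h3
  have h5 := abs_sub_le ((Hn n).integral W t ω) ((Hn (n + N)).integral W t ω) (I t ω)
  rw [abs_sub_comm (I t ω)] at h3
  linarith

lemma isItoIntegral_of_simple_tendsto (hWc : ∀ᵐ ω ∂P, ContinuousOn (fun t ↦ W t ω) (Set.Iic T))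
    (hWa : ∀ t, StronglyMeasurable[𝓕 t] (W t))
    (hH : ∀ᵐ ω ∂P, MemLp (fun s ↦ H s ω) 2 (leb T)) (Hn : ℕ → SimpleProcess 𝓕 m)
    (h1 : ∀ᵐ ω ∂P, Tendsto (fun n ↦ ∫⁻ s, ‖(Hn n).eval s ω - H s ω‖ₑ ^ 2 ∂(leb T)) atTop (𝓝 0))
    (h2 : ∀ᵐ ω ∂P, TendstoUniformlyOn (fun n t ↦ (Hn n).integral W t ω) (fun t ↦ I t ω)
      atTop (Set.Iic T)) :
    IsItoIntegral 𝓕 P T W H I :=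
  ⟨hH, Hn, tendsto_measure_lintegral_sq hH Hn h1, tendsto_measure_sup_abs hWc hWa Hn h2⟩

lemma IsItoIntegral.exists_near (h : IsItoIntegral 𝓕 P T W H I) {δ : ℝ} (hδ : 0 < δ) :
    ∃ K : SimpleProcess 𝓕 m,
      P {ω | ENNReal.ofReal δ ≤ ∫⁻ s, ‖K.eval s ω - H s ω‖ₑ ^ 2 ∂(leb T)} ≤ ENNReal.ofReal δ ∧
      P {ω | ∃ t ≤ T, δ ≤ |K.integral W t ω - I t ω|} ≤ ENNReal.ofReal δ := by
  obtain ⟨Hn, h1, h2⟩ := h.approx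
  have hδ' : 0 < ENNReal.ofReal δ := by simpa using hδ
  have h3 := ENNReal.tendsto_nhds_zero.1 (h1 _ hδ') _ hδ'
  have h4 := ENNReal.tendsto_nhds_zero.1 (h2 _ hδ) _ hδ'
  obtain ⟨n, hn⟩ := (h3.and h4).exists
  exact ⟨Hn n, hn⟩

lemma tsum_ofReal_half_pow_ne_top : ∑' n : ℕ, ENNReal.ofReal ((1 / 2) ^ n) ≠ ∞ := by
  rw [← ENNReal.ofReal_tsum_of_nonneg (fun n ↦ by positivity) summable_geometric_two]
  exact ENNReal.ofReal_ne_top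

/-- Diagonal choice of simple approximations of a sequence of Itô integrals. -/
lemma exists_simple_diagonal {Hn : ℕ → ℝ≥0 → Ω → Vec m} {In : ℕ → ℝ≥0 → Ω → ℝ}
    (h : ∀ n, IsItoIntegral 𝓕 P T W (Hn n) (In n)) :
    ∃ Kn : ℕ → SimpleProcess 𝓕 m,
      (∀ᵐ ω ∂P, Tendsto (fun n ↦ ∫⁻ s, ‖(Kn n).eval s ω - Hn n s ω‖ₑ ^ 2 ∂(leb T))
        atTop (𝓝 0)) ∧
      ∀ᵐ ω ∂P, ∀ᶠ n in atTop, ∀ t ≤ T, |(Kn n).integral W t ω - In n t ω| < (1 / 2) ^ n := by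
  -- Using `(1/2)^n` both as the tolerance and as the exceptional probability makes the
  -- probabilities summable, so Borel–Cantelli applies.
  choose Kn h1 h2 using fun n : ℕ ↦ (h n).exists_near (δ := (1 / 2) ^ n) (by positivity)
  refine ⟨Kn, ?_, ?_⟩
  · have h3 := ae_eventually_notMem (μ := P) (s := fun n ↦ {ω | ENNReal.ofReal ((1 / 2) ^ n) ≤
        ∫⁻ s, ‖(Kn n).eval s ω - Hn n s ω‖ₑ ^ 2 ∂(leb T)})
      (ne_top_of_le_ne_top tsum_ofReal_half_pow_ne_top (ENNReal.tsum_le_tsum h1))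
    filter_upwards [h3] with ω hω
    have h4 : Tendsto (fun n : ℕ ↦ ENNReal.ofReal ((1 / 2) ^ n)) atTop (𝓝 0) := by
      rw [← ENNReal.ofReal_zero]
      exact ENNReal.tendsto_ofReal
        (tendsto_pow_atTop_nhds_zero_of_lt_one (by norm_num) (by norm_num))
    refine tendsto_of_tendsto_of_tendsto_of_le_of_le' tendsto_const_nhds h4
      (Eventually.of_forall fun _ ↦ zero_le) ?_
    filter_upwards [hω] with n hn
    simp only [not_le] at hn
    exact hn.le
  · have h3 := ae_eventually_notMem (μ := P)
      (s := fun n ↦ {ω | ∃ t ≤ T, (1 / 2) ^ n ≤ |(Kn n).integral W t ω - In n t ω|})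
      (ne_top_of_le_ne_top tsum_ofReal_half_pow_ne_top (ENNReal.tsum_le_tsum h2))
    filter_upwards [h3] with ω hω
    filter_upwards [hω] with n hn
    simp only [not_exists, not_and, not_le] at hn
    exact hn

lemma tendstoUniformlyOn_of_close {u v : ℕ → ℝ≥0 → ℝ} {w : ℝ≥0 → ℝ} {s : Set ℝ≥0}
    (h : ∀ᶠ n in atTop, ∀ t ∈ s, |u n t - v n t| < (1 / 2) ^ n)
    (hv : TendstoUniformlyOn v w atTop s) : TendstoUniformlyOn u w atTop s := by
  rw [Metric.tendstoUniformlyOn_iff] at *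
  intro ε hε
  have h4 : Tendsto (fun n : ℕ ↦ ((1 : ℝ) / 2) ^ n) atTop (𝓝 0) :=
    tendsto_pow_atTop_nhds_zero_of_lt_one (by norm_num) (by norm_num)
  filter_upwards [h, hv (ε / 2) (by positivity), (tendsto_order.1 h4).2 (ε / 2) (by positivity)]
    with n h1 h2 h3 t ht
  have h5 := h1 t ht
  have h6 := h2 t ht
  rw [Real.dist_eq] at *
  rw [abs_lt] at *
  constructor <;> linarith [h5.1, h5.2, h6.1, h6.2]

/-- The Itô integral is closed under almost sure limits. -/
theorem isItoIntegral_of_tendsto (hWc : ∀ᵐ ω ∂P, ContinuousOn (fun t ↦ W t ω) (Set.Iic T))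
    (hWa : ∀ t, StronglyMeasurable[𝓕 t] (W t))
    {Hn : ℕ → ℝ≥0 → Ω → Vec m} {In : ℕ → ℝ≥0 → Ω → ℝ}
    (h : ∀ n, IsItoIntegral 𝓕 P T W (Hn n) (In n))
    (hH : ∀ᵐ ω ∂P, MemLp (fun s ↦ H s ω) 2 (leb T))
    (h1 : ∀ᵐ ω ∂P, Tendsto (fun n ↦ ∫⁻ s, ‖Hn n s ω - H s ω‖ₑ ^ 2 ∂(leb T)) atTop (𝓝 0))
    (h2 : ∀ᵐ ω ∂P, TendstoUniformlyOn (fun n t ↦ In n t ω) (fun t ↦ I t ω)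
      atTop (Set.Iic T)) :
    IsItoIntegral 𝓕 P T W H I := by
  obtain ⟨Kn, h3, h4⟩ := exists_simple_diagonal h
  refine isItoIntegral_of_simple_tendsto hWc hWa hH Kn ?_ ?_
  · filter_upwards [h1, h3, hH, ae_all_iff.2 fun n ↦ (h n).sq_integrable] with ω h1 h3 hH hn
    have := tendsto_lintegral_sq_add (μ := leb T) (f := fun n s ↦ (Kn n).eval s ω - Hn n s ω)
      (f' := fun _ ↦ 0) (g := fun n s ↦ Hn n s ω) (g' := fun s ↦ H s ω) (by simpa using h3) h1
      (fun n ↦ (hn n).1.sub hH.1)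
    simpa using this
  · filter_upwards [h2, h4] with ω h2 h4
    exact tendstoUniformlyOn_of_close h4 h2

/-- The diagonal choice applied to a constant sequence upgrades convergence in probability to almost
sure convergence. All pathwise arguments below rest on this. -/
lemma IsItoIntegral.exists_simple_tendsto (h : IsItoIntegral 𝓕 P T W H I) :
    ∃ Hn : ℕ → SimpleProcess 𝓕 m,
      (∀ᵐ ω ∂P, Tendsto (fun n ↦ ∫⁻ s, ‖(Hn n).eval s ω - H s ω‖ₑ ^ 2 ∂(leb T))
        atTop (𝓝 0)) ∧
      ∀ᵐ ω ∂P, TendstoUniformlyOn (fun n t ↦ (Hn n).integral W t ω) (fun t ↦ I t ω)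
        atTop (Set.Iic T) := by
  obtain ⟨Kn, h3, h4⟩ := exists_simple_diagonal fun _ : ℕ ↦ h
  refine ⟨Kn, h3, ?_⟩
  filter_upwards [h4] with ω h4
  refine tendstoUniformlyOn_of_close h4 ?_
  rw [Metric.tendstoUniformlyOn_iff]
  intro ε hε
  simp [hε]

lemma IsItoIntegral.continuousOn (h : IsItoIntegral 𝓕 P T W H I)
    (hWc : ∀ᵐ ω ∂P, ContinuousOn (fun t ↦ W t ω) (Set.Iic T)) :
    ∀ᵐ ω ∂P, ContinuousOn (fun t ↦ I t ω) (Set.Iic T) := by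
  obtain ⟨Kn, -, h4⟩ := h.exists_simple_tendsto
  filter_upwards [h4, hWc] with ω h4 hc
  exact h4.continuousOn (Frequently.of_forall fun n ↦ (Kn n).continuousOn_integral hc)

lemma IsItoIntegral.zero_ae (h : IsItoIntegral 𝓕 P T W H I) : ∀ᵐ ω ∂P, I 0 ω = 0 := by
  obtain ⟨Kn, -, h4⟩ := h.exists_simple_tendsto
  filter_upwards [h4] with ω h4
  have := h4.tendsto_at (x := 0) (by simp)
  simp only [SimpleProcess.integral_zero] at this
  exact tendsto_nhds_unique this tendsto_const_nhds

/-- Measurability for the smaller σ-algebra is kept by choosing versions measurable for it and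
taking their limsup. -/
lemma aestronglyMeasurable_of_ae_tendsto {m' : MeasurableSpace Ω} {f : ℕ → Ω → ℝ} {g : Ω → ℝ}
    (hf : ∀ n, AEStronglyMeasurable[m'] (f n) P)
    (lim : ∀ᵐ ω ∂P, Tendsto (fun n ↦ f n ω) atTop (𝓝 (g ω))) : AEStronglyMeasurable[m'] g P := by
  choose f' hf' hff' using hf
  refine ⟨fun ω ↦ limsup (fun n ↦ f' n ω) atTop,
    (Measurable.limsup fun n ↦ (hf' n).measurable).stronglyMeasurable, ?_⟩
  filter_upwards [lim, ae_all_iff.2 hff'] with ω h1 h2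
  simp only [h2] at h1
  exact h1.limsup_eq.symm

lemma IsItoIntegral.aestronglyMeasurable (h : IsItoIntegral 𝓕 P T W H I)
    (hWa : ∀ t, StronglyMeasurable[𝓕 t] (W t)) {t : ℝ≥0} (ht : t ≤ T) :
    AEStronglyMeasurable[𝓕 t] (fun ω ↦ I t ω) P := by
  obtain ⟨Kn, -, h4⟩ := h.exists_simple_tendsto
  refine aestronglyMeasurable_of_ae_tendsto (f := fun n ω ↦ (Kn n).integral W t ω)
    (fun n ↦ ⟨_, (Kn n).stronglyMeasurable_integral hWa t, EventuallyEq.rfl⟩) ?_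
  filter_upwards [h4] with ω h4
  exact h4.tendsto_at ht

lemma SimpleProcess.isItoIntegral (H : SimpleProcess 𝓕 m) :
    IsItoIntegral 𝓕 P T W H.eval (H.integral W) := by
  refine ⟨Eventually.of_forall fun ω ↦ H.memLp_eval T ω, fun _ ↦ H, ?_, ?_⟩
  · intro ε hε
    simp [not_le.2 hε]
  · intro ε hε
    simp [not_le.2 hε]

lemma IsItoIntegral.congr (h : IsItoIntegral 𝓕 P T W H I)
    (hH : ∀ᵐ ω ∂P, ∀ᵐ s ∂(leb T), H s ω = K s ω) (hI : ∀ᵐ ω ∂P, ∀ t ≤ T, I t ω = J t ω) :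
    IsItoIntegral 𝓕 P T W K J := by
  obtain ⟨Hn, h1, h2⟩ := h.approx
  refine ⟨?_, Hn, fun ε hε ↦ ?_, fun ε hε ↦ ?_⟩
  · filter_upwards [h.sq_integrable, hH] with ω h hH
    exact h.ae_eq hH
  · refine (h1 ε hε).congr fun n ↦ measure_congr ?_
    filter_upwards [hH] with ω hH
    have : ∫⁻ s, ‖(Hn n).eval s ω - H s ω‖ₑ ^ 2 ∂(leb T)
        = ∫⁻ s, ‖(Hn n).eval s ω - K s ω‖ₑ ^ 2 ∂(leb T) := by
      refine lintegral_congr_ae ?_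
      filter_upwards [hH] with s hs
      rw [hs]
    change (ε ≤ _) = (ε ≤ _)
    rw [this]
  · refine (h2 ε hε).congr fun n ↦ measure_congr ?_
    filter_upwards [hI] with ω hI
    change (∃ t ≤ T, _) = (∃ t ≤ T, _)
    simp only [eq_iff_iff]
    refine exists_congr fun t ↦ and_congr_right fun ht ↦ ?_
    rw [hI t ht]

lemma IsItoIntegral.add (hWc : ∀ᵐ ω ∂P, ContinuousOn (fun t ↦ W t ω) (Set.Iic T))
    (hWa : ∀ t, StronglyMeasurable[𝓕 t] (W t)) (h : IsItoIntegral 𝓕 P T W H I)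
    (h' : IsItoIntegral 𝓕 P T W K J) :
    IsItoIntegral 𝓕 P T W (fun s ω ↦ H s ω + K s ω) (fun t ω ↦ I t ω + J t ω) := by
  obtain ⟨Hn, h1, h2⟩ := h.exists_simple_tendsto
  obtain ⟨Kn, h3, h4⟩ := h'.exists_simple_tendsto
  refine isItoIntegral_of_simple_tendsto hWc hWa ?_ (fun n ↦ (Hn n).add (Kn n)) ?_ ?_
  · filter_upwards [h.sq_integrable, h'.sq_integrable] with ω h h' using h.add h'
  · filter_upwards [h1, h3, h'.sq_integrable] with ω h1 h3 h'
    simp only [SimpleProcess.add_eval]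
    exact tendsto_lintegral_sq_add h1 h3 fun n ↦ ((Kn n).memLp_eval T ω).1.sub h'.1
  · filter_upwards [h2, h4] with ω h2 h4
    simp only [SimpleProcess.add_integral]
    exact h2.add h4

lemma isItoIntegral_zero : IsItoIntegral 𝓕 P T W (fun _ _ ↦ 0) (fun _ _ ↦ 0) := by
  refine (SimpleProcess.zero : SimpleProcess 𝓕 m).isItoIntegral.congr ?_ ?_
  · simp [SimpleProcess.zero_eval]
  · simp [SimpleProcess.zero_integral]

lemma IsItoIntegral.sum (hWc : ∀ᵐ ω ∂P, ContinuousOn (fun t ↦ W t ω) (Set.Iic T))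
    (hWa : ∀ t, StronglyMeasurable[𝓕 t] (W t)) {ι : Type*} (S : Finset ι)
    {Hn : ι → ℝ≥0 → Ω → Vec m} {In : ι → ℝ≥0 → Ω → ℝ}
    (h : ∀ i ∈ S, IsItoIntegral 𝓕 P T W (Hn i) (In i)) :
    IsItoIntegral 𝓕 P T W (fun s ω ↦ ∑ i ∈ S, Hn i s ω) (fun t ω ↦ ∑ i ∈ S, In i t ω) := by
  classical
  induction S using Finset.induction_on with
  | empty => simpa using isItoIntegral_zero
  | insert a S ha ih =>
    simp only [Finset.sum_insert ha]
    exact (h a (by simp)).add hWc hWa (ih fun i hi ↦ h i (by simp [hi]))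

lemma tendstoUniformlyOn_const_mul {u : ℕ → ℝ≥0 → ℝ} {w : ℝ≥0 → ℝ} {s : Set ℝ≥0}
    (h : TendstoUniformlyOn u w atTop s) (c : ℝ) :
    TendstoUniformlyOn (fun n t ↦ c * u n t) (fun t ↦ c * w t) atTop s := by
  have : UniformContinuous (fun x : ℝ ↦ c * x) := by
    simpa using (uniformContinuous_const_smul (M := ℝ) (X := ℝ) c)
  exact this.comp_tendstoUniformlyOn h

lemma memLp_indicator_smul {l T : ℝ≥0} (c : ℝ) {f : ℝ≥0 → Vec m} (hf : MemLp f 2 (leb T)) :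
    MemLp (fun s ↦ (Set.Ioi l).indicator (fun _ ↦ c) s • f s) 2 (leb T) := by
  have : (fun s ↦ (Set.Ioi l).indicator (fun _ ↦ c) s • f s)
      = (Set.Ioi l).indicator (fun s ↦ c • f s) := by
    ext1 s; by_cases h : s ∈ Set.Ioi l <;> simp [h]
  rw [this]
  exact (hf.const_smul c).indicator measurableSet_Ioi

lemma IsItoIntegral.start_of_bounded (hWc : ∀ᵐ ω ∂P, ContinuousOn (fun t ↦ W t ω) (Set.Iic T))
    (hWa : ∀ t, StronglyMeasurable[𝓕 t] (W t)) (h : IsItoIntegral 𝓕 P T W H I) {l : ℝ≥0}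
    {η : Ω → ℝ} (hη : StronglyMeasurable[𝓕 l] η) (hb : ∃ c : ℝ, ∀ ω, |η ω| ≤ c) :
    IsItoIntegral 𝓕 P T W (fun s ω ↦ (Set.Ioi l).indicator (fun _ ↦ η ω) s • H s ω)
      (fun t ω ↦ η ω * (I t ω - I (min l t) ω)) := by
  obtain ⟨Hn, h1, h2⟩ := h.exists_simple_tendsto
  have hind : ∀ ω s, ‖(Set.Ioi l).indicator (fun _ ↦ η ω) s‖ ≤ |η ω| := fun ω s ↦
    norm_indicator_le_norm_self (fun _ ↦ η ω) s
  refine isItoIntegral_of_simple_tendsto hWc hWa ?_ (fun n ↦ (Hn n).start l η hη hb) ?_ ?_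
  · filter_upwards [h.sq_integrable] with ω h using memLp_indicator_smul _ h
  · filter_upwards [h1, h.sq_integrable] with ω h1 hH
    simp only [SimpleProcess.start_eval]
    refine tendsto_lintegral_sq_smul (s := Set.univ) (by simp)
      (u := fun _ s ↦ (Set.Ioi l).indicator (fun _ ↦ η ω) s) ?_ (fun x _ ↦ hind ω x) h1 hH
    rw [Metric.tendstoUniformlyOn_iff]
    intro ε hε
    simp [hε]
  · filter_upwards [h2] with ω h2
    simp only [SimpleProcess.start_integral]
    refine tendstoUniformlyOn_const_mul ?_ _
    refine h2.sub ?_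
    exact (h2.comp (fun t ↦ min l t)).mono fun t ht ↦ (min_le_right l t).trans (Set.mem_Iic.1 ht)

/-- `∫ η 1_{(l, ∞)} H dW = η (∫ H dW - ∫_0^{l ∧ ·} H dW)` for `η` measurable at time `l`. -/
lemma IsItoIntegral.start (hWc : ∀ᵐ ω ∂P, ContinuousOn (fun t ↦ W t ω) (Set.Iic T))
    (hWa : ∀ t, StronglyMeasurable[𝓕 t] (W t)) (h : IsItoIntegral 𝓕 P T W H I) {l : ℝ≥0}
    {η : Ω → ℝ} (hη : AEStronglyMeasurable[𝓕 l] η P) :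
    IsItoIntegral 𝓕 P T W (fun s ω ↦ (Set.Ioi l).indicator (fun _ ↦ η ω) s • H s ω)
      (fun t ω ↦ η ω * (I t ω - I (min l t) ω)) := by
  obtain ⟨η', hη', hηη'⟩ := hη
  -- Truncation at level `n` gives a bounded multiplier which, at almost every `ω`, equals `η` from
  -- some `n` on. All the limits required are therefore eventually constant.
  let c : ℕ → Ω → ℝ := fun n ω ↦ max (-n) (min n (η' ω))
  have hc : ∀ n, StronglyMeasurable[𝓕 l] (c n) := fun n ↦
    (continuous_const.max (continuous_const.min continuous_id)).comp_stronglyMeasurable hη'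
  have hcb : ∀ n, ∃ r : ℝ, ∀ ω, |c n ω| ≤ r := fun n ↦ ⟨n, fun ω ↦ by
    rw [abs_le]
    exact ⟨le_max_left _ _, max_le (by simp) (min_le_left _ _)⟩⟩
  have hce : ∀ᵐ ω ∂P, ∀ᶠ n in atTop, c n ω = η ω := by
    filter_upwards [hηη'] with ω hω
    obtain ⟨N, hN⟩ := exists_nat_ge |η' ω|
    filter_upwards [eventually_ge_atTop N] with n hn
    have h1 : |η' ω| ≤ n := hN.trans (by exact_mod_cast hn)
    rw [abs_le] at h1
    simp only [c]
    rw [min_eq_right h1.2, max_eq_right h1.1, hω]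
  refine isItoIntegral_of_tendsto hWc hWa (fun n ↦ h.start_of_bounded hWc hWa (hc n) (hcb n)) ?_ ?_ ?_
  · filter_upwards [h.sq_integrable] with ω h using memLp_indicator_smul _ h
  · filter_upwards [hce] with ω hω
    refine Tendsto.congr' (f₁ := fun _ ↦ 0) ?_ tendsto_const_nhds
    filter_upwards [hω] with n hn
    simp [hn]
  · filter_upwards [hce] with ω hω
    rw [Metric.tendstoUniformlyOn_iff]
    intro ε hε
    filter_upwards [hω] with n hn
    simp [hn, hε]

/-! ### Riemann sums along uniform grids -/

/-- The points of the uniform grid of `[0, T]` with `8 ^ n` cells. -/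
def gridPt (T : ℝ≥0) (n k : ℕ) : ℝ≥0 := T * k / 8 ^ n

/-- The process frozen at the left endpoints of the grid cells. -/
def stepProc (T : ℝ≥0) (n : ℕ) (X : ℝ≥0 → ℝ) (s : ℝ≥0) : ℝ :=
  ∑ k ∈ Finset.range (8 ^ n),
    (Set.Ioc (gridPt T n k) (gridPt T n (k + 1))).indicator (fun _ ↦ X (gridPt T n k)) s

/-- The Riemann sum approximation of `∫ X dY`. -/
def riemannSum (T : ℝ≥0) (n : ℕ) (X Y : ℝ≥0 → ℝ) (t : ℝ≥0) : ℝ :=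
  ∑ k ∈ Finset.range (8 ^ n),
    X (gridPt T n k) * (Y (min (gridPt T n (k + 1)) t) - Y (min (gridPt T n k) t))

/-- The sum of products of increments along the grid. -/
def crossSum (T : ℝ≥0) (n : ℕ) (X Y : ℝ≥0 → ℝ) (t : ℝ≥0) : ℝ :=
  ∑ k ∈ Finset.range (8 ^ n),
    (X (min (gridPt T n (k + 1)) t) - X (min (gridPt T n k) t)) *
      (Y (min (gridPt T n (k + 1)) t) - Y (min (gridPt T n k) t))

lemma gridPt_zero (T : ℝ≥0) (n : ℕ) : gridPt T n 0 = 0 := by simp [gridPt]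

lemma gridPt_last (T : ℝ≥0) (n : ℕ) : gridPt T n (8 ^ n) = T := by
  simp only [gridPt, Nat.cast_pow, Nat.cast_ofNat]
  exact mul_div_cancel_right₀ T (by positivity)

lemma gridPt_mono (T : ℝ≥0) (n : ℕ) : Monotone (gridPt T n) := by
  intro a b hab
  unfold gridPt
  gcongr

lemma gridPt_le {T : ℝ≥0} {n k : ℕ} (hk : k ≤ 8 ^ n) : gridPt T n k ≤ T :=
  (gridPt_mono T n hk).trans (gridPt_last T n).le

lemma gridPt_succ_sub (T : ℝ≥0) (n k : ℕ) :
    (gridPt T n (k + 1) : ℝ) - gridPt T n k = T / 8 ^ n := by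
  simp only [gridPt]
  push_cast
  ring

lemma sum_grid_increments {E : Type*} [AddCommGroup E] {T : ℝ≥0} (n : ℕ) (Y : ℝ≥0 → E) {t : ℝ≥0}
    (ht : t ≤ T) :
    ∑ k ∈ Finset.range (8 ^ n), (Y (min (gridPt T n (k + 1)) t) - Y (min (gridPt T n k) t))
      = Y t - Y 0 := by
  rw [Finset.sum_range_sub (fun k ↦ Y (min (gridPt T n k) t)), gridPt_last, gridPt_zero,
    min_eq_right ht, min_eq_left zero_le]

/-- On a cell, `Δ(XY) = X ΔY + Y ΔX + ΔX ΔY` with `X` and `Y` at the left endpoint. Cells not yet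
begun at time `t` vanish. Every integration by parts formula below is a limit of this identity. -/
lemma mul_sub_eq_riemannSum {T : ℝ≥0} (n : ℕ) (X Y : ℝ≥0 → ℝ) {t : ℝ≥0} (ht : t ≤ T) :
    X t * Y t - X 0 * Y 0 = riemannSum T n X Y t + riemannSum T n Y X t + crossSum T n X Y t := by
  rw [← sum_grid_increments n (fun s ↦ X s * Y s) ht]
  simp only [riemannSum, crossSum, ← Finset.sum_add_distrib]
  refine Finset.sum_congr rfl fun k _ ↦ ?_
  rcases le_total (gridPt T n k) t with h | h
  · rw [min_eq_left h]; ring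
  · rw [min_eq_right h, min_eq_right (h.trans (gridPt_mono T n (Nat.le_succ k)))]; ring

lemma exists_grid_cell {T : ℝ≥0} (n : ℕ) {s : ℝ≥0} (hs : 0 < s) (hsT : s ≤ T) :
    ∃ k < 8 ^ n, gridPt T n k < s ∧ s ≤ gridPt T n (k + 1) := by
  have hex : ∃ k, s ≤ gridPt T n k := ⟨8 ^ n, by rwa [gridPt_last]⟩
  classical
  have h1 := Nat.find_spec hex
  have h0 : Nat.find hex ≠ 0 := by
    intro h
    rw [h, gridPt_zero] at h1
    exact absurd h1 (not_le.2 hs)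
  obtain ⟨k, hk⟩ := Nat.exists_eq_succ_of_ne_zero h0
  refine ⟨k, ?_, ?_, ?_⟩
  · have : Nat.find hex ≤ 8 ^ n := Nat.find_min' hex (by rwa [gridPt_last])
    omega
  · exact not_le.1 (Nat.find_min hex (by omega))
  · rw [hk] at h1; exact h1

lemma stepProc_eq {T : ℝ≥0} {n : ℕ} (X : ℝ≥0 → ℝ) {s : ℝ≥0} {k : ℕ} (hk : k < 8 ^ n)
    (h1 : gridPt T n k < s) (h2 : s ≤ gridPt T n (k + 1)) : stepProc T n X s = X (gridPt T n k) := by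
  unfold stepProc
  rw [Finset.sum_eq_single_of_mem k (by simpa using hk)]
  · simp [h1, h2]
  · intro j _ hjk
    rw [Set.indicator_of_notMem]
    rintro ⟨h3, h4⟩
    rcases lt_or_gt_of_ne hjk with h | h
    · exact absurd (h4.trans (gridPt_mono T n (by omega : j + 1 ≤ k))) (not_le.2 h1)
    · exact absurd (h2.trans (gridPt_mono T n (by omega : k + 1 ≤ j))) (not_le.2 h3)

lemma isCompact_Iic_nnreal (T : ℝ≥0) : IsCompact (Set.Iic T) := by
  rw [← Set.Icc_bot]; exact isCompact_Icc

/-- Eventual control of the oscillation of a continuous function over grid cells. -/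
lemma eventually_osc_lt {T : ℝ≥0} {X : ℝ≥0 → ℝ} (hX : ContinuousOn X (Set.Iic T)) {ε : ℝ}
    (hε : 0 < ε) : ∀ᶠ n : ℕ in atTop, ∀ s ≤ T, ∀ t ≤ T, |(s : ℝ) - t| ≤ T / 8 ^ n →
      |X s - X t| < ε := by
  have hu := (isCompact_Iic_nnreal T).uniformContinuousOn_of_continuous hX
  obtain ⟨δ, hδ, h⟩ := Metric.uniformContinuousOn_iff.1 hu ε hε
  have h4 : Tendsto (fun n : ℕ ↦ (T : ℝ) / 8 ^ n) atTop (𝓝 0) :=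
    tendsto_const_nhds.div_atTop (tendsto_pow_atTop_atTop_of_one_lt (by norm_num))
  filter_upwards [(tendsto_order.1 h4).2 δ hδ] with n hn s hs t ht hst
  exact h s hs t ht (by rw [NNReal.dist_eq]; exact hst.trans_lt hn)

/-- Time 0 lies in no half-open cell and is left out; it is a null set for `leb T`. -/
lemma tendstoUniformlyOn_stepProc {T : ℝ≥0} {X : ℝ≥0 → ℝ} (hX : ContinuousOn X (Set.Iic T)) :
    TendstoUniformlyOn (fun n ↦ stepProc T n X) X atTop (Set.Ioc 0 T) := by
  rw [Metric.tendstoUniformlyOn_iff]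
  intro ε hε
  filter_upwards [eventually_osc_lt hX hε] with n hn s hs
  obtain ⟨k, hk, h1, h2⟩ := exists_grid_cell n hs.1 hs.2
  rw [stepProc_eq X hk h1 h2, Real.dist_eq]
  refine hn s hs.2 _ (h1.le.trans hs.2) ?_
  have h3 := gridPt_succ_sub T n k
  have h1' : (gridPt T n k : ℝ) < s := h1
  have h2' : (s : ℝ) ≤ gridPt T n (k + 1) := h2
  rw [abs_le]
  constructor <;> linarith

lemma ae_leb_mem_Ioc (T : ℝ≥0) : ∀ᵐ s ∂(leb T), s ∈ Set.Ioc 0 T := by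
  have h1 : ∀ᵐ s ∂(leb T), s ≠ 0 := by
    rw [ae_iff]; simpa using leb_singleton_zero T
  filter_upwards [ae_leb_le T, h1] with s h1 h2
  exact ⟨pos_iff_ne_zero.2 h2, h1⟩

lemma abs_min_gridPt_sub_le {T t : ℝ≥0} (n k : ℕ) :
    |((min (gridPt T n (k + 1)) t : ℝ≥0) : ℝ) - (min (gridPt T n k) t : ℝ≥0)| ≤ T / 8 ^ n := by
  have h3 := gridPt_succ_sub T n k
  have hm : (gridPt T n k : ℝ) ≤ gridPt T n (k + 1) := gridPt_mono T n (Nat.le_succ k)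
  push_cast
  rw [abs_le]
  rcases le_total (gridPt T n (k + 1) : ℝ) t with h | h <;>
  rcases le_total (gridPt T n k : ℝ) t with h' | h' <;> simp only [min_eq_left, min_eq_right, h, h'] <;>
  constructor <;> linarith

/-! ### Integrals against absolutely continuous paths -/

/-- The primitive of an integrable function. -/
lemma leb_integral_sub {T s t : ℝ≥0} (hst : s ≤ t) (ht : t ≤ T) {a : ℝ≥0 → ℝ}
    (ha : Integrable a (leb T)) :
    ∫ r, a r ∂(leb t) - ∫ r, a r ∂(leb s) = ∫ r in Set.Ioc s t, a r ∂(leb T) := by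
  rw [← leb_restrict_Iic ht, ← leb_restrict_Iic (hst.trans ht)]
  have : Set.Iic t = Set.Iic s ∪ Set.Ioc s t := (Set.Iic_union_Ioc_eq_Iic hst).symm
  rw [this, setIntegral_union (by
    rw [Set.disjoint_left]; intro x hx hx'; exact absurd hx'.1 (not_lt.2 hx)) measurableSet_Ioc
    ha.integrableOn ha.integrableOn]
  ring

/-- With the endpoint moved into an indicator, dominated convergence applies: the indicator of `Iic
t` is discontinuous in `t` only at `r = t`, which is a null set. -/
lemma continuousOn_primitive {T : ℝ≥0} {a : ℝ≥0 → ℝ} (ha : Integrable a (leb T)) :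
    ContinuousOn (fun t ↦ ∫ r, a r ∂(leb t)) (Set.Iic T) := by
  have h : Set.EqOn (fun t ↦ ∫ r, a r ∂(leb t))
      (fun t ↦ ∫ r, (Set.Iic t).indicator a r ∂(leb T)) (Set.Iic T) := by
    intro t ht
    simp only
    rw [← leb_restrict_Iic ht, integral_indicator measurableSet_Iic]
  refine ContinuousOn.congr ?_ h
  refine Continuous.continuousOn ?_
  refine continuous_iff_continuousAt.2 fun t ↦ ?_
  refine continuousAt_of_dominated (bound := fun r ↦ ‖a r‖) ?_ ?_ ha.norm ?_
  · exact Eventually.of_forall fun t ↦ ha.1.indicator measurableSet_Iic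
  · exact Eventually.of_forall fun t ↦ Eventually.of_forall fun r ↦ norm_indicator_le_norm_self _ _
  · have h0 : ∀ᵐ r ∂(leb T), r ≠ t := by
      rw [ae_iff]
      simp only [ne_eq, not_not]
      have : {r | r = t} = ({t} : Set ℝ≥0) := rfl
      rw [this]
      unfold leb
      rw [Measure.map_apply measurable_real_toNNReal (measurableSet_singleton _),
        Measure.restrict_apply (measurable_real_toNNReal (measurableSet_singleton _))]
      refine measure_mono_null (t := {(t : ℝ)}) ?_ (by simp)
      rintro x ⟨hx, hx'⟩
      simp only [Set.mem_preimage, Set.mem_singleton_iff] at hx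
      rw [Set.mem_singleton_iff, ← hx, Real.coe_toNNReal _ hx'.1]
    filter_upwards [h0] with r hr
    rcases lt_or_gt_of_ne hr with h | h
    · refine ContinuousAt.congr (f := fun _ ↦ a r) continuousAt_const ?_
      filter_upwards [lt_mem_nhds h] with u hu
      simp [hu.le]
    · refine ContinuousAt.congr (f := fun _ ↦ 0) continuousAt_const ?_
      filter_upwards [gt_mem_nhds h] with u hu
      simp [hu]

/-- Cross sums of a continuous function and an absolutely continuous one tend to zero. -/
lemma tendstoUniformlyOn_crossSum_zero {T : ℝ≥0} {X B a : ℝ≥0 → ℝ}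
    (hX : ContinuousOn X (Set.Iic T)) (ha : Integrable a (leb T))
    (hB : ∀ t ≤ T, B t = B 0 + ∫ r, a r ∂(leb t)) :
    TendstoUniformlyOn (fun n t ↦ crossSum T n X B t) (fun _ ↦ 0) atTop (Set.Iic T) := by
  rw [Metric.tendstoUniformlyOn_iff]
  intro ε hε
  set A := ∫ r, |a r| ∂(leb T)
  have hA : 0 ≤ A := integral_nonneg fun _ ↦ abs_nonneg _
  -- `A` bounds the total variation of `B`; adding 1 avoids division by zero and keeps the final
  -- inequality strict.
  filter_upwards [eventually_osc_lt hX (show 0 < ε / (A + 1) by positivity)] with n hn t ht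
  have ht' : t ≤ T := ht
  rw [dist_comm, Real.dist_eq, sub_zero]
  have hinc : ∀ k, |B (min (gridPt T n (k + 1)) t) - B (min (gridPt T n k) t)|
      ≤ (∫ r, |a r| ∂(leb (min (gridPt T n (k + 1)) t)))
        - ∫ r, |a r| ∂(leb (min (gridPt T n k) t)) := by
    intro k
    have h1 : min (gridPt T n k) t ≤ min (gridPt T n (k + 1)) t :=
      min_le_min_right _ (gridPt_mono T n (Nat.le_succ k))
    have h2 : min (gridPt T n (k + 1)) t ≤ T := (min_le_right _ _).trans ht'
    rw [hB _ h2, hB _ (h1.trans h2), add_sub_add_left_eq_sub, leb_integral_sub h1 h2 ha,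
      leb_integral_sub h1 h2 ha.abs]
    exact abs_integral_le_integral_abs
  calc |crossSum T n X B t|
      ≤ ∑ k ∈ Finset.range (8 ^ n), ε / (A + 1) *
        ((∫ r, |a r| ∂(leb (min (gridPt T n (k + 1)) t)))
          - ∫ r, |a r| ∂(leb (min (gridPt T n k) t))) := by
        refine (Finset.abs_sum_le_sum_abs _ _).trans (Finset.sum_le_sum fun k _ ↦ ?_)
        rw [abs_mul]
        refine mul_le_mul ?_ (hinc k) (abs_nonneg _) (by positivity)
        exact (hn _ ((min_le_right _ _).trans ht') _ ((min_le_right _ _).trans ht')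
          (abs_min_gridPt_sub_le n k)).le
    _ = ε / (A + 1) * (∫ r, |a r| ∂(leb t) - ∫ r, |a r| ∂(leb 0)) := by
        rw [← Finset.mul_sum, sum_grid_increments n (fun t ↦ ∫ r, |a r| ∂(leb t)) ht']
    _ ≤ ε / (A + 1) * A := by
        gcongr
        have h0 : 0 ≤ ∫ r, |a r| ∂(leb 0) := integral_nonneg fun _ ↦ abs_nonneg _
        have h1 : ∫ r, |a r| ∂(leb t) ≤ A := by
          rw [← leb_restrict_Iic ht']
          exact setIntegral_le_integral ha.abs (Eventually.of_forall fun _ ↦ abs_nonneg _)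
        linarith
    _ < ε := by
        rw [div_mul_eq_mul_div, div_lt_iff₀ (by positivity)]
        nlinarith

lemma stepProc_mul_integrable {T : ℝ≥0} (n : ℕ) (X : ℝ≥0 → ℝ) {a : ℝ≥0 → ℝ}
    (ha : Integrable a (leb T)) : Integrable (fun r ↦ stepProc T n X r * a r) (leb T) := by
  simp only [stepProc, Finset.sum_mul]
  refine integrable_finsetSum _ fun k _ ↦ ?_
  have : (fun r ↦ (Set.Ioc (gridPt T n k) (gridPt T n (k + 1))).indicator
      (fun _ ↦ X (gridPt T n k)) r * a r) = (Set.Ioc (gridPt T n k) (gridPt T n (k + 1))).indicator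
      (fun r ↦ X (gridPt T n k) * a r) := by
    ext1 r
    rw [Set.indicator_mul_left]
  rw [this]
  exact (ha.const_mul _).indicator measurableSet_Ioc

/-- The increment of `B` over a cell cut off at `t` is the integral of `a` over that piece, so the
sum is the integral of the frozen process against `a`. -/
lemma riemannSum_eq_integral {T : ℝ≥0} (n : ℕ) (X : ℝ≥0 → ℝ) {B a : ℝ≥0 → ℝ}
    (ha : Integrable a (leb T)) (hB : ∀ t ≤ T, B t = B 0 + ∫ r, a r ∂(leb t)) {t : ℝ≥0}
    (ht' : t ≤ T) : riemannSum T n X B t = ∫ r, stepProc T n X r * a r ∂(leb t) := by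
  rw [← leb_restrict_Iic ht']
  simp only [stepProc, Finset.sum_mul]
  rw [integral_finsetSum]
  · refine Finset.sum_congr rfl fun k _ ↦ ?_
    have h1 : min (gridPt T n k) t ≤ min (gridPt T n (k + 1)) t :=
      min_le_min_right _ (gridPt_mono T n (Nat.le_succ k))
    have h2 : min (gridPt T n (k + 1)) t ≤ T := (min_le_right _ _).trans ht'
    rw [hB _ h2, hB _ (h1.trans h2), add_sub_add_left_eq_sub, leb_integral_sub h1 h2 ha,
      ← integral_const_mul, ← integral_indicator measurableSet_Ioc,
      ← integral_indicator measurableSet_Iic]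
    congr 1
    ext1 r
    simp only [Set.indicator_apply, Set.mem_Ioc, Set.mem_Iic]
    by_cases h3 : r ≤ t
    · simp [h3, not_lt.2 h3]
    · simp [h3]
  · intro k _
    have : (fun r ↦ (Set.Ioc (gridPt T n k) (gridPt T n (k + 1))).indicator
      (fun _ ↦ X (gridPt T n k)) r * a r) = (Set.Ioc (gridPt T n k) (gridPt T n (k + 1))).indicator
      (fun r ↦ X (gridPt T n k) * a r) := by
      ext1 r
      rw [Set.indicator_mul_left]
    rw [this]
    exact ((ha.const_mul _).indicator measurableSet_Ioc).integrableOn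

/-- Riemann sums against an absolutely continuous integrator converge. -/
lemma tendstoUniformlyOn_riemannSum {T : ℝ≥0} {X B a : ℝ≥0 → ℝ}
    (hX : ContinuousOn X (Set.Iic T)) (ha : Integrable a (leb T))
    (hB : ∀ t ≤ T, B t = B 0 + ∫ r, a r ∂(leb t)) :
    TendstoUniformlyOn (fun n t ↦ riemannSum T n X B t) (fun t ↦ ∫ r, X r * a r ∂(leb t))
      atTop (Set.Iic T) := by
  rw [Metric.tendstoUniformlyOn_iff]
  intro ε hε
  set A := ∫ r, |a r| ∂(leb T)
  have hA : 0 ≤ A := integral_nonneg fun _ ↦ abs_nonneg _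
  have hXa : Integrable (fun r ↦ X r * a r) (leb T) := by
    obtain ⟨R, hR0, hR⟩ := exists_bound_of_continuousOn hX
    exact ha.bdd_mul (aestronglyMeasurable_of_continuousOn hX) (c := R) (ae_leb_of_forall_le hR)
  filter_upwards [(Metric.tendstoUniformlyOn_iff.1 (tendstoUniformlyOn_stepProc hX))
    (ε / (A + 1)) (by positivity)] with n hn t ht
  have ht' : t ≤ T := ht
  have hr := riemannSum_eq_integral n X ha hB ht'
  rw [hr, Real.dist_eq, ← leb_restrict_Iic ht', ← integral_sub hXa.integrableOn
    (stepProc_mul_integrable n X ha).integrableOn]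
  calc |∫ r in Set.Iic t, (X r * a r - stepProc T n X r * a r) ∂(leb T)|
      ≤ ∫ r in Set.Iic t, |X r * a r - stepProc T n X r * a r| ∂(leb T) :=
        abs_integral_le_integral_abs
    _ ≤ ∫ r, |X r * a r - stepProc T n X r * a r| ∂(leb T) :=
        setIntegral_le_integral (hXa.sub (stepProc_mul_integrable n X ha)).abs
          (Eventually.of_forall fun _ ↦ abs_nonneg _)
    _ ≤ ∫ r, ε / (A + 1) * |a r| ∂(leb T) := by
        refine integral_mono_ae (hXa.sub (stepProc_mul_integrable n X ha)).abs
          (ha.abs.const_mul _) ?_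
        filter_upwards [ae_leb_mem_Ioc T] with r hr
        have h5 := (hn r hr).le
        rw [Real.dist_eq] at h5
        rw [← sub_mul, abs_mul]
        gcongr
    _ = ε / (A + 1) * A := integral_const_mul _ _
    _ < ε := by
        rw [div_mul_eq_mul_div, div_lt_iff₀ (by positivity)]
        nlinarith

/-! ### Itô integrals of step processes -/

/-- The indicator of a cell is the difference of the indicators of two half-lines. Each piece is an
instance of `IsItoIntegral.start`, the second with the coefficient `-X` at the left endpoint, which
is also known at the right endpoint. -/
lemma IsItoIntegral.step (hWc : ∀ᵐ ω ∂P, ContinuousOn (fun t ↦ W t ω) (Set.Iic T))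
    (hWa : ∀ t, StronglyMeasurable[𝓕 t] (W t)) (h : IsItoIntegral 𝓕 P T W H I)
    {X : ℝ≥0 → Ω → ℝ} (hX : ∀ t ≤ T, AEStronglyMeasurable[𝓕 t] (X t) P) (n : ℕ) :
    IsItoIntegral 𝓕 P T W (fun s ω ↦ stepProc T n (fun r ↦ X r ω) s • H s ω)
      (fun t ω ↦ riemannSum T n (fun r ↦ X r ω) (fun r ↦ I r ω) t) := by
  have key : ∀ k ∈ Finset.range (8 ^ n), IsItoIntegral 𝓕 P T W
      (fun s ω ↦ (Set.Ioc (gridPt T n k) (gridPt T n (k + 1))).indicator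
        (fun _ ↦ X (gridPt T n k) ω) s • H s ω)
      (fun t ω ↦ X (gridPt T n k) ω *
        (I (min (gridPt T n (k + 1)) t) ω - I (min (gridPt T n k) t) ω)) := by
    intro k hk
    have hkT : gridPt T n k ≤ T := gridPt_le (Finset.mem_range.1 hk).le
    have hXk := hX _ hkT
    obtain ⟨g, hg, hgX⟩ := hXk
    have hXk' : AEStronglyMeasurable[𝓕 (gridPt T n (k + 1))] (fun ω ↦ -X (gridPt T n k) ω) P :=
      ⟨fun ω ↦ - g ω, (hg.mono (𝓕.mono (gridPt_mono T n (Nat.le_succ k)))).neg,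
        by filter_upwards [hgX] with ω hω; rw [hω]⟩
    refine ((h.start hWc hWa (hX _ hkT)).add hWc hWa (h.start hWc hWa hXk')).congr ?_ ?_
    · refine Eventually.of_forall fun ω ↦ Eventually.of_forall fun s ↦ ?_
      have hm := gridPt_mono T n (Nat.le_succ k)
      rw [← add_smul]
      congr 1
      simp only [Set.indicator_apply, Set.mem_Ioc, Set.mem_Ioi]
      by_cases h1 : gridPt T n (k + 1) < s
      · simp [h1, hm.trans_lt h1, not_le.2 h1]
      · simp [h1, not_lt.1 h1]
    · refine Eventually.of_forall fun ω t _ ↦ ?_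
      ring
  refine (IsItoIntegral.sum hWc hWa _ key).congr ?_ ?_
  · refine Eventually.of_forall fun ω ↦ Eventually.of_forall fun s ↦ ?_
    simp only [stepProc, Finset.sum_smul]
  · exact Eventually.of_forall fun ω t _ ↦ rfl

lemma tendsto_stepProc_smul {X : ℝ≥0 → ℝ} (hX : ContinuousOn X (Set.Iic T)) {f : ℝ≥0 → Vec m}
    (hf : MemLp f 2 (leb T)) :
    Tendsto (fun n ↦ ∫⁻ s, ‖stepProc T n X s • f s - X s • f s‖ₑ ^ 2 ∂(leb T)) atTop (𝓝 0) := by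
  obtain ⟨R, -, hR⟩ := exists_bound_of_continuousOn hX
  exact tendsto_lintegral_sq_smul (ae_leb_mem_Ioc T) (tendstoUniformlyOn_stepProc hX)
    (fun s hs ↦ hR s hs.2) (f := fun _ ↦ f) (by simp) hf

lemma memLp_smul_of_continuousOn {X : ℝ≥0 → ℝ} (hX : ContinuousOn X (Set.Iic T))
    {f : ℝ≥0 → Vec m} (hf : MemLp f 2 (leb T)) : MemLp (fun s ↦ X s • f s) 2 (leb T) := by
  obtain ⟨R, -, hR⟩ := exists_bound_of_continuousOn hX
  refine (hf.const_smul R).of_le ((aestronglyMeasurable_of_continuousOn hX).smul hf.1) ?_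
  filter_upwards [ae_leb_le T] with s hs
  rw [norm_smul, Pi.smul_apply, norm_smul]
  gcongr
  exact (hR s hs).trans (le_abs_self _)

/-! ### Brownian motion relative to a filtration -/

/-- The properties of a Brownian motion on `[0, T]` relative to a filtration that are used to
develop the Itô integral. -/
structure IsFilteredBrownian (𝓕 : Filtration ℝ≥0 mΩ) (P : Measure Ω) (T : ℝ≥0)
    (W : ℝ≥0 → Ω → Vec m) : Prop where
  zero : ∀ᵐ ω ∂P, W 0 ω = 0
  continuous : ∀ᵐ ω ∂P, ContinuousOn (fun t ↦ W t ω) (Set.Iic T)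
  adapted : ∀ t, StronglyMeasurable[𝓕 t] (W t)
  indep : ∀ s t, s ≤ t → t ≤ T →
    Indep (MeasurableSpace.comap (fun ω ↦ W t ω - W s ω) inferInstance) (𝓕 s) P
  memLp : ∀ s t i, s ≤ t → t ≤ T → MemLp (fun ω ↦ W t ω i - W s ω i) 4 P
  mean : ∀ s t i, s ≤ t → t ≤ T → ∫ ω, (W t ω i - W s ω i) ∂P = 0
  cov : ∀ s t i j, s ≤ t → t ≤ T → ∫ ω, (W t ω i - W s ω i) * (W t ω j - W s ω j) ∂P
    = if i = j then (t : ℝ) - s else 0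
  fourth : ∃ κ : ℝ, ∀ s t i, s ≤ t → t ≤ T →
    ∫ ω, (W t ω i - W s ω i) ^ 4 ∂P = κ * ((t : ℝ) - s) ^ 2
  null : ∀ N, MeasurableSet N → P N = 0 → MeasurableSet[𝓕 0] N

/-- By scaling, only the dependence on the variance matters; the standard fourth moment is left
unevaluated. -/
lemma integral_pow_four_gaussianReal (v : ℝ≥0) :
    ∫ x, x ^ 4 ∂(gaussianReal 0 v) = (∫ x, x ^ 4 ∂(gaussianReal 0 1)) * (v : ℝ) ^ 2 := by
  have h : gaussianReal 0 v = (gaussianReal 0 1).map (fun x ↦ √v * x) := by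
    rw [gaussianReal_map_const_mul]
    congr 1
    · simp
    · ext; simp
  rw [h, integral_map (by fun_prop) (by fun_prop)]
  simp_rw [mul_pow]
  rw [integral_const_mul, mul_comm]
  congr 1
  have : (√(v : ℝ)) ^ 4 = ((√(v : ℝ)) ^ 2) ^ 2 := by ring
  rw [this, Real.sq_sqrt v.coe_nonneg]

lemma IsBrownianMotion.isFilteredBrownian (hW : IsBrownianMotion W T P)
    (h𝓕 : 𝓕 = augmentedFiltration W hW.measurable P) : IsFilteredBrownian 𝓕 P T W := by
  have hlaw : ∀ s t i, s ≤ t → t ≤ T →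
      HasLaw (fun ω ↦ W t ω i - W s ω i) (gaussianReal 0 (t - s)) P := by
    intro s t i hst ht
    exact (measurePreserving_eval _ i).hasLaw.comp (hW.law_increment s t hst ht)
  have hmem : ∀ s t i, s ≤ t → t ≤ T → ∀ p : ℝ≥0, MemLp (fun ω ↦ W t ω i - W s ω i) p P := by
    intro s t i hst ht p
    have h := memLp_id_gaussianReal (μ := 0) (v := t - s) p
    have hl := hlaw s t i hst ht
    rw [← hl.map_eq] at h
    exact h.comp_of_map hl.aemeasurable
  have hnat : ∀ s, (Filtration.natural W hW.measurable) s ≤ 𝓕 s := by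
    intro s; rw [h𝓕]; exact le_sup_left (a := (Filtration.natural W hW.measurable) s)
  constructor
  · exact hW.zero
  · filter_upwards [hW.continuous_paths] with ω h
    rwa [← Set.Icc_bot]
  · intro t
    have : StronglyMeasurable[(Filtration.natural W hW.measurable) t] (W t) :=
      (Filtration.stronglyAdapted_natural hW.measurable) t
    exact this.mono (hnat t)
  · intro s t hst ht
    have h := hW.indep_increment s t hst ht
    rw [IndepFun_iff_Indep] at h
    -- Each set of the augmented σ-algebra agrees almost everywhere with a set of the natural one,
    -- and independence does not see null sets.
    have hle : 𝓕 s ≤ eventuallyMeasurableSpace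
        ((Filtration.natural W hW.measurable) s) (ae P) := by
      rw [h𝓕]
      refine sup_le ?_ ?_
      · exact le_eventuallyMeasurableSpace
      · refine MeasurableSpace.generateFrom_le ?_
        rintro N ⟨-, hN⟩
        refine ⟨∅, @MeasurableSet.empty _ ((Filtration.natural W hW.measurable) s), ?_⟩
        rwa [ae_eq_empty]
    rw [← Filtration.natural_eq_comap W hW.measurable s] at h
    rw [Indep_iff] at h ⊢
    intro A B hA hB
    obtain ⟨B', hB', hBB'⟩ := hle B hB
    rw [measure_congr hBB', ← h A B' hA hB']
    exact measure_congr ((ae_eq_refl A).inter hBB')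
  · intro s t i hst ht
    exact hmem s t i hst ht 4
  · intro s t i hst ht
    rw [(hlaw s t i hst ht).integral_eq, integral_id_gaussianReal]
  · intro s t i j hst ht
    have hmean : ∀ i, ∫ ω, (W t ω i - W s ω i) ∂P = 0 := fun i ↦ by
      rw [(hlaw s t i hst ht).integral_eq, integral_id_gaussianReal]
    split_ifs with hij
    · subst hij
      have hv := (hlaw s t i hst ht).variance_eq
      rw [variance_id_gaussianReal, variance_eq_integral (hlaw s t i hst ht).aemeasurable,
        hmean i, NNReal.coe_sub hst] at hv
      simp only [sub_zero] at hv
      rw [← hv]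
      congr 1; ext ω; ring
    · have hind : iIndepFun (fun i ω ↦ W t ω i - W s ω i) P :=
        (iIndepFun_iff_hasLaw_pi_pi (fun i ↦ hlaw s t i hst ht)).2 (hW.law_increment s t hst ht)
      have h2 := (hind.indepFun hij).integral_fun_mul_eq_mul_integral
        (hlaw s t i hst ht).aemeasurable.aestronglyMeasurable
        (hlaw s t j hst ht).aemeasurable.aestronglyMeasurable
      rw [h2, hmean i, zero_mul]
  · refine ⟨∫ x, x ^ 4 ∂(gaussianReal 0 1), fun s t i hst ht ↦ ?_⟩
    rw [← NNReal.coe_sub hst, ← integral_pow_four_gaussianReal,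
      ← (hlaw s t i hst ht).integral_comp (f := fun x : ℝ ↦ x ^ 4) (by fun_prop)]
    rfl
  · intro N hN hN0
    rw [h𝓕]
    have : (Filtration.const ℝ≥0 (MeasurableSpace.generateFrom
      {N : Set Ω | MeasurableSet N ∧ P N = 0}) (MeasurableSpace.generateFrom_le fun _ hN ↦ hN.1) :
      Filtration ℝ≥0 mΩ) 0 ≤ (augmentedFiltration W hW.measurable P) 0 :=
      le_sup_right (a := (Filtration.natural W hW.measurable) 0)
    exact this N (MeasurableSpace.measurableSet_generateFrom ⟨hN, hN0⟩)

/-! ### Square-integrable martingales on `[0, T]` -/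

/-- Square-integrable martingales on `[0, T]`: increments are orthogonal to the past. -/
structure IsL2Martingale (𝓕 : Filtration ℝ≥0 mΩ) (P : Measure Ω) (T : ℝ≥0)
    (N : ℝ≥0 → Ω → ℝ) : Prop where
  adapted : ∀ t ≤ T, StronglyMeasurable[𝓕 t] (N t)
  memLp : ∀ t ≤ T, MemLp (N t) 2 P
  orth : ∀ s t, s ≤ t → t ≤ T → ∀ Y : Ω → ℝ, StronglyMeasurable[𝓕 s] Y → MemLp Y 2 P →
    ∫ ω, Y ω * (N t ω - N s ω) ∂P = 0

lemma IsL2Martingale.add {N M : ℝ≥0 → Ω → ℝ} (hN : IsL2Martingale 𝓕 P T N)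
    (hM : IsL2Martingale 𝓕 P T M) : IsL2Martingale 𝓕 P T (fun t ω ↦ N t ω + M t ω) where
  adapted t ht := (hN.adapted t ht).add (hM.adapted t ht)
  memLp t ht := (hN.memLp t ht).add (hM.memLp t ht)
  orth s t hst ht Y hY hY2 := by
    have h1 : ∀ ω, Y ω * (N t ω + M t ω - (N s ω + M s ω))
        = Y ω * (N t ω - N s ω) + Y ω * (M t ω - M s ω) := fun ω ↦ by ring
    simp_rw [h1]
    rw [integral_add, hN.orth s t hst ht Y hY hY2, hM.orth s t hst ht Y hY hY2, add_zero]
    · exact hY2.integrable_mul ((hN.memLp t ht).sub (hN.memLp s (hst.trans ht)))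
    · exact hY2.integrable_mul ((hM.memLp t ht).sub (hM.memLp s (hst.trans ht)))

lemma IsL2Martingale.const_mul {N : ℝ≥0 → Ω → ℝ} (hN : IsL2Martingale 𝓕 P T N) (c : ℝ) :
    IsL2Martingale 𝓕 P T (fun t ω ↦ c * N t ω) where
  adapted t ht := (hN.adapted t ht).const_mul c
  memLp t ht := (hN.memLp t ht).const_mul c
  orth s t hst ht Y hY hY2 := by
    have h1 : ∀ ω, Y ω * (c * N t ω - c * N s ω) = c * (Y ω * (N t ω - N s ω)) := fun ω ↦ by ring
    simp_rw [h1]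
    rw [integral_const_mul, hN.orth s t hst ht Y hY hY2, mul_zero]

lemma IsL2Martingale.sum {ι : Type*} (S : Finset ι) {N : ι → ℝ≥0 → Ω → ℝ}
    (hN : ∀ i ∈ S, IsL2Martingale 𝓕 P T (N i)) :
    IsL2Martingale 𝓕 P T (fun t ω ↦ ∑ i ∈ S, N i t ω) := by
  classical
  induction S using Finset.induction_on with
  | empty =>
    simp only [Finset.sum_empty]
    exact ⟨fun _ _ ↦ stronglyMeasurable_const, fun _ _ ↦ by simp, by simp⟩
  | insert a S ha ih =>
    simp only [Finset.sum_insert ha]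
    exact (hN a (by simp)).add (ih fun i hi ↦ hN i (by simp [hi]))

/-- Expanding `N_{k+1}² = N_k² + 2 N_k ΔN + (ΔN)²`, the cross term integrates to zero over `A ∈ 𝓕 (τ
k)`: it is the orthogonality relation tested with `1_A N_k`. -/
lemma IsL2Martingale.submartingale_sq {N : ℝ≥0 → Ω → ℝ} (hN : IsL2Martingale 𝓕 P T N)
    {τ : ℕ → ℝ≥0} (hτ : Monotone τ) (hτT : ∀ k, τ k ≤ T) :
    Submartingale (fun k ω ↦ N (τ k) ω ^ 2)
      (⟨fun k ↦ 𝓕 (τ k), fun _ _ h ↦ 𝓕.mono (hτ h), fun _ ↦ 𝓕.le _⟩ : Filtration ℕ mΩ) P := by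
  refine submartingale_of_setIntegral_le_succ ?_ ?_ ?_
  · intro k
    exact (hN.adapted _ (hτT k)).pow 2
  · intro k
    exact (hN.memLp _ (hτT k)).integrable_sq
  · intro k A hA
    have hA' : MeasurableSet A := 𝓕.le _ A hA
    have h1 := hN.memLp _ (hτT k)
    have h2 := hN.memLp _ (hτT (k + 1))
    have hY : MemLp (A.indicator (N (τ k))) 2 P := h1.indicator hA'
    have ho := hN.orth _ _ (hτ (Nat.le_succ k)) (hτT (k + 1)) (A.indicator (N (τ k)))
      ((hN.adapted _ (hτT k)).indicator hA) hY
    have e : ∫ ω in A, N (τ k) ω * (N (τ (k + 1)) ω - N (τ k) ω) ∂P = 0 := by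
      rw [← integral_indicator hA', ← ho]
      congr 1
      ext ω
      by_cases h : ω ∈ A <;> simp [h]
    have hi : Integrable (fun ω ↦ N (τ k) ω * (N (τ (k + 1)) ω - N (τ k) ω)) P :=
      h1.integrable_mul (h2.sub h1)
    have hsq : Integrable (fun ω ↦ (N (τ (k + 1)) ω - N (τ k) ω) ^ 2) P := (h2.sub h1).integrable_sq
    have e2 : ∫ ω in A, N (τ (k + 1)) ω ^ 2 ∂P = ∫ ω in A, N (τ k) ω ^ 2 ∂P
        + 2 * ∫ ω in A, N (τ k) ω * (N (τ (k + 1)) ω - N (τ k) ω) ∂P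
        + ∫ ω in A, (N (τ (k + 1)) ω - N (τ k) ω) ^ 2 ∂P := by
      have hint : Integrable (fun ω ↦ N (τ k) ω ^ 2) P := h1.integrable_sq
      have hint2 : Integrable (fun ω ↦ N (τ k) ω ^ 2
          + 2 * (N (τ k) ω * (N (τ (k + 1)) ω - N (τ k) ω))) P := hint.add (hi.const_mul 2)
      rw [← integral_const_mul, ← integral_add hint.integrableOn (hi.const_mul 2).integrableOn,
        ← integral_add hint2.integrableOn hsq.integrableOn]
      congr 1; ext ω; ring
    rw [e2, e, mul_zero, add_zero]
    have : 0 ≤ ∫ ω in A, (N (τ (k + 1)) ω - N (τ k) ω) ^ 2 ∂P :=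
      integral_nonneg fun _ ↦ sq_nonneg _
    linarith

lemma gridPt_succ_level (T : ℝ≥0) (n k : ℕ) : gridPt T n k = gridPt T (n + 1) (8 * k) := by
  unfold gridPt
  push_cast
  rw [pow_succ]
  field_simp

/-- The maximal inequality for continuous square-integrable martingales. -/
lemma IsL2Martingale.maximal_ineq {N : ℝ≥0 → Ω → ℝ} (hN : IsL2Martingale 𝓕 P T N)
    (hc : ∀ᵐ ω ∂P, ContinuousOn (fun t ↦ N t ω) (Set.Iic T)) {ε : ℝ} (hε : 0 < ε) :
    ENNReal.ofReal (ε ^ 2 / 4) * P {ω | ∃ t ≤ T, ε ≤ |N t ω|}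
      ≤ ENNReal.ofReal (∫ ω, N T ω ^ 2 ∂P) := by
  -- On the grid only `|N| ≥ ε/2` is asked for, since passing from an arbitrary time to a grid point
  -- may lose `ε/2`. This is the origin of the 4. The sets increase with `n` because the grids are
  -- nested.
  let A : ℕ → Set Ω := fun n ↦ {ω | ∃ k ≤ 8 ^ n, ε ^ 2 / 4 ≤ N (gridPt T n k) ω ^ 2}
  have hAmono : Monotone A := by
    refine monotone_nat_of_le_succ fun n ω ↦ ?_
    rintro ⟨k, hk, h⟩
    exact ⟨8 * k, by rw [pow_succ]; omega, by rwa [← gridPt_succ_level]⟩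
  have hA : ∀ n, ENNReal.ofReal (ε ^ 2 / 4) * P (A n) ≤ ENNReal.ofReal (∫ ω, N T ω ^ 2 ∂P) := by
    intro n
    -- Capping at `T` keeps all times admissible for every index, also beyond the last grid point.
    have hsub := hN.submartingale_sq (τ := fun k ↦ min (gridPt T n k) T)
      (fun a b h ↦ min_le_min_right _ (gridPt_mono T n h)) (fun k ↦ min_le_right _ _)
    have := MeasureTheory.maximal_ineq hsub (fun k ω ↦ sq_nonneg _)
      (ε := (ε ^ 2 / 4).toNNReal) (8 ^ n)
    rw [Real.coe_toNNReal _ (by positivity)] at this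
    have hset : A n ⊆ {ω | ε ^ 2 / 4 ≤ (Finset.range (8 ^ n + 1)).sup' Finset.nonempty_range_add_one
        fun k ↦ N (min (gridPt T n k) T) ω ^ 2} := by
      rintro ω ⟨k, hk, h⟩
      change ε ^ 2 / 4 ≤ _
      rw [Finset.le_sup'_iff]
      refine ⟨k, by simpa [Nat.lt_succ_iff] using hk, ?_⟩
      rwa [min_eq_left (gridPt_le hk)]
    refine (mul_le_mul' le_rfl (measure_mono hset)).trans (this.trans ?_)
    rw [gridPt_last, min_self]
    exact ENNReal.ofReal_le_ofReal (setIntegral_le_integral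
      (hN.memLp T le_rfl).integrable_sq (Eventually.of_forall fun _ ↦ sq_nonneg _))
  have hsup : P (⋃ n, A n) = ⨆ n, P (A n) := hAmono.measure_iUnion
  have hle : P {ω | ∃ t ≤ T, ε ≤ |N t ω|} ≤ P (⋃ n, A n) := by
    refine measure_mono_ae ?_
    filter_upwards [hc] with ω hc
    change (∃ t ≤ T, ε ≤ |N t ω|) → ω ∈ ⋃ n, A n
    rintro ⟨t, ht, hle⟩
    obtain ⟨n, hn⟩ := (eventually_osc_lt hc (show 0 < ε / 2 by positivity)).exists
    rw [Set.mem_iUnion]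
    refine ⟨n, ?_⟩
    rcases eq_or_ne t 0 with h0 | h0
    · refine ⟨0, by simp, ?_⟩
      rw [gridPt_zero, ← h0, ← sq_abs (N t ω)]
      nlinarith
    · obtain ⟨k, hk, h1, h2⟩ := exists_grid_cell n (pos_iff_ne_zero.2 h0) ht
      have h3 := gridPt_succ_sub T n k
      have h1' : (gridPt T n k : ℝ) < t := h1
      have h2' : (t : ℝ) ≤ gridPt T n (k + 1) := h2
      have h4 := hn t ht (gridPt T n k) (h1.le.trans ht) (by rw [abs_le]; constructor <;> linarith)
      refine ⟨k, hk.le, ?_⟩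
      have h5 : |N t ω| ≤ |N t ω - N (gridPt T n k) ω| + |N (gridPt T n k) ω| := by
        have := abs_add_le (N t ω - N (gridPt T n k) ω) (N (gridPt T n k) ω)
        rwa [sub_add_cancel] at this
      have h6 : ε / 2 ≤ |N (gridPt T n k) ω| := by linarith
      rw [← sq_abs (N (gridPt T n k) ω)]
      nlinarith
  calc _ ≤ ENNReal.ofReal (ε ^ 2 / 4) * ⨆ n, P (A n) := by rw [← hsup]; gcongr
    _ = ⨆ n, ENNReal.ofReal (ε ^ 2 / 4) * P (A n) := ENNReal.mul_iSup _ _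
    _ ≤ _ := iSup_le hA

/-! ### Increments of Brownian motion -/

namespace IsFilteredBrownian

lemma indepFun (hW : IsFilteredBrownian 𝓕 P T W) {u v : ℝ≥0} (huv : u ≤ v) (hv : v ≤ T) {Y : Ω → ℝ}
    (hY : StronglyMeasurable[𝓕 u] Y) {g : Vec m → ℝ} (hg : Measurable g) :
    IndepFun Y (fun ω ↦ g (W v ω - W u ω)) P := by
  rw [IndepFun_iff_Indep]
  refine (indep_of_indep_of_le_left (indep_of_indep_of_le_right (hW.indep u v huv hv)
    hY.measurable.comap_le) ?_).symm
  rintro A ⟨B, hB, rfl⟩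
  exact ⟨g ⁻¹' B, hg hB, rfl⟩

lemma measurable_increment (hW : IsFilteredBrownian 𝓕 P T W) (u v : ℝ≥0) :
    Measurable (fun ω ↦ W v ω - W u ω) :=
  ((hW.adapted v).mono (𝓕.le _)).measurable.sub ((hW.adapted u).mono (𝓕.le _)).measurable

lemma integral_mul_increment (hW : IsFilteredBrownian 𝓕 P T W) {u v : ℝ≥0} (huv : u ≤ v)
    (hv : v ≤ T) {Y : Ω → ℝ} (hY : StronglyMeasurable[𝓕 u] Y) {g : Vec m → ℝ}
    (hg : Measurable g) :
    ∫ ω, Y ω * g (W v ω - W u ω) ∂P = (∫ ω, Y ω ∂P) * ∫ ω, g (W v ω - W u ω) ∂P :=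
  (hW.indepFun huv hv hY hg).integral_fun_mul_eq_mul_integral
    (hY.mono (𝓕.le _)).aestronglyMeasurable
    (hg.comp (hW.measurable_increment u v)).aestronglyMeasurable

lemma integrable_mul_increment (hW : IsFilteredBrownian 𝓕 P T W) {u v : ℝ≥0} (huv : u ≤ v)
    (hv : v ≤ T) {Y : Ω → ℝ} (hY : StronglyMeasurable[𝓕 u] Y) (hYi : Integrable Y P)
    {g : Vec m → ℝ} (hg : Measurable g) (hgi : Integrable (fun ω ↦ g (W v ω - W u ω)) P) :
    Integrable (fun ω ↦ Y ω * g (W v ω - W u ω)) P :=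
  (hW.indepFun huv hv hY hg).integrable_mul hYi hgi

lemma adapted_coord (hW : IsFilteredBrownian 𝓕 P T W) (t : ℝ≥0) (i : Fin m) :
    StronglyMeasurable[𝓕 t] (fun ω ↦ W t ω i) :=
  (by fun_prop : Continuous fun v : Vec m ↦ v i).comp_stronglyMeasurable (hW.adapted t)

lemma memLp_two (hW : IsFilteredBrownian 𝓕 P T W) (i : Fin m) {u v : ℝ≥0} (huv : u ≤ v)
    (hv : v ≤ T) : MemLp (fun ω ↦ W v ω i - W u ω i) 2 P :=
  (hW.memLp u v i huv hv).mono_exponent (by norm_num)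

lemma continuousOn_coord (hW : IsFilteredBrownian 𝓕 P T W) (i : Fin m) :
    ∀ᵐ ω ∂P, ContinuousOn (fun t ↦ W t ω i) (Set.Iic T) := by
  filter_upwards [hW.continuous] with ω h
  exact (by fun_prop : Continuous fun v : Vec m ↦ v i).comp_continuousOn h

lemma memLp_coord (hW : IsFilteredBrownian 𝓕 P T W) (i : Fin m) {t : ℝ≥0} (ht : t ≤ T) :
    MemLp (fun ω ↦ W t ω i) 4 P := by
  refine (hW.memLp 0 t i zero_le ht).ae_eq ?_
  filter_upwards [hW.zero] with ω h
  simp [h]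

/-- `∫ ξ 1_{(l, ∞)} dWⁱ` is a square-integrable martingale. -/
lemma isL2Martingale_start (hW : IsFilteredBrownian 𝓕 P T W) {l : ℝ≥0} {ξ : Ω → ℝ}
    (hξ : StronglyMeasurable[𝓕 l] ξ) (hξ2 : MemLp ξ 2 P) (i : Fin m) :
    IsL2Martingale 𝓕 P T (fun t ω ↦ ξ ω * (W t ω i - W (min l t) ω i)) where
  adapted t ht := by
    rcases le_total l t with h | h
    · exact (hξ.mono (𝓕.mono h)).mul ((hW.adapted_coord t i).sub
        ((hW.adapted_coord _ i).mono (𝓕.mono (min_le_right _ _))))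
    · have : (fun ω ↦ ξ ω * (W t ω i - W (min l t) ω i)) = fun _ ↦ 0 := by
        ext ω; rw [min_eq_right h]; simp
      rw [this]; exact stronglyMeasurable_const
  memLp t ht := by
    rcases le_total l t with h | h
    · rw [min_eq_left h]
      have hm : AEStronglyMeasurable (fun ω ↦ ξ ω * (W t ω i - W l ω i)) P :=
        hξ2.1.mul (hW.memLp_two i h ht).1
      rw [memLp_two_iff_integrable_sq hm]
      have := hW.integrable_mul_increment h ht (Y := fun ω ↦ ξ ω ^ 2) (hξ.pow 2) hξ2.integrable_sq
        (g := fun v ↦ v i ^ 2) (by fun_prop) (hW.memLp_two i h ht).integrable_sq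
      refine this.congr (Eventually.of_forall fun ω ↦ ?_)
      simp only [PiLp.sub_apply]
      ring
    · have : (fun ω ↦ ξ ω * (W t ω i - W (min l t) ω i)) = fun _ ↦ 0 := by
        ext ω; rw [min_eq_right h]; simp
      rw [this]; simp
  orth s t hst ht Y hY hY2 := by
    -- Both orders of `l` and `s` are covered at once: the factor `Y * ξ` is known at time `max l
    -- s`, and the remaining increment starts there.
    have e : ∀ ω, Y ω * (ξ ω * (W t ω i - W (min l t) ω i) - ξ ω * (W s ω i - W (min l s) ω i))
        = (Y ω * ξ ω) * (W t ω i - W (min (max l s) t) ω i) := by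
      intro ω
      rcases le_total l s with h | h
      · rw [min_eq_left h, min_eq_left (h.trans hst), max_eq_right h, min_eq_left hst]; ring
      · rw [min_eq_right h, max_eq_left h]; ring
    simp_rw [e]
    rcases le_total (max l s) t with h | h
    · rw [min_eq_left h]
      have := hW.integral_mul_increment h ht (Y := fun ω ↦ Y ω * ξ ω)
        ((hY.mono (𝓕.mono (le_max_right _ _))).mul (hξ.mono (𝓕.mono (le_max_left _ _))))
        (g := fun v ↦ v i) (by fun_prop)
      simp only [PiLp.sub_apply] at this
      rw [this, hW.mean _ _ i h ht, mul_zero]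
    · rw [min_eq_right h]; simp

/-- `Wⁱ Wʲ - δᵢⱼ t` is a square-integrable martingale. -/
lemma isL2Martingale_mul (hW : IsFilteredBrownian 𝓕 P T W) (i j : Fin m) :
    IsL2Martingale 𝓕 P T (fun t ω ↦ W t ω i * W t ω j - if i = j then (t : ℝ) else 0) where
  adapted t ht := ((hW.adapted_coord t i).mul (hW.adapted_coord t j)).sub stronglyMeasurable_const
  memLp t ht := by
    refine MemLp.sub ?_ (memLp_const _)
    exact (hW.memLp_coord j ht).mul' (hW.memLp_coord i ht) (hpqr := ⟨by
      rw [← ENNReal.toReal_eq_toReal_iff' (by finiteness) (by finiteness)]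
      rw [ENNReal.toReal_add (by finiteness) (by finiteness)]; norm_num⟩)
  orth s t hst ht Y hY hY2 := by
    -- The product is expanded about time `s`: two terms linear in increments after `s`, and the
    -- product of increments centred by its covariance. Each is a factor known at `s` times an
    -- independent mean zero variable.
    have e : ∀ ω, Y ω * (W t ω i * W t ω j - (if i = j then (t : ℝ) else 0)
          - (W s ω i * W s ω j - if i = j then (s : ℝ) else 0))
        = (Y ω * W s ω i) * (W t ω j - W s ω j) + (Y ω * W s ω j) * (W t ω i - W s ω i)
          + Y ω * ((W t ω i - W s ω i) * (W t ω j - W s ω j) - if i = j then (t : ℝ) - s else 0) := by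
      intro ω
      split_ifs <;> ring
    have hs := hst.trans ht
    have hm : ∀ i, MemLp (fun ω ↦ W s ω i) 2 P := fun i ↦
      (hW.memLp_coord i hs).mono_exponent (by norm_num)
    have h1 : ∀ i j, Integrable (fun ω ↦ (Y ω * W s ω i) * (W t ω j - W s ω j)) P := by
      intro i j
      have := hW.integrable_mul_increment hst ht (Y := fun ω ↦ Y ω * W s ω i)
        (hY.mul (hW.adapted_coord s i)) (hY2.integrable_mul (hm i)) (g := fun v ↦ v j)
        (by fun_prop) ((hW.memLp_two j hst ht).integrable (by norm_num))
      simpa only [PiLp.sub_apply] using this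
    have h2 : ∀ i j, ∫ ω, (Y ω * W s ω i) * (W t ω j - W s ω j) ∂P = 0 := by
      intro i j
      have := hW.integral_mul_increment hst ht (Y := fun ω ↦ Y ω * W s ω i)
        (hY.mul (hW.adapted_coord s i)) (g := fun v ↦ v j) (by fun_prop)
      simp only [PiLp.sub_apply] at this
      rw [this, hW.mean _ _ j hst ht, mul_zero]
    have hpi : Integrable (fun ω ↦ (W t ω i - W s ω i) * (W t ω j - W s ω j)) P :=
      (hW.memLp_two i hst ht).integrable_mul (hW.memLp_two j hst ht)
    have h3 : ∫ ω, Y ω * ((W t ω i - W s ω i) * (W t ω j - W s ω j)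
        - if i = j then (t : ℝ) - s else 0) ∂P = 0 := by
      have := hW.integral_mul_increment hst ht hY
        (g := fun v ↦ v i * v j - if i = j then (t : ℝ) - s else 0) (by fun_prop)
      simp only [PiLp.sub_apply] at this
      rw [this, integral_sub hpi (integrable_const _), hW.cov s t i j hst ht]
      simp
    have h4 : Integrable (fun ω ↦ Y ω * ((W t ω i - W s ω i) * (W t ω j - W s ω j)
        - if i = j then (t : ℝ) - s else 0)) P := by
      have := hW.integrable_mul_increment hst ht hY (hY2.integrable (by norm_num))
        (g := fun v ↦ v i * v j - if i = j then (t : ℝ) - s else 0) (by fun_prop)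
        (by simp only [PiLp.sub_apply]; exact hpi.sub (integrable_const _))
      simpa only [PiLp.sub_apply] using this
    simp_rw [e]
    have h5 : Integrable (fun ω ↦ (Y ω * W s ω i) * (W t ω j - W s ω j)
        + (Y ω * W s ω j) * (W t ω i - W s ω i)) P := (h1 i j).add (h1 j i)
    rw [integral_add h5 h4, integral_add (h1 i j) (h1 j i), h2, h2, h3]
    simp

end IsFilteredBrownian

/-! ### The Itô isometry for simple processes -/

lemma leb_Ioi (T a : ℝ≥0) : leb T (Set.Ioi a) = ((T - a : ℝ≥0) : ℝ≥0∞) := by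
  have h : Set.Ioi a =ᵐ[leb T] Set.Ioc a (max a T) := by
    filter_upwards [ae_leb_le T] with s hs
    change (a < s) = (a < s ∧ s ≤ max a T)
    simp [hs]
  rw [measure_congr h, leb_Ioc, min_eq_right (le_max_right _ _), ENNReal.ofReal]
  congr 1
  ext
  rcases le_total a T with h | h
  · rw [min_eq_left h, NNReal.coe_sub h]
    exact Real.coe_toNNReal _ (sub_nonneg.2 (NNReal.coe_le_coe.2 h))
  · rw [min_eq_right h, tsub_eq_zero_of_le h]; simp

namespace SimpleProcess

/-- A simple process is a sum of scalar processes `ξ 1_{(l, ∞)} eᵢ`. -/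
lemma exists_decomp (H : SimpleProcess 𝓕 m) :
    ∃ (ι : Type) (_ : Fintype ι) (ξ : ι → Ω → ℝ) (c : ι → Fin m) (l : ι → ℝ≥0),
      (∀ a, StronglyMeasurable[𝓕 (l a)] (ξ a)) ∧ (∀ a, ∃ r, ∀ ω, |ξ a ω| ≤ r) ∧
      (∀ s ω, H.eval s ω = ∑ a, (Set.Ioi (l a)).indicator (fun _ ↦ ξ a ω) s •
        EuclideanSpace.single (c a) (1 : ℝ)) ∧
      (∀ (W : ℝ≥0 → Ω → Vec m) t ω, H.integral W t ω
        = ∑ a, ξ a ω * (W t ω (c a) - W (min (l a) t) ω (c a))) := by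
  have hcoord : ∀ k i, StronglyMeasurable[𝓕 (H.left k)] (fun ω ↦ H.ξ k ω i) := fun k i ↦
    (by fun_prop : Continuous fun v : Vec m ↦ v i).comp_stronglyMeasurable (H.measurable_ξ k)
  have hbd : ∀ k i, ∃ r, ∀ ω, |H.ξ k ω i| ≤ r := by
    intro k i
    obtain ⟨r, hr⟩ := H.bounded_ξ k
    exact ⟨r, fun ω ↦ (PiLp.norm_apply_le (H.ξ k ω) i).trans (hr ω)⟩
  -- The indicator of `(l, r]` is that of `(l, ∞)` minus that of `(r, ∞)`. Hence two copies of the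
  -- index set: left endpoints carry the coordinates of `ξ`, right endpoints those of `-ξ`.
  refine ⟨(Fin H.n × Fin m) ⊕ (Fin H.n × Fin m), inferInstance,
    Sum.elim (fun a ω ↦ H.ξ a.1 ω a.2) (fun a ω ↦ -H.ξ a.1 ω a.2),
    Sum.elim Prod.snd Prod.snd, Sum.elim (fun a ↦ H.left a.1) (fun a ↦ H.right a.1), ?_, ?_, ?_, ?_⟩
  · rintro (⟨k, i⟩ | ⟨k, i⟩)
    · exact hcoord k i
    · exact ((hcoord k i).mono (𝓕.mono (H.left_le_right k))).neg
  · rintro (⟨k, i⟩ | ⟨k, i⟩)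
    · exact hbd k i
    · simpa using hbd k i
  · intro s ω
    simp only [eval, Fintype.sum_sum_type, Sum.elim_inl, Sum.elim_inr, Fintype.sum_prod_type,
      ← Finset.sum_add_distrib]
    refine Finset.sum_congr rfl fun k _ ↦ ?_
    have hm := H.left_le_right k
    ext i
    simp only [PiLp.add_apply, PiLp.smul_apply, WithLp.ofLp_sum, Finset.sum_apply,
      PiLp.single_apply, smul_eq_mul, mul_ite, mul_one, mul_zero, Finset.sum_add_distrib,
      Finset.sum_ite_eq, Finset.mem_univ, if_true, Set.indicator_apply, Set.mem_Ioc, Set.mem_Ioi]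
    by_cases h1 : H.right k < s
    · simp [h1, hm.trans_lt h1, not_le.2 h1]
    · by_cases h2 : H.left k < s <;> simp [h1, not_lt.1 h1, h2]
  · intro W t ω
    simp only [integral, Fintype.sum_sum_type, Sum.elim_inl, Sum.elim_inr, Fintype.sum_prod_type,
      ← Finset.sum_add_distrib, PiLp.inner_apply, PiLp.sub_apply]
    refine Finset.sum_congr rfl fun k _ ↦ Finset.sum_congr rfl fun i _ ↦ ?_
    simp only [RCLike.inner_apply, conj_trivial]
    ring

lemma integrable_sq (H : SimpleProcess 𝓕 m) (T : ℝ≥0) (ω : Ω) :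
    Integrable (fun s ↦ ‖H.eval s ω‖ ^ 2) (leb T) := (H.memLp_eval T ω).integrable_norm_pow (by norm_num)

lemma isL2Martingale (hW : IsFilteredBrownian 𝓕 P T W) (H : SimpleProcess 𝓕 m) :
    IsL2Martingale 𝓕 P T (H.integral W) := by
  obtain ⟨ι, _, ξ, c, l, hξ, hb, -, h2⟩ := H.exists_decomp
  have : H.integral W = fun t ω ↦ ∑ a, ξ a ω * (W t ω (c a) - W (min (l a) t) ω (c a)) := by
    ext t ω; exact h2 W t ω
  rw [this]
  refine IsL2Martingale.sum _ fun a _ ↦ hW.isL2Martingale_start (hξ a) ?_ (c a)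
  obtain ⟨r, hr⟩ := hb a
  exact MemLp.of_bound ((hξ a).mono (𝓕.le _)).aestronglyMeasurable r (Eventually.of_forall hr)

end SimpleProcess

/-- The basis vectors are orthonormal, so only pairs with the same coordinate survive, each
integrated over the time both are active. The explicit form serves the isometry and the adaptedness
of the running square integral. -/
lemma integral_sum_start_sq {ι : Type*} [Fintype ι] (x : ι → ℝ) (c : ι → Fin m) (l : ι → ℝ≥0)
    (T : ℝ≥0) :
    ∫ s, ‖∑ a, (Set.Ioi (l a)).indicator (fun _ ↦ x a) s •
      (EuclideanSpace.single (c a) (1 : ℝ) : Vec m)‖ ^ 2 ∂(leb T)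
      = ∑ a, ∑ b, x a * x b * if c a = c b then ((T - max (l a) (l b) : ℝ≥0) : ℝ) else 0 := by
  have e : ∀ s, ‖∑ a, (Set.Ioi (l a)).indicator (fun _ ↦ x a) s •
      (EuclideanSpace.single (c a) (1 : ℝ) : Vec m)‖ ^ 2
      = ∑ a, ∑ b, (Set.Ioi (max (l a) (l b))).indicator
        (fun _ ↦ x a * x b * if c a = c b then 1 else 0) s := by
    intro s
    rw [← real_inner_self_eq_norm_sq, sum_inner]
    refine Finset.sum_congr rfl fun a _ ↦ ?_
    rw [inner_sum]
    refine Finset.sum_congr rfl fun b _ ↦ ?_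
    rw [real_inner_smul_left, real_inner_smul_right, EuclideanSpace.inner_single_left]
    simp only [PiLp.single_apply, map_one, one_mul, Set.indicator_apply, Set.mem_Ioi, max_lt_iff]
    by_cases h1 : l a < s <;> by_cases h2 : l b < s <;> simp [h1, h2]
  simp_rw [e]
  rw [integral_finsetSum]
  · refine Finset.sum_congr rfl fun a _ ↦ ?_
    rw [integral_finsetSum]
    · refine Finset.sum_congr rfl fun b _ ↦ ?_
      rw [integral_indicator measurableSet_Ioi, setIntegral_const, Measure.real, leb_Ioi]
      simp only [ENNReal.coe_toReal, smul_eq_mul]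
      split_ifs <;> ring
    · intro b _
      exact (integrable_const _).indicator measurableSet_Ioi
  · intro a _
    refine integrable_finsetSum _ fun b _ ↦ ?_
    exact (integrable_const _).indicator measurableSet_Ioi

/-- The increment from `l` to `T` is split at `l'`. The part before `l'` is known at `l'`, hence
orthogonal to the later increment; the part after it produces the covariance. -/
lemma IsFilteredBrownian.integral_start_mul_start_of_le (hW : IsFilteredBrownian 𝓕 P T W)
    {l l' : ℝ≥0} (hll : l ≤ l') {ξ η : Ω → ℝ} (hξ : StronglyMeasurable[𝓕 l] ξ)
    (hξb : ∃ r, ∀ ω, |ξ ω| ≤ r) (hη : StronglyMeasurable[𝓕 l'] η) (hηb : ∃ r, ∀ ω, |η ω| ≤ r)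
    (i j : Fin m) :
    ∫ ω, (ξ ω * (W T ω i - W (min l T) ω i)) * (η ω * (W T ω j - W (min l' T) ω j)) ∂P
      = (∫ ω, ξ ω * η ω ∂P) * if i = j then ((T - max l l' : ℝ≥0) : ℝ) else 0 := by
  rw [max_eq_right hll]
  rcases le_total l' T with h | h
  · rw [min_eq_left h, min_eq_left (hll.trans h)]
    obtain ⟨r, hr⟩ := hξb
    obtain ⟨r', hr'⟩ := hηb
    have hY : StronglyMeasurable[𝓕 l'] (fun ω ↦ ξ ω * η ω) := (hξ.mono (𝓕.mono hll)).mul hη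
    have hYb : MemLp (fun ω ↦ ξ ω * η ω) 2 P := by
      refine MemLp.of_bound (hY.mono (𝓕.le _)).aestronglyMeasurable (r * r')
        (Eventually.of_forall fun ω ↦ ?_)
      rw [norm_mul]
      exact mul_le_mul (hr ω) (hr' ω) (norm_nonneg _) ((abs_nonneg _).trans (hr ω))
    have hYW : StronglyMeasurable[𝓕 l'] (fun ω ↦ ξ ω * η ω * (W l' ω i - W l ω i)) :=
      hY.mul ((hW.adapted_coord l' i).sub ((hW.adapted_coord l i).mono (𝓕.mono hll)))
    have hYWi : Integrable (fun ω ↦ ξ ω * η ω * (W l' ω i - W l ω i)) P :=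
      hYb.integrable_mul (hW.memLp_two i hll h)
    have e : ∀ ω, (ξ ω * (W T ω i - W l ω i)) * (η ω * (W T ω j - W l' ω j))
        = (ξ ω * η ω) * ((W T ω i - W l' ω i) * (W T ω j - W l' ω j))
          + (ξ ω * η ω * (W l' ω i - W l ω i)) * (W T ω j - W l' ω j) := fun ω ↦ by ring
    simp_rw [e]
    have h1 := hW.integral_mul_increment h le_rfl hY (g := fun v ↦ v i * v j) (by fun_prop)
    have h2 := hW.integral_mul_increment h le_rfl hYW (g := fun v ↦ v j) (by fun_prop)
    have h3 := hW.integrable_mul_increment h le_rfl hY (hYb.integrable (by norm_num))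
      (g := fun v ↦ v i * v j) (by fun_prop)
      (by simp only [PiLp.sub_apply]
          exact (hW.memLp_two i h le_rfl).integrable_mul (hW.memLp_two j h le_rfl))
    have h4 := hW.integrable_mul_increment h le_rfl hYW hYWi
      (g := fun v ↦ v j) (by fun_prop)
      (by simp only [PiLp.sub_apply]
          exact (hW.memLp_two j h le_rfl).integrable (by norm_num))
    simp only [PiLp.sub_apply] at h1 h2 h3 h4
    rw [integral_add h3 h4, h1, h2, hW.mean _ _ j h le_rfl, hW.cov _ _ i j h le_rfl,
      NNReal.coe_sub h, mul_zero, add_zero]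
  · rw [min_eq_right h, tsub_eq_zero_of_le h]
    simp

lemma IsFilteredBrownian.integral_start_mul_start (hW : IsFilteredBrownian 𝓕 P T W)
    {l l' : ℝ≥0} {ξ η : Ω → ℝ} (hξ : StronglyMeasurable[𝓕 l] ξ)
    (hξb : ∃ r, ∀ ω, |ξ ω| ≤ r) (hη : StronglyMeasurable[𝓕 l'] η) (hηb : ∃ r, ∀ ω, |η ω| ≤ r)
    (i j : Fin m) :
    ∫ ω, (ξ ω * (W T ω i - W (min l T) ω i)) * (η ω * (W T ω j - W (min l' T) ω j)) ∂P
      = (∫ ω, ξ ω * η ω ∂P) * if i = j then ((T - max l l' : ℝ≥0) : ℝ) else 0 := by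
  rcases le_total l l' with h | h
  · exact hW.integral_start_mul_start_of_le h hξ hξb hη hηb i j
  · have := hW.integral_start_mul_start_of_le h hη hηb hξ hξb j i
    simp_rw [fun ω ↦ mul_comm (η ω) (ξ ω), max_comm l' l, @eq_comm _ j i] at this
    rw [← this]
    congr 1; ext ω; ring

namespace SimpleProcess

/-- The Itô isometry for simple processes. -/
lemma isometry (hW : IsFilteredBrownian 𝓕 P T W) (H : SimpleProcess 𝓕 m) :
    ∫ ω, H.integral W T ω ^ 2 ∂P = ∫ ω, ∫ s, ‖H.eval s ω‖ ^ 2 ∂(leb T) ∂P := by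
  obtain ⟨ι, _, ξ, c, l, hξ, hb, h1, h2⟩ := H.exists_decomp
  simp_rw [h1, h2 W, integral_sum_start_sq]
  have hL : ∀ a, MemLp (ξ a) 2 P := fun a ↦ by
    obtain ⟨r, hr⟩ := hb a
    exact MemLp.of_bound ((hξ a).mono (𝓕.le _)).aestronglyMeasurable r (Eventually.of_forall hr)
  have hM : ∀ a, MemLp (fun ω ↦ ξ a ω * (W T ω (c a) - W (min (l a) T) ω (c a))) 2 P := fun a ↦
    (hW.isL2Martingale_start (hξ a) (hL a) (c a)).memLp T le_rfl
  have hMi : ∀ a b, Integrable (fun ω ↦ (ξ a ω * (W T ω (c a) - W (min (l a) T) ω (c a)))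
      * (ξ b ω * (W T ω (c b) - W (min (l b) T) ω (c b)))) P := fun a b ↦
    (hM a).integrable_mul (hM b)
  have hLi : ∀ a b, Integrable (fun ω ↦ ξ a ω * ξ b ω *
      if c a = c b then ((T - max (l a) (l b) : ℝ≥0) : ℝ) else 0) P := fun a b ↦
    ((hL a).integrable_mul (hL b)).mul_const _
  simp_rw [sq, Finset.sum_mul_sum]
  rw [integral_finsetSum _ fun a _ ↦ integrable_finsetSum _ fun b _ ↦ hMi a b,
    integral_finsetSum _ fun a _ ↦ integrable_finsetSum _ fun b _ ↦ hLi a b]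
  refine Finset.sum_congr rfl fun a _ ↦ ?_
  rw [integral_finsetSum _ fun b _ ↦ hMi a b, integral_finsetSum _ fun b _ ↦ hLi a b]
  refine Finset.sum_congr rfl fun b _ ↦ ?_
  rw [integral_mul_const, hW.integral_start_mul_start (hξ a) (hb a) (hξ b) (hb b)]

/-- The running square integral of a simple process is adapted. -/
lemma stronglyMeasurable_integral_sq (H : SimpleProcess 𝓕 m) (t : ℝ≥0) :
    StronglyMeasurable[𝓕 t] (fun ω ↦ ∫ s, ‖H.eval s ω‖ ^ 2 ∂(leb t)) := by
  obtain ⟨ι, _, ξ, c, l, hξ, hb, h1, -⟩ := H.exists_decomp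
  simp_rw [h1, integral_sum_start_sq]
  refine Finset.stronglyMeasurable_fun_sum _ fun a _ ↦ Finset.stronglyMeasurable_fun_sum _ fun b _ ↦ ?_
  rcases le_total (max (l a) (l b)) t with h | h
  · exact (((hξ a).mono (𝓕.mono ((le_max_left _ _).trans h))).mul
      ((hξ b).mono (𝓕.mono ((le_max_right _ _).trans h)))).mul stronglyMeasurable_const
  · rw [tsub_eq_zero_of_le h]
    simp only [NNReal.coe_zero, ite_self, mul_zero]
    exact stronglyMeasurable_const

lemma integral_sq_le (H : SimpleProcess 𝓕 m) {c : ℝ} (hc : ∀ s ω, ‖H.eval s ω‖ ≤ c) (t : ℝ≥0)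
    (ω : Ω) : ∫ s, ‖H.eval s ω‖ ^ 2 ∂(leb t) ≤ c ^ 2 * t := by
  calc ∫ s, ‖H.eval s ω‖ ^ 2 ∂(leb t) ≤ ∫ _, c ^ 2 ∂(leb t) := by
        refine integral_mono (H.integrable_sq t ω) (integrable_const _) fun s ↦ ?_
        have := hc s ω
        simp only
        gcongr
    _ = c ^ 2 * t := by
        rw [integral_const, Measure.real, leb_univ]; simp [mul_comm]

lemma maximal_ineq (hW : IsFilteredBrownian 𝓕 P T W) (H : SimpleProcess 𝓕 m) {ε : ℝ}
    (hε : 0 < ε) :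
    ENNReal.ofReal (ε ^ 2 / 4) * P {ω | ∃ t ≤ T, ε ≤ |H.integral W t ω|}
      ≤ ENNReal.ofReal (∫ ω, ∫ s, ‖H.eval s ω‖ ^ 2 ∂(leb T) ∂P) := by
  rw [← H.isometry hW]
  refine (H.isL2Martingale hW).maximal_ineq ?_ hε
  filter_upwards [hW.continuous] with ω h using H.continuousOn_integral h

/-- Multiplication of a simple process by a bounded adapted step process. -/
lemma exists_step (H : SimpleProcess 𝓕 m) {τ : ℕ → ℝ≥0} (hτ : Monotone τ) {φ : ℕ → Ω → ℝ}
    (hφ : ∀ k, StronglyMeasurable[𝓕 (τ k)] (φ k)) (hb : ∀ k, ∃ r, ∀ ω, |φ k ω| ≤ r)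
    (W : ℝ≥0 → Ω → Vec m) (N : ℕ) :
    ∃ H' : SimpleProcess 𝓕 m,
      (∀ s ω, H'.eval s ω = (∑ k ∈ Finset.range N,
        (Set.Ioc (τ k) (τ (k + 1))).indicator (fun _ ↦ φ k ω) s) • H.eval s ω) ∧
      ∀ t ω, H'.integral W t ω = ∑ k ∈ Finset.range N,
        φ k ω * (H.integral W (min (τ (k + 1)) t) ω - H.integral W (min (τ k) t) ω) := by
  induction N with
  | zero => exact ⟨zero, by simp [zero_eval], by simp [zero_integral]⟩
  | succ N ih =>
    obtain ⟨H', h1, h2⟩ := ih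
    have hm := hτ (Nat.le_succ N)
    have hneg : StronglyMeasurable[𝓕 (τ (N + 1))] (fun ω ↦ -φ N ω) :=
      ((hφ N).mono (𝓕.mono hm)).neg
    refine ⟨(H'.add (H.start _ _ (hφ N) (hb N))).add (H.start _ _ hneg (by simpa using hb N)), ?_, ?_⟩
    · intro s ω
      rw [add_eval, add_eval, start_eval, start_eval, h1, ← add_smul, ← add_smul,
        Finset.sum_range_succ, add_assoc]
      congr 2
      simp only [Set.indicator_apply, Set.mem_Ioc, Set.mem_Ioi]
      by_cases h1 : τ (N + 1) < s
      · simp [h1, hm.trans_lt h1, not_le.2 h1]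
      · simp [h1, not_lt.1 h1]
    · intro t ω
      rw [add_integral, add_integral, start_integral, start_integral, h2, Finset.sum_range_succ]
      ring

end SimpleProcess

/-! ### A Lenglart inequality and uniqueness of the integral -/

/-- The last increment counted starts from a value below `η` and adds at most `c`. The bound by `q
N` is included to make the induction close. -/
lemma sum_truncated_le {q : ℕ → ℝ} {η c : ℝ} (hη : 0 ≤ η) (hc : 0 ≤ c) (h0 : q 0 = 0)
    (hmono : ∀ k, q k ≤ q (k + 1)) (hstep : ∀ k, q (k + 1) - q k ≤ c) (N : ℕ) :
    ∑ k ∈ Finset.range N, (if q k < η then (1 : ℝ) else 0) * (q (k + 1) - q k) ≤ min (q N) (η + c) := by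
  induction N with
  | zero => simp [h0]; positivity
  | succ N ih =>
    rw [Finset.sum_range_succ]
    have h1 := ih.trans (min_le_left _ _)
    have h2 := ih.trans (min_le_right _ _)
    have h3 := hmono N
    have h4 := hstep N
    rw [le_min_iff]
    split_ifs with h
    · constructor <;> linarith
    · constructor <;> linarith

/-- A Lenglart type inequality for simple processes. -/
lemma SimpleProcess.lenglart (hW : IsFilteredBrownian 𝓕 P T W) (H : SimpleProcess 𝓕 m) {ε η : ℝ}
    (hε : 0 < ε) (hη : 0 < η) :
    ENNReal.ofReal (ε ^ 2 / 4) * P {ω | ∃ t ≤ T, ε ≤ |H.integral W t ω|}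
      ≤ ENNReal.ofReal (ε ^ 2 / 4) * P {ω | η ≤ ∫ s, ‖H.eval s ω‖ ^ 2 ∂(leb T)}
        + ENNReal.ofReal η := by
  obtain ⟨c, hc0, hc⟩ := H.exists_bound
  set q : ℝ≥0 → Ω → ℝ := fun t ω ↦ ∫ s, ‖H.eval s ω‖ ^ 2 ∂(leb t) with hq
  have hqinc : ∀ {s t : ℝ≥0} (ω : Ω), s ≤ t → q t ω - q s ω = ∫ r in Set.Ioc s t, ‖H.eval r ω‖ ^ 2 ∂(leb t) :=
    fun {s t} ω hst ↦ leb_integral_sub hst le_rfl (H.integrable_sq t ω)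
  have hqmono : ∀ (ω : Ω) {s t : ℝ≥0}, s ≤ t → q s ω ≤ q t ω := by
    intro ω s t hst
    have h := hqinc ω hst
    have : 0 ≤ ∫ r in Set.Ioc s t, ‖H.eval r ω‖ ^ 2 ∂(leb t) :=
      integral_nonneg fun _ ↦ by positivity
    linarith
  have hqstep : ∀ (ω : Ω) (n k : ℕ), q (gridPt T n (k + 1)) ω - q (gridPt T n k) ω
      ≤ c ^ 2 * (T / 8 ^ n) := by
    intro ω n k
    have hm : gridPt T n k ≤ gridPt T n (k + 1) := gridPt_mono T n (Nat.le_succ k)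
    rw [hqinc ω hm, ← gridPt_succ_sub T n k]
    calc ∫ r in Set.Ioc (gridPt T n k) (gridPt T n (k + 1)), ‖H.eval r ω‖ ^ 2 ∂(leb (gridPt T n (k + 1)))
        ≤ ∫ r in Set.Ioc (gridPt T n k) (gridPt T n (k + 1)), c ^ 2 ∂(leb (gridPt T n (k + 1))) := by
          refine integral_mono (H.integrable_sq _ ω).integrableOn (integrable_const _) fun s ↦ ?_
          simp only
          gcongr
          exact hc s ω
      _ = _ := by
          rw [setIntegral_const, Measure.real, leb_Ioc, min_self, min_eq_left hm,
            ENNReal.toReal_ofReal (sub_nonneg.2 (NNReal.coe_le_coe.2 hm)), smul_eq_mul, mul_comm]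
  have hq0 : ∀ ω, q 0 ω = 0 := by
    intro ω
    have h1 := H.integral_sq_le hc 0 ω
    have h2 : 0 ≤ q 0 ω := integral_nonneg fun _ ↦ by positivity
    simp only [NNReal.coe_zero, mul_zero] at h1
    exact le_antisymm h1 h2
  -- The integrand is switched off once the accumulated square reaches `η`. The test is made at grid
  -- times only, which keeps the stopped process simple at the price of an overshoot of at most one
  -- cell.
  set X : ℝ≥0 → Ω → ℝ := fun t ω ↦ if q t ω < η then 1 else 0 with hX
  have hX01 : ∀ t ω, X t ω = 0 ∨ X t ω = 1 := by
    intro t ω; simp only [hX]; split_ifs <;> simp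
  have hXm : ∀ t, StronglyMeasurable[𝓕 t] (X t) := by
    intro t
    have h1 := (H.stronglyMeasurable_integral_sq t).measurable
    have h2 : MeasurableSet[𝓕 t] {ω | q t ω < η} := h1 measurableSet_Iio
    exact StronglyMeasurable.ite h2 stronglyMeasurable_const stronglyMeasurable_const
  have key : ∀ n : ℕ, ENNReal.ofReal (ε ^ 2 / 4) * P {ω | ∃ t ≤ T, ε ≤ |H.integral W t ω|}
      ≤ ENNReal.ofReal (ε ^ 2 / 4) * P {ω | η ≤ q T ω}
        + ENNReal.ofReal (η + c ^ 2 * (T / 8 ^ n)) := by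
    intro n
    obtain ⟨H', h1, h2⟩ := H.exists_step (gridPt_mono T n) (φ := fun k ↦ X (gridPt T n k))
      (fun k ↦ hXm _) (fun k ↦ ⟨1, fun ω ↦ by rcases hX01 (gridPt T n k) ω with h | h <;> simp [h]⟩)
      W (8 ^ n)
    have h1' : ∀ s ω, H'.eval s ω = stepProc T n (fun r ↦ X r ω) s • H.eval s ω := h1
    have hbound : ∀ ω, ∫ s, ‖H'.eval s ω‖ ^ 2 ∂(leb T) ≤ η + c ^ 2 * (T / 8 ^ n) := by
      intro ω
      have e : ∫ s, ‖H'.eval s ω‖ ^ 2 ∂(leb T)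
          = ∫ s, stepProc T n (fun r ↦ X r ω) s * ‖H.eval s ω‖ ^ 2 ∂(leb T) := by
        refine integral_congr_ae ?_
        filter_upwards [ae_leb_mem_Ioc T] with s hs
        obtain ⟨k, hk, h3, h4⟩ := exists_grid_cell n hs.1 hs.2
        rw [h1', stepProc_eq _ hk h3 h4, norm_smul]
        rcases hX01 (gridPt T n k) ω with h | h <;> simp [h]
      rw [e, ← riemannSum_eq_integral n (fun r ↦ X r ω) (B := fun t ↦ q t ω)
        (H.integrable_sq T ω) (fun t _ ↦ by rw [hq0, zero_add]) le_rfl]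
      have h5 := sum_truncated_le (q := fun k ↦ q (gridPt T n k) ω) hη.le
        (c := c ^ 2 * (T / 8 ^ n)) (by positivity) (by rw [gridPt_zero, hq0])
        (fun k ↦ hqmono ω (gridPt_mono T n (Nat.le_succ k))) (hqstep ω n) (8 ^ n)
      refine le_trans (le_of_eq ?_) (h5.trans (min_le_right _ _))
      refine Finset.sum_congr rfl fun k hk ↦ ?_
      have hk' := Finset.mem_range.1 hk
      rw [min_eq_left (gridPt_le hk'), min_eq_left (gridPt_le hk'.le)]
    have hE : ∫ ω, ∫ s, ‖H'.eval s ω‖ ^ 2 ∂(leb T) ∂P ≤ η + c ^ 2 * (T / 8 ^ n) := by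
      have hm := ((H'.stronglyMeasurable_integral_sq T).mono (𝓕.le _))
      calc ∫ ω, ∫ s, ‖H'.eval s ω‖ ^ 2 ∂(leb T) ∂P ≤ ∫ _, (η + c ^ 2 * (T / 8 ^ n)) ∂P := by
            refine integral_mono ?_ (integrable_const _) hbound
            refine Integrable.of_bound hm.aestronglyMeasurable (η + c ^ 2 * (T / 8 ^ n))
              (Eventually.of_forall fun ω ↦ ?_)
            rw [Real.norm_eq_abs, abs_of_nonneg (integral_nonneg fun _ ↦ by positivity)]
            exact hbound ω
        _ = _ := by simp
    -- Where the total stays below `η` nothing is switched off, so the stopped and the original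
    -- integrals coincide.
    have hsub : {ω | ∃ t ≤ T, ε ≤ |H.integral W t ω|} ⊆ {ω | η ≤ q T ω}
        ∪ {ω | ∃ t ≤ T, ε ≤ |H'.integral W t ω|} := by
      rintro ω ⟨t, ht, hle⟩
      by_cases h : η ≤ q T ω
      · exact Or.inl h
      · right
        refine ⟨t, ht, ?_⟩
        have e : H'.integral W t ω = H.integral W t ω := by
          rw [h2]
          have : ∀ k ∈ Finset.range (8 ^ n), X (gridPt T n k) ω *
              (H.integral W (min (gridPt T n (k + 1)) t) ω - H.integral W (min (gridPt T n k) t) ω)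
              = H.integral W (min (gridPt T n (k + 1)) t) ω - H.integral W (min (gridPt T n k) t) ω := by
            intro k hk
            have h6 : q (gridPt T n k) ω < η :=
              (hqmono ω (gridPt_le (Finset.mem_range.1 hk).le)).trans_lt (not_le.1 h)
            simp [hX, h6]
          rw [Finset.sum_congr rfl this, sum_grid_increments n (fun t ↦ H.integral W t ω) ht,
            integral_zero, sub_zero]
        rwa [e]
    calc _ ≤ ENNReal.ofReal (ε ^ 2 / 4) * (P {ω | η ≤ q T ω}
          + P {ω | ∃ t ≤ T, ε ≤ |H'.integral W t ω|}) := by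
          gcongr
          exact (measure_mono hsub).trans (measure_union_le _ _)
      _ ≤ _ := by
          rw [mul_add]
          gcongr
          exact (H'.maximal_ineq hW hε).trans (ENNReal.ofReal_le_ofReal hE)
  -- Refining the grid removes the overshoot.
  have hlim : Tendsto (fun n : ℕ ↦ ENNReal.ofReal (ε ^ 2 / 4) * P {ω | η ≤ q T ω}
        + ENNReal.ofReal (η + c ^ 2 * (T / 8 ^ n))) atTop
      (𝓝 (ENNReal.ofReal (ε ^ 2 / 4) * P {ω | η ≤ q T ω} + ENNReal.ofReal η)) := by
    refine tendsto_const_nhds.add (ENNReal.tendsto_ofReal ?_)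
    have h4 : Tendsto (fun n : ℕ ↦ (T : ℝ) / 8 ^ n) atTop (𝓝 0) :=
      tendsto_const_nhds.div_atTop (tendsto_pow_atTop_atTop_of_one_lt (by norm_num))
    simpa using (h4.const_mul (c ^ 2)).const_add η
  exact ge_of_tendsto' hlim key

/-- The Itô integral of the zero process vanishes. -/
theorem IsItoIntegral.eq_zero (hW : IsFilteredBrownian 𝓕 P T W) (h : IsItoIntegral 𝓕 P T W H I)
    (hH : ∀ᵐ ω ∂P, ∀ᵐ s ∂(leb T), H s ω = 0) : ∀ᵐ ω ∂P, ∀ t ≤ T, I t ω = 0 := by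
  have h0 := h.congr (K := fun _ _ ↦ 0) hH (Eventually.of_forall fun ω t _ ↦ rfl)
  obtain ⟨Hn, h1, h2⟩ := h0.approx
  have key : ∀ ε : ℝ, 0 < ε → P {ω | ∃ t ≤ T, 2 * ε ≤ |I t ω|} = 0 := by
    intro ε hε
    set c := ENNReal.ofReal (ε ^ 2 / 4) with hc
    have hc0 : c ≠ 0 := by rw [hc]; simp; positivity
    have hctop : c ≠ ∞ := ENNReal.ofReal_ne_top
    -- The simple approximations have square integrals tending to zero in probability, so Lenglart's
    -- inequality leaves only the term `η`, which is arbitrary.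
    have hle : ∀ η : ℝ, 0 < η → c * P {ω | ∃ t ≤ T, 2 * ε ≤ |I t ω|} ≤ ENNReal.ofReal η := by
      intro η hη
      have hlim : Tendsto (fun n ↦ c * P {ω | ∃ t ≤ T, ε ≤ |(Hn n).integral W t ω - I t ω|}
          + (c * P {ω | ENNReal.ofReal η ≤ ∫⁻ s, ‖(Hn n).eval s ω - 0‖ₑ ^ 2 ∂(leb T)}
            + ENNReal.ofReal η)) atTop (𝓝 (c * 0 + (c * 0 + ENNReal.ofReal η))) := by
        refine (ENNReal.Tendsto.const_mul (h2 ε hε) (Or.inr hctop)).add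
          ((ENNReal.Tendsto.const_mul (h1 _ (by simpa using hη)) (Or.inr hctop)).add
            tendsto_const_nhds)
      simp only [mul_zero, zero_add] at hlim
      refine ge_of_tendsto' hlim fun n ↦ ?_
      have hsub : {ω | ∃ t ≤ T, 2 * ε ≤ |I t ω|} ⊆
          {ω | ∃ t ≤ T, ε ≤ |(Hn n).integral W t ω - I t ω|}
            ∪ {ω | ∃ t ≤ T, ε ≤ |(Hn n).integral W t ω|} := by
        rintro ω ⟨t, ht, hle⟩
        by_cases h3 : ε ≤ |(Hn n).integral W t ω|
        · exact Or.inr ⟨t, ht, h3⟩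
        · refine Or.inl ⟨t, ht, ?_⟩
          have := abs_sub_abs_le_abs_sub (I t ω) ((Hn n).integral W t ω)
          rw [abs_sub_comm] at this
          linarith [not_le.1 h3]
      have heq : ∀ ω, ENNReal.ofReal (∫ s, ‖(Hn n).eval s ω‖ ^ 2 ∂(leb T))
          = ∫⁻ s, ‖(Hn n).eval s ω - 0‖ₑ ^ 2 ∂(leb T) := by
        intro ω
        rw [ofReal_integral_eq_lintegral_ofReal ((Hn n).integrable_sq T ω)
          (Eventually.of_forall fun _ ↦ by positivity)]
        refine lintegral_congr fun s ↦ ?_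
        rw [sub_zero, ENNReal.ofReal_pow (norm_nonneg _), ofReal_norm]
      calc _ ≤ c * (P {ω | ∃ t ≤ T, ε ≤ |(Hn n).integral W t ω - I t ω|}
            + P {ω | ∃ t ≤ T, ε ≤ |(Hn n).integral W t ω|}) := by
            gcongr
            exact (measure_mono hsub).trans (measure_union_le _ _)
        _ ≤ _ := by
            rw [mul_add]
            gcongr
            refine ((Hn n).lenglart hW hε hη).trans ?_
            gcongr with ω
            intro h3
            rw [← heq]
            exact ENNReal.ofReal_le_ofReal h3
    have hz : c * P {ω | ∃ t ≤ T, 2 * ε ≤ |I t ω|} = 0 := by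
      refine le_antisymm (le_of_forall_pos_le_add fun δ hδ ↦ ?_) zero_le
      rw [zero_add]
      rcases eq_or_ne δ ∞ with h | h
      · simp [h]
      · have := hle δ.toReal (ENNReal.toReal_pos hδ.ne' h)
        rwa [ENNReal.ofReal_toReal h] at this
    exact (mul_eq_zero.1 hz).resolve_left hc0
  have hall : ∀ᵐ ω ∂P, ∀ k : ℕ, ¬ ∃ t ≤ T, 2 * (1 / ((k : ℝ) + 1)) ≤ |I t ω| := by
    rw [ae_all_iff]
    intro k
    rw [ae_iff]
    simp only [not_not]
    exact key _ (by positivity)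
  filter_upwards [hall] with ω hω t ht
  by_contra hne
  obtain ⟨k, hk⟩ := exists_nat_one_div_lt (show 0 < |I t ω| / 2 by positivity)
  exact hω k ⟨t, ht, by linarith⟩

/-! ### Quadratic variation of Brownian motion -/

lemma integral_sq_sum_of_orthogonal {N : ℕ} {D : ℕ → Ω → ℝ} (hD : ∀ k < N, MemLp (D k) 2 P)
    (ho : ∀ j k, j < k → k < N → ∫ ω, D j ω * D k ω ∂P = 0) :
    ∫ ω, (∑ k ∈ Finset.range N, D k ω) ^ 2 ∂P = ∑ k ∈ Finset.range N, ∫ ω, D k ω ^ 2 ∂P := by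
  have hi : ∀ j ∈ Finset.range N, ∀ k ∈ Finset.range N, Integrable (fun ω ↦ D j ω * D k ω) P :=
    fun j hj k hk ↦ (hD j (Finset.mem_range.1 hj)).integrable_mul (hD k (Finset.mem_range.1 hk))
  simp_rw [sq, Finset.sum_mul_sum]
  rw [integral_finsetSum _ fun j hj ↦ integrable_finsetSum _ fun k hk ↦ hi j hj k hk]
  refine Finset.sum_congr rfl fun j hj ↦ ?_
  rw [integral_finsetSum _ fun k hk ↦ hi j hj k hk]
  rw [Finset.sum_eq_single_of_mem j hj]
  intro k hk hkj
  rcases lt_or_gt_of_ne hkj with h | h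
  · simp_rw [mul_comm (D j _)]
    exact ho k j h (Finset.mem_range.1 hj)
  · exact ho j k h (Finset.mem_range.1 hk)

namespace IsFilteredBrownian

/-- Each cell contributes a difference of two integrals started at its endpoints. The coefficient is
unbounded but square integrable, which `isL2Martingale_start` allows. -/
lemma isL2Martingale_riemannSum (hW : IsFilteredBrownian 𝓕 P T W) (n : ℕ) (i j : Fin m) :
    IsL2Martingale 𝓕 P T
      (fun t ω ↦ riemannSum T n (fun r ↦ W r ω i) (fun r ↦ W r ω j) t) := by
  have e : (fun t ω ↦ riemannSum T n (fun r ↦ W r ω i) (fun r ↦ W r ω j) t) =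
      fun t ω ↦ ∑ k ∈ Finset.range (8 ^ n),
        (W (gridPt T n k) ω i * (W t ω j - W (min (gridPt T n k) t) ω j)
          + -1 * (W (gridPt T n k) ω i * (W t ω j - W (min (gridPt T n (k + 1)) t) ω j))) := by
    ext t ω
    refine Finset.sum_congr rfl fun k _ ↦ ?_
    ring
  rw [e]
  refine IsL2Martingale.sum _ fun k hk ↦ ?_
  have h2 : MemLp (fun ω ↦ W (gridPt T n k) ω i) 2 P :=
    (hW.memLp_coord i (gridPt_le (Finset.mem_range.1 hk).le)).mono_exponent (by norm_num)
  exact (hW.isL2Martingale_start (hW.adapted_coord _ i) h2 j).add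
    ((hW.isL2Martingale_start ((hW.adapted_coord _ i).mono
      (𝓕.mono (gridPt_mono T n (Nat.le_succ k)))) h2 j).const_mul (-1))

/-- The compensated sum of products of increments. -/
def compensated (W : ℝ≥0 → Ω → Vec m) (T : ℝ≥0) (i j : Fin m) (n : ℕ) (t : ℝ≥0) (ω : Ω) : ℝ :=
  (W t ω i * W t ω j - if i = j then (t : ℝ) else 0)
    + -1 * (riemannSum T n (fun r ↦ W r ω i) (fun r ↦ W r ω j) t
      + riemannSum T n (fun r ↦ W r ω j) (fun r ↦ W r ω i) t)

/-- The definition displays the martingale property; this form, by summation by parts, displays the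
cross sum minus its mean. -/
lemma compensated_eq {i j : Fin m} {n : ℕ} {t : ℝ≥0} {ω : Ω} (ht : t ≤ T)
    (h0 : W 0 ω = 0) : compensated W T i j n t ω
      = crossSum T n (fun r ↦ W r ω i) (fun r ↦ W r ω j) t - if i = j then (t : ℝ) else 0 := by
  have h := mul_sub_eq_riemannSum n (fun r ↦ W r ω i) (fun r ↦ W r ω j) ht
  simp only [h0, PiLp.zero_apply, mul_zero, sub_zero] at h
  simp only [compensated]
  rw [h]; ring

lemma isL2Martingale_compensated (hW : IsFilteredBrownian 𝓕 P T W) (i j : Fin m) (n : ℕ) :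
    IsL2Martingale 𝓕 P T (compensated W T i j n) :=
  (hW.isL2Martingale_mul i j).add
    (((hW.isL2Martingale_riemannSum n i j).add (hW.isL2Martingale_riemannSum n j i)).const_mul (-1))

lemma continuousOn_riemannSum {X Y : ℝ≥0 → ℝ} (hY : ContinuousOn Y (Set.Iic T)) (n : ℕ) :
    ContinuousOn (riemannSum T n X Y) (Set.Iic T) := by
  unfold riemannSum
  refine continuousOn_finsetSum _ fun k _ ↦ continuousOn_const.mul ?_
  have h : ∀ u : ℝ≥0, ContinuousOn (fun t ↦ Y (min u t)) (Set.Iic T) := fun u ↦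
    hY.comp (f := fun t ↦ min u t) (by fun_prop) fun t ht ↦
      (min_le_right u t).trans (Set.mem_Iic.1 ht)
  exact (h _).sub (h _)

lemma continuousOn_compensated (hW : IsFilteredBrownian 𝓕 P T W) (i j : Fin m) (n : ℕ) :
    ∀ᵐ ω ∂P, ContinuousOn (fun t ↦ compensated W T i j n t ω) (Set.Iic T) := by
  filter_upwards [hW.continuousOn_coord i, hW.continuousOn_coord j] with ω hi hj
  refine ((hi.mul hj).sub ?_).add (continuousOn_const.mul
    ((continuousOn_riemannSum hj n).add (continuousOn_riemannSum hi n)))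
  split_ifs
  · exact NNReal.continuous_coe.continuousOn
  · exact continuousOn_const

/-- The centred products over different cells are orthogonal, and each has second moment of the
order of the squared cell length. With `8^n` cells of length `T / 8^n` the total is of order
`8^{-n}`. -/
lemma exists_integral_compensated_sq_le (hW : IsFilteredBrownian 𝓕 P T W) (i j : Fin m) :
    ∃ C : ℝ, ∀ n, ∫ ω, compensated W T i j n T ω ^ 2 ∂P ≤ C / 8 ^ n := by
  obtain ⟨κ, hκ⟩ := hW.fourth
  -- From `(xy - h)² ≤ x⁴ + y⁴ + 2h²`, with fourth moments `κ h²` for each of the two factors.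
  refine ⟨(2 * κ + 2) * T ^ 2, fun n ↦ ?_⟩
  set h : ℝ := T / 8 ^ n with hh
  let D : ℕ → Ω → ℝ := fun k ω ↦ (W (gridPt T n (k + 1)) ω i - W (gridPt T n k) ω i)
    * (W (gridPt T n (k + 1)) ω j - W (gridPt T n k) ω j) - if i = j then h else 0
  have e : ∀ᵐ ω ∂P, compensated W T i j n T ω ^ 2 = (∑ k ∈ Finset.range (8 ^ n), D k ω) ^ 2 := by
    filter_upwards [hW.zero] with ω h0
    rw [compensated_eq le_rfl h0]
    congr 1
    simp only [D, Finset.sum_sub_distrib, Finset.sum_const, Finset.card_range, crossSum]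
    congr 1
    · refine Finset.sum_congr rfl fun k hk ↦ ?_
      have hk' := Finset.mem_range.1 hk
      rw [min_eq_left (gridPt_le hk'), min_eq_left (gridPt_le hk'.le)]
    · split_ifs
      · rw [hh, nsmul_eq_mul]; push_cast; field_simp
      · simp
  rw [integral_congr_ae e]
  have hle : ∀ k, k < 8 ^ n → gridPt T n k ≤ gridPt T n (k + 1) ∧ gridPt T n (k + 1) ≤ T :=
    fun k hk ↦ ⟨gridPt_mono T n (Nat.le_succ k), gridPt_le hk⟩
  have hprod : ∀ k < 8 ^ n, MemLp (fun ω ↦ (W (gridPt T n (k + 1)) ω i - W (gridPt T n k) ω i)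
    * (W (gridPt T n (k + 1)) ω j - W (gridPt T n k) ω j)) 2 P := by
    intro k hk
    exact (hW.memLp _ _ j (hle k hk).1 (hle k hk).2).mul'
      (hW.memLp _ _ i (hle k hk).1 (hle k hk).2) (hpqr := ⟨by
      rw [← ENNReal.toReal_eq_toReal_iff' (by finiteness) (by finiteness)]
      rw [ENNReal.toReal_add (by finiteness) (by finiteness)]; norm_num⟩)
  have hD : ∀ k < 8 ^ n, MemLp (D k) 2 P := fun k hk ↦ (hprod k hk).sub (memLp_const _)
  have hmean : ∀ k < 8 ^ n, ∫ ω, D k ω ∂P = 0 := by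
    intro k hk
    simp only [D]
    rw [integral_sub ((hprod k hk).integrable (by norm_num)) (integrable_const _),
      hW.cov _ _ i j (hle k hk).1 (hle k hk).2, gridPt_succ_sub]
    simp [hh]
  have hDm : ∀ k, StronglyMeasurable[𝓕 (gridPt T n (k + 1))] (D k) := by
    intro k
    have hm := 𝓕.mono (gridPt_mono T n (Nat.le_succ k))
    exact (((hW.adapted_coord _ i).sub ((hW.adapted_coord _ i).mono hm)).mul
      ((hW.adapted_coord _ j).sub ((hW.adapted_coord _ j).mono hm))).sub stronglyMeasurable_const
  rw [integral_sq_sum_of_orthogonal hD]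
  · have hDsq : ∀ k ∈ Finset.range (8 ^ n), ∫ ω, D k ω ^ 2 ∂P ≤ (2 * κ + 2) * h ^ 2 := by
      intro k hk
      have hk' := Finset.mem_range.1 hk
      have h4 : ∀ i, Integrable (fun ω ↦ (W (gridPt T n (k + 1)) ω i - W (gridPt T n k) ω i) ^ 4) P := by
        intro i
        have := (hW.memLp _ _ i (hle k hk').1 (hle k hk').2).integrable_norm_pow (by norm_num)
        refine this.congr (Eventually.of_forall fun ω ↦ ?_)
        simp [Real.norm_eq_abs, Even.pow_abs (by decide : Even 4)]
      have h5 : Integrable (fun ω ↦ (W (gridPt T n (k + 1)) ω i - W (gridPt T n k) ω i) ^ 4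
          + (W (gridPt T n (k + 1)) ω j - W (gridPt T n k) ω j) ^ 4) P := (h4 i).add (h4 j)
      calc ∫ ω, D k ω ^ 2 ∂P
          ≤ ∫ ω, ((W (gridPt T n (k + 1)) ω i - W (gridPt T n k) ω i) ^ 4
            + (W (gridPt T n (k + 1)) ω j - W (gridPt T n k) ω j) ^ 4 + 2 * h ^ 2) ∂P := by
            refine integral_mono (hD k hk').integrable_sq (h5.add (integrable_const _)) fun ω ↦ ?_
            simp only [D]
            set x := W (gridPt T n (k + 1)) ω i - W (gridPt T n k) ω i
            set y := W (gridPt T n (k + 1)) ω j - W (gridPt T n k) ω j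
            split_ifs
            · nlinarith [sq_nonneg (x ^ 2 - y ^ 2), sq_nonneg (x * y + h)]
            · nlinarith [sq_nonneg (x ^ 2 - y ^ 2), sq_nonneg (x * y), sq_nonneg h]
        _ = (2 * κ + 2) * h ^ 2 := by
            rw [integral_add h5 (integrable_const _), integral_add (h4 i) (h4 j),
              hκ _ _ i (hle k hk').1 (hle k hk').2, hκ _ _ j (hle k hk').1 (hle k hk').2,
              gridPt_succ_sub]
            simp
            ring
    refine (Finset.sum_le_sum hDsq).trans (le_of_eq ?_)
    rw [Finset.sum_const, Finset.card_range, nsmul_eq_mul, hh]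
    push_cast
    field_simp
  · intro a k hak hk
    have := hW.integral_mul_increment (hle k hk).1 (hle k hk).2
      ((hDm a).mono (𝓕.mono (gridPt_mono T n (by omega : a + 1 ≤ k))))
      (g := fun v ↦ v i * v j - if i = j then h else 0) (by fun_prop)
    simp only [PiLp.sub_apply] at this
    have h0 := hmean k hk
    simp only [D] at h0
    rw [h0, mul_zero] at this
    exact this

/-- The maximal inequality at level `2^{-n}` costs a factor `4 * 4^n` against a second moment of
order `8^{-n}`. The outcome `2^{-n}` is summable and Borel–Cantelli applies; this is why grids have
`8^n` cells. -/
lemma tendstoUniformlyOn_crossSum (hW : IsFilteredBrownian 𝓕 P T W) (i j : Fin m) :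
    ∀ᵐ ω ∂P, TendstoUniformlyOn
      (fun n t ↦ crossSum T n (fun r ↦ W r ω i) (fun r ↦ W r ω j) t)
      (fun t ↦ if i = j then (t : ℝ) else 0) atTop (Set.Iic T) := by
  obtain ⟨C, hC⟩ := hW.exists_integral_compensated_sq_le i j
  have hC0 : 0 ≤ C := by
    have h := hC 0
    have h' : 0 ≤ ∫ ω, compensated W T i j 0 T ω ^ 2 ∂P := integral_nonneg fun _ ↦ sq_nonneg _
    simpa using h'.trans h
  have hP : ∀ n : ℕ, P {ω | ∃ t ≤ T, ((1 : ℝ) / 2) ^ n ≤ |compensated W T i j n t ω|}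
      ≤ ENNReal.ofReal (4 * C) * ENNReal.ofReal ((1 / 2) ^ n) := by
    intro n
    have h1 := (hW.isL2Martingale_compensated i j n).maximal_ineq
      (hW.continuousOn_compensated i j n) (ε := (1 / 2) ^ n) (by positivity)
    have h2 := h1.trans (ENNReal.ofReal_le_ofReal (hC n))
    have hpos : (0 : ℝ) < ((1 / 2) ^ n) ^ 2 / 4 := by positivity
    rw [mul_comm, ← ENNReal.le_div_iff_mul_le (Or.inl (by simp))
      (Or.inl ENNReal.ofReal_ne_top), ← ENNReal.ofReal_div_of_pos hpos] at h2
    refine h2.trans ?_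
    rw [← ENNReal.ofReal_mul (by positivity)]
    refine ENNReal.ofReal_le_ofReal (le_of_eq ?_)
    have : (8 : ℝ) ^ n = 2 ^ n * 2 ^ n * 2 ^ n := by rw [← mul_pow, ← mul_pow]; norm_num
    rw [this, one_div, inv_pow]
    field_simp
  have hBC := ae_eventually_notMem (μ := P)
    (s := fun n ↦ {ω | ∃ t ≤ T, ((1 : ℝ) / 2) ^ n ≤ |compensated W T i j n t ω|})
    (by
      refine ne_top_of_le_ne_top ?_ (ENNReal.tsum_le_tsum hP)
      rw [ENNReal.tsum_mul_left]
      exact ENNReal.mul_ne_top ENNReal.ofReal_ne_top tsum_ofReal_half_pow_ne_top)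
  filter_upwards [hBC, hW.zero] with ω hω h0
  refine tendstoUniformlyOn_of_close (v := fun _ t ↦ if i = j then (t : ℝ) else 0) ?_ ?_
  · filter_upwards [hω] with n hn t ht
    simp only [not_exists, not_and, not_le] at hn
    have := hn t ht
    rwa [compensated_eq ht h0] at this
  · rw [Metric.tendstoUniformlyOn_iff]
    intro ε hε
    simp [hε]

/-! ### The product rule -/

lemma isItoIntegral_coord (hW : IsFilteredBrownian 𝓕 P T W) (i : Fin m) :
    IsItoIntegral 𝓕 P T W (fun _ _ ↦ EuclideanSpace.single i 1) (fun t ω ↦ W t ω i) := by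
  refine (SimpleProcess.single (𝓕 := 𝓕) 0 T zero_le (fun _ ↦ EuclideanSpace.single i 1)
    stronglyMeasurable_const ⟨1, by simp⟩).isItoIntegral.congr ?_ ?_
  · refine Eventually.of_forall fun ω ↦ ?_
    filter_upwards [ae_leb_mem_Ioc T] with s hs
    rw [SimpleProcess.single_eval, Set.indicator_of_mem hs]
  · filter_upwards [hW.zero] with ω h0 t ht
    rw [SimpleProcess.single_integral, min_eq_right ht, min_eq_left zero_le, h0, sub_zero,
      EuclideanSpace.inner_single_left]
    simp

/-- Summation by parts writes the two Riemann sums as `Wⁱ Wʲ` minus the cross sum, and the cross sum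
tends to the quadratic covariation. This is the base case of the product rule. -/
lemma isItoIntegral_mul (hW : IsFilteredBrownian 𝓕 P T W) (i j : Fin m) :
    IsItoIntegral 𝓕 P T W
      (fun s ω ↦ W s ω i • EuclideanSpace.single j (1 : ℝ) + W s ω j • EuclideanSpace.single i (1 : ℝ))
      (fun t ω ↦ W t ω i * W t ω j - if i = j then (t : ℝ) else 0) := by
  have had : ∀ i, ∀ t ≤ T, AEStronglyMeasurable[𝓕 t] (fun ω ↦ W t ω i) P := fun i t _ ↦
    ⟨_, hW.adapted_coord t i, EventuallyEq.rfl⟩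
  have hst := fun n ↦ ((hW.isItoIntegral_coord j).step hW.continuous hW.adapted (had i) n).add
    hW.continuous hW.adapted ((hW.isItoIntegral_coord i).step hW.continuous hW.adapted (had j) n)
  have hmem : ∀ i, MemLp (fun _ : ℝ≥0 ↦ (EuclideanSpace.single i (1 : ℝ) : Vec m)) 2 (leb T) :=
    fun i ↦ memLp_const _
  refine isItoIntegral_of_tendsto hW.continuous hW.adapted hst ?_ ?_ ?_
  · filter_upwards [hW.continuousOn_coord i, hW.continuousOn_coord j] with ω hi hj
    exact (memLp_smul_of_continuousOn hi (hmem j)).add (memLp_smul_of_continuousOn hj (hmem i))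
  · filter_upwards [hW.continuousOn_coord i, hW.continuousOn_coord j,
      ae_all_iff.2 fun n ↦ ((hW.isItoIntegral_coord i).step hW.continuous hW.adapted
        (had j) n).sq_integrable] with ω hi hj hm
    exact tendsto_lintegral_sq_add (tendsto_stepProc_smul hi (hmem j))
      (tendsto_stepProc_smul hj (hmem i))
      (fun n ↦ (hm n).1.sub (memLp_smul_of_continuousOn hj (hmem i)).1)
  · filter_upwards [hW.tendstoUniformlyOn_crossSum i j, hW.zero] with ω hω h0
    rw [Metric.tendstoUniformlyOn_iff] at hω ⊢
    intro ε hε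
    filter_upwards [hω ε hε] with n hn t ht
    have h1 := hn t ht
    have h := mul_sub_eq_riemannSum n (fun r ↦ W r ω i) (fun r ↦ W r ω j) ht
    simp only [h0, PiLp.zero_apply, mul_zero, sub_zero] at h
    rw [Real.dist_eq] at h1 ⊢
    rw [h, abs_sub_comm]
    convert h1 using 2
    ring

end IsFilteredBrownian

/-! ### The product rule -/

section Convergence

variable {α E : Type*} [MeasurableSpace α] {μ : Measure α} [NormedAddCommGroup E]
  [InnerProductSpace ℝ E]

lemma lintegral_enorm_mul_le {f g : α → E} (hf : AEStronglyMeasurable f μ)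
    (hg : AEStronglyMeasurable g μ) : ∫⁻ x, ‖f x‖ₑ * ‖g x‖ₑ ∂μ
      ≤ (∫⁻ x, ‖f x‖ₑ ^ 2 ∂μ) ^ (1 / 2 : ℝ) * (∫⁻ x, ‖g x‖ₑ ^ 2 ∂μ) ^ (1 / 2 : ℝ) := by
  have h := ENNReal.lintegral_mul_le_Lp_mul_Lq μ Real.HolderConjugate.two_two hf.enorm hg.enorm
  simpa using h

/-- The difference of inner products is bilinear in the errors, and each of its three parts is
bounded by Cauchy–Schwarz. -/
lemma tendsto_lintegral_inner {f g : ℕ → α → E} {f' g' : α → E}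
    (hf : Tendsto (fun n ↦ ∫⁻ x, ‖f n x - f' x‖ₑ ^ 2 ∂μ) atTop (𝓝 0))
    (hg : Tendsto (fun n ↦ ∫⁻ x, ‖g n x - g' x‖ₑ ^ 2 ∂μ) atTop (𝓝 0))
    (hfm : ∀ n, AEStronglyMeasurable (f n) μ) (hgm : ∀ n, AEStronglyMeasurable (g n) μ)
    (hf' : MemLp f' 2 μ) (hg' : MemLp g' 2 μ) :
    Tendsto (fun n ↦ ∫⁻ x, ‖inner ℝ (f n x) (g n x) - inner ℝ (f' x) (g' x)‖ₑ ∂μ)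
      atTop (𝓝 0) := by
  have hpow : ∀ {u : ℕ → ℝ≥0∞}, Tendsto u atTop (𝓝 0) →
      Tendsto (fun n ↦ u n ^ (1 / 2 : ℝ)) atTop (𝓝 0) := fun {u} hu ↦ by
    have := (ENNReal.continuous_rpow_const (y := (1 / 2 : ℝ))).tendsto 0
    rw [ENNReal.zero_rpow_of_pos (by norm_num)] at this
    exact this.comp hu
  have hfin : ∀ {h : α → E}, MemLp h 2 μ → (∫⁻ x, ‖h x‖ₑ ^ 2 ∂μ) ^ (1 / 2 : ℝ) ≠ ∞ := fun hh ↦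
    (ENNReal.rpow_lt_top_of_nonneg (by norm_num) hh.lintegral_enorm_sq_lt_top.ne).ne
  have hlim : Tendsto (fun n ↦
      (∫⁻ x, ‖f n x - f' x‖ₑ ^ 2 ∂μ) ^ (1 / 2 : ℝ) * (∫⁻ x, ‖g n x - g' x‖ₑ ^ 2 ∂μ) ^ (1 / 2 : ℝ)
      + (∫⁻ x, ‖f n x - f' x‖ₑ ^ 2 ∂μ) ^ (1 / 2 : ℝ) * (∫⁻ x, ‖g' x‖ₑ ^ 2 ∂μ) ^ (1 / 2 : ℝ)
      + (∫⁻ x, ‖f' x‖ₑ ^ 2 ∂μ) ^ (1 / 2 : ℝ) * (∫⁻ x, ‖g n x - g' x‖ₑ ^ 2 ∂μ) ^ (1 / 2 : ℝ))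
      atTop (𝓝 0) := by
    have h1 := ENNReal.Tendsto.mul (hpow hf) (Or.inr ENNReal.zero_ne_top) (hpow hg)
      (Or.inr ENNReal.zero_ne_top)
    have h2 := ENNReal.Tendsto.mul_const (b := (∫⁻ x, ‖g' x‖ₑ ^ 2 ∂μ) ^ (1 / 2 : ℝ)) (hpow hf)
      (Or.inr (hfin hg'))
    have h3 := ENNReal.Tendsto.const_mul (a := (∫⁻ x, ‖f' x‖ₑ ^ 2 ∂μ) ^ (1 / 2 : ℝ)) (hpow hg)
      (Or.inr (hfin hf'))
    simpa using (h1.add h2).add h3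
  refine tendsto_of_tendsto_of_tendsto_of_le_of_le tendsto_const_nhds hlim (fun _ ↦ zero_le) fun n ↦ ?_
  have hfs := (hfm n).sub hf'.1
  have hgs := (hgm n).sub hg'.1
  calc ∫⁻ x, ‖inner ℝ (f n x) (g n x) - inner ℝ (f' x) (g' x)‖ₑ ∂μ
      ≤ ∫⁻ x, (‖f n x - f' x‖ₑ * ‖g n x - g' x‖ₑ + ‖f n x - f' x‖ₑ * ‖g' x‖ₑ)
        + ‖f' x‖ₑ * ‖g n x - g' x‖ₑ ∂μ := by
        refine lintegral_mono fun x ↦ ?_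
        have e : inner ℝ (f n x) (g n x) - inner ℝ (f' x) (g' x)
            = (inner ℝ (f n x - f' x) (g n x - g' x) + inner ℝ (f n x - f' x) (g' x))
              + inner ℝ (f' x) (g n x - g' x) := by
          simp only [inner_sub_left, inner_sub_right]; ring
        have hi : ∀ u v : E, ‖inner ℝ u v‖ₑ ≤ ‖u‖ₑ * ‖v‖ₑ := fun u v ↦ by
          rw [← ofReal_norm, ← ofReal_norm, ← ofReal_norm, ← ENNReal.ofReal_mul (norm_nonneg _)]
          exact ENNReal.ofReal_le_ofReal (norm_inner_le_norm u v)
        rw [e]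
        exact (enorm_add_le _ _).trans (add_le_add ((enorm_add_le _ _).trans
          (add_le_add (hi _ _) (hi _ _))) (hi _ _))
    _ = ∫⁻ x, ‖f n x - f' x‖ₑ * ‖g n x - g' x‖ₑ ∂μ + ∫⁻ x, ‖f n x - f' x‖ₑ * ‖g' x‖ₑ ∂μ
        + ∫⁻ x, ‖f' x‖ₑ * ‖g n x - g' x‖ₑ ∂μ := by
        have m1 : AEMeasurable (fun x ↦ ‖f' x‖ₑ * ‖g n x - g' x‖ₑ) μ := hf'.1.enorm.mul hgs.enorm
        have m2 : AEMeasurable (fun x ↦ ‖f n x - f' x‖ₑ * ‖g' x‖ₑ) μ := hfs.enorm.mul hg'.1.enorm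
        rw [lintegral_add_right' _ m1, lintegral_add_right' _ m2]
    _ ≤ _ := add_le_add (add_le_add (lintegral_enorm_mul_le hfs hgs)
        (lintegral_enorm_mul_le hfs hg'.1)) (lintegral_enorm_mul_le hf'.1 hgs)

end Convergence

lemma integrable_leb_of_le {t : ℝ≥0} (ht : t ≤ T) {a : ℝ≥0 → ℝ} (ha : Integrable a (leb T)) :
    Integrable a (leb t) := by
  rw [← leb_restrict_Iic ht]; exact ha.integrableOn

lemma tendstoUniformlyOn_primitive {a : ℕ → ℝ≥0 → ℝ} {a' : ℝ≥0 → ℝ}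
    (ha : ∀ n, Integrable (a n) (leb T)) (ha' : Integrable a' (leb T))
    (h : Tendsto (fun n ↦ ∫⁻ s, ‖a n s - a' s‖ₑ ∂(leb T)) atTop (𝓝 0)) :
    TendstoUniformlyOn (fun n t ↦ ∫ s, a n s ∂(leb t)) (fun t ↦ ∫ s, a' s ∂(leb t)) atTop
      (Set.Iic T) := by
  rw [Metric.tendstoUniformlyOn_iff]
  intro ε hε
  filter_upwards [(tendsto_order.1 h).2 (ENNReal.ofReal ε) (by simpa using hε)] with n hn t ht
  rw [dist_comm, dist_eq_norm, ← integral_sub (integrable_leb_of_le ht (ha n))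
    (integrable_leb_of_le ht ha'), ← ENNReal.ofReal_lt_ofReal_iff hε, ofReal_norm]
  refine (enorm_integral_le_lintegral_enorm _).trans_lt (lt_of_le_of_lt ?_ hn)
  rw [← leb_restrict_Iic ht]
  exact lintegral_mono' Measure.restrict_le_self le_rfl

lemma tendstoUniformlyOn_mul {α : Type*} {s : Set α} {u v : ℕ → α → ℝ} {u' v' : α → ℝ}
    (hu : TendstoUniformlyOn u u' atTop s) (hv : TendstoUniformlyOn v v' atTop s)
    {R : ℝ} (hu' : ∀ x ∈ s, |u' x| ≤ R) (hv' : ∀ x ∈ s, |v' x| ≤ R) :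
    TendstoUniformlyOn (fun n x ↦ u n x * v n x) (fun x ↦ u' x * v' x) atTop s := by
  rw [Metric.tendstoUniformlyOn_iff] at *
  intro ε hε
  have hR : 0 < |R| + 1 := by positivity
  set δ := min 1 (ε / (2 * (|R| + 1))) with hδ
  have hδ0 : 0 < δ := by positivity
  filter_upwards [hu δ hδ0, hv δ hδ0] with n h1 h2 x hx
  have h1 := h1 x hx
  have h2 := h2 x hx
  have h3 := (hu' x hx).trans (le_abs_self R)
  have h4 := (hv' x hx).trans (le_abs_self R)
  rw [Real.dist_eq, abs_sub_comm] at h1 h2 ⊢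
  have e : u n x * v n x - u' x * v' x
      = (u n x - u' x) * ((v n x - v' x) + v' x) + u' x * (v n x - v' x) := by ring
  have hd1 : δ ≤ 1 := min_le_left _ _
  have hd2 : δ * (2 * (|R| + 1)) ≤ ε := by
    rw [← le_div_iff₀ (by positivity)]; exact min_le_right _ _
  calc |u n x * v n x - u' x * v' x|
      ≤ |u n x - u' x| * (|v n x - v' x| + |v' x|) + |u' x| * |v n x - v' x| := by
        rw [e]
        refine (abs_add_le _ _).trans ?_
        rw [abs_mul, abs_mul]
        gcongr
        exact abs_add_le _ _
    _ ≤ |u n x - u' x| * (1 + |R|) + |R| * |v n x - v' x| := by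
        gcongr; exact h2.le.trans hd1
    _ ≤ |u n x - u' x| * (1 + |R|) + |R| * δ := by gcongr
    _ < δ * (1 + |R|) + |R| * δ := by gcongr
    _ ≤ ε := by nlinarith

lemma integral_inner_start (l l' : ℝ≥0) (x y : ℝ) (i j : Fin m) (t : ℝ≥0) :
    ∫ s, inner ℝ ((Set.Ioi l).indicator (fun _ ↦ x) s • (EuclideanSpace.single i (1 : ℝ) : Vec m))
      ((Set.Ioi l').indicator (fun _ ↦ y) s • (EuclideanSpace.single j (1 : ℝ) : Vec m)) ∂(leb t)
      = x * y * if i = j then ((t - max l l' : ℝ≥0) : ℝ) else 0 := by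
  have e : ∀ s : ℝ≥0, inner ℝ ((Set.Ioi l).indicator (fun _ ↦ x) s •
      (EuclideanSpace.single i (1 : ℝ) : Vec m))
      ((Set.Ioi l').indicator (fun _ ↦ y) s • (EuclideanSpace.single j (1 : ℝ) : Vec m))
      = (Set.Ioi (max l l')).indicator (fun _ ↦ x * y * if i = j then 1 else 0) s := by
    intro s
    rw [real_inner_smul_left, real_inner_smul_right, EuclideanSpace.inner_single_left]
    simp only [PiLp.single_apply, map_one, one_mul, Set.indicator_apply, Set.mem_Ioi, max_lt_iff]
    by_cases h1 : l < s <;> by_cases h2 : l' < s <;> simp [h1, h2]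
  simp_rw [e]
  rw [integral_indicator measurableSet_Ioi, setIntegral_const, Measure.real, leb_Ioi]
  simp only [ENNReal.coe_toReal, smul_eq_mul]
  split_ifs <;> ring

namespace IsFilteredBrownian

/-- Before `l'` the second factor vanishes. After `l'` the product is a quadratic polynomial in
`Wⁱ`, `Wʲ` with coefficients known at `l'`, so it is assembled from three integrals started at `l'`:
those of `Wⁱ Wʲ`, `Wʲ` and `Wⁱ`. -/
lemma isItoIntegral_start_mul_start_of_le (hW : IsFilteredBrownian 𝓕 P T W)
    {l l' : ℝ≥0} (hll : l ≤ l') {ξ η : Ω → ℝ} (hξ : StronglyMeasurable[𝓕 l] ξ)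
    (hη : StronglyMeasurable[𝓕 l'] η) (i j : Fin m) :
    IsItoIntegral 𝓕 P T W
      (fun s ω ↦ (ξ ω * (W s ω i - W (min l s) ω i)) •
          ((Set.Ioi l').indicator (fun _ ↦ η ω) s • EuclideanSpace.single j (1 : ℝ))
        + (η ω * (W s ω j - W (min l' s) ω j)) •
          ((Set.Ioi l).indicator (fun _ ↦ ξ ω) s • EuclideanSpace.single i (1 : ℝ)))
      (fun t ω ↦ (ξ ω * (W t ω i - W (min l t) ω i)) * (η ω * (W t ω j - W (min l' t) ω j))
        - ξ ω * η ω * if i = j then ((t - max l l' : ℝ≥0) : ℝ) else 0) := by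
  have hξη : StronglyMeasurable[𝓕 l'] (fun ω ↦ ξ ω * η ω) := (hξ.mono (𝓕.mono hll)).mul hη
  have hWi : StronglyMeasurable[𝓕 l'] (fun ω ↦ W l ω i) := (hW.adapted_coord l i).mono (𝓕.mono hll)
  have h1 := (hW.isItoIntegral_mul i j).start hW.continuous hW.adapted (l := l')
    (η := fun ω ↦ ξ ω * η ω) ⟨_, hξη, EventuallyEq.rfl⟩
  have h2 := (hW.isItoIntegral_coord j).start hW.continuous hW.adapted (l := l')
    (η := fun ω ↦ -(ξ ω * η ω * W l ω i)) ⟨_, (hξη.mul hWi).neg, EventuallyEq.rfl⟩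
  have h3 := (hW.isItoIntegral_coord i).start hW.continuous hW.adapted (l := l')
    (η := fun ω ↦ -(ξ ω * η ω * W l' ω j))
    ⟨_, (hξη.mul (hW.adapted_coord l' j)).neg, EventuallyEq.rfl⟩
  refine ((h1.add hW.continuous hW.adapted h2).add hW.continuous hW.adapted h3).congr
    (Eventually.of_forall fun ω ↦ Eventually.of_forall fun s ↦ ?_)
    (Eventually.of_forall fun ω t _ ↦ ?_)
  · rcases le_or_gt s l' with h | h
    · have : s ∉ Set.Ioi l' := not_lt.2 h
      simp [this, h]
    · have h' : l < s := hll.trans_lt h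
      simp only [Set.indicator_apply, Set.mem_Ioi, h, h', if_true, min_eq_left h.le,
        min_eq_left h'.le]
      module
  · rw [max_eq_right hll]
    rcases le_or_gt t l' with h | h
    · simp [h, tsub_eq_zero_of_le h]
    · have h' : l < t := hll.trans_lt h
      simp only [min_eq_left h.le, min_eq_left h'.le, NNReal.coe_sub h.le]
      split_ifs <;> ring

lemma isItoIntegral_start_mul_start (hW : IsFilteredBrownian 𝓕 P T W)
    (l l' : ℝ≥0) {ξ η : Ω → ℝ} (hξ : StronglyMeasurable[𝓕 l] ξ)
    (hη : StronglyMeasurable[𝓕 l'] η) (i j : Fin m) :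
    IsItoIntegral 𝓕 P T W
      (fun s ω ↦ (ξ ω * (W s ω i - W (min l s) ω i)) •
          ((Set.Ioi l').indicator (fun _ ↦ η ω) s • EuclideanSpace.single j (1 : ℝ))
        + (η ω * (W s ω j - W (min l' s) ω j)) •
          ((Set.Ioi l).indicator (fun _ ↦ ξ ω) s • EuclideanSpace.single i (1 : ℝ)))
      (fun t ω ↦ (ξ ω * (W t ω i - W (min l t) ω i)) * (η ω * (W t ω j - W (min l' t) ω j))
        - ξ ω * η ω * if i = j then ((t - max l l' : ℝ≥0) : ℝ) else 0) := by
  rcases le_total l l' with h | h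
  · exact hW.isItoIntegral_start_mul_start_of_le h hξ hη i j
  · refine (hW.isItoIntegral_start_mul_start_of_le h hη hξ j i).congr
      (Eventually.of_forall fun ω ↦ Eventually.of_forall fun s ↦ add_comm _ _)
      (Eventually.of_forall fun ω t _ ↦ ?_)
    simp only [max_comm l' l, eq_comm (a := j) (b := i)]
    ring

end IsFilteredBrownian

lemma integrable_inner_of_memLp {α : Type*} [MeasurableSpace α] {μ : Measure α} {f g : α → Vec m}
    (hf : MemLp f 2 μ) (hg : MemLp g 2 μ) : Integrable (fun x ↦ inner ℝ (f x) (g x)) μ := by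
  refine Integrable.mono' (hf.norm.integrable_mul hg.norm) (hf.1.inner hg.1)
    (Eventually.of_forall fun x ↦ ?_)
  exact norm_inner_le_norm (𝕜 := ℝ) (f x) (g x)

/-- Both sides are bilinear, so the decomposition into started coordinate processes reduces the
claim to `isItoIntegral_start_mul_start`. -/
lemma SimpleProcess.isItoIntegral_mul (hW : IsFilteredBrownian 𝓕 P T W) (H K : SimpleProcess 𝓕 m) :
    IsItoIntegral 𝓕 P T W
      (fun s ω ↦ H.integral W s ω • K.eval s ω + K.integral W s ω • H.eval s ω)
      (fun t ω ↦ H.integral W t ω * K.integral W t ω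
        - ∫ s, inner ℝ (H.eval s ω) (K.eval s ω) ∂(leb t)) := by
  obtain ⟨ι, _, ξ, c, l, hξ, -, h1, h2⟩ := H.exists_decomp
  obtain ⟨κ, _, η, c', l', hη, -, h3, h4⟩ := K.exists_decomp
  refine (IsItoIntegral.sum hW.continuous hW.adapted (Finset.univ : Finset ι) fun a _ ↦
    IsItoIntegral.sum hW.continuous hW.adapted (Finset.univ : Finset κ) fun b _ ↦
      hW.isItoIntegral_start_mul_start (l a) (l' b) (hξ a) (hη b) (c a) (c' b)).congr
    (Eventually.of_forall fun ω ↦ Eventually.of_forall fun s ↦ ?_)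
    (Eventually.of_forall fun ω t _ ↦ ?_)
  · simp only [Finset.sum_add_distrib, h1, h2, h3, h4]
    congr 1
    · rw [Finset.sum_comm]
      simp only [Finset.sum_smul, Finset.smul_sum]
    · simp only [Finset.sum_smul, Finset.smul_sum]
  · simp only [Finset.sum_sub_distrib, h1, h2, h3, h4]
    congr 1
    · rw [Finset.sum_mul_sum]
    · simp only [sum_inner, inner_sum]
      have hm : ∀ (l : ℝ≥0) (x : ℝ) (i : Fin m), MemLp (fun s ↦ (Set.Ioi l).indicator
          (fun _ ↦ x) s • (EuclideanSpace.single i (1 : ℝ) : Vec m)) 2 (leb t) := fun l x i ↦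
        memLp_indicator_smul _ (memLp_const _)
      have hi := fun a b ↦ integrable_inner_of_memLp (hm (l a) (ξ a ω) (c a))
        (hm (l' b) (η b ω) (c' b))
      rw [integral_finsetSum _ fun b _ ↦ integrable_finsetSum _ fun a _ ↦ hi a b, Finset.sum_comm]
      refine Finset.sum_congr rfl fun b _ ↦ ?_
      rw [integral_finsetSum _ fun a _ ↦ hi a b]
      simp only [integral_inner_start]

/-- Integration by parts for Itô integrals. -/
theorem IsItoIntegral.mul (hW : IsFilteredBrownian 𝓕 P T W) (h : IsItoIntegral 𝓕 P T W H I)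
    (h' : IsItoIntegral 𝓕 P T W K J) :
    IsItoIntegral 𝓕 P T W (fun s ω ↦ I s ω • K s ω + J s ω • H s ω)
      (fun t ω ↦ I t ω * J t ω - ∫ s, inner ℝ (H s ω) (K s ω) ∂(leb t)) := by
  obtain ⟨Hn, h1, h2⟩ := h.exists_simple_tendsto
  obtain ⟨Kn, h3, h4⟩ := h'.exists_simple_tendsto
  refine isItoIntegral_of_tendsto hW.continuous hW.adapted
    (fun n ↦ (Hn n).isItoIntegral_mul hW (Kn n)) ?_ ?_ ?_
  · filter_upwards [h.sq_integrable, h'.sq_integrable, h.continuousOn hW.continuous,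
      h'.continuousOn hW.continuous] with ω hH hK hI hJ
    exact (memLp_smul_of_continuousOn hI hK).add (memLp_smul_of_continuousOn hJ hH)
  · filter_upwards [h.sq_integrable, h'.sq_integrable, h.continuousOn hW.continuous,
      h'.continuousOn hW.continuous, h1, h2, h3, h4, hW.continuous] with ω hH hK hI hJ h1 h2 h3 h4 hc
    obtain ⟨R, -, hR⟩ := exists_bound_of_continuousOn hI
    obtain ⟨R', -, hR'⟩ := exists_bound_of_continuousOn hJ
    refine tendsto_lintegral_sq_add
      (tendsto_lintegral_sq_smul (ae_leb_le T) h2 hR h3 hK)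
      (tendsto_lintegral_sq_smul (ae_leb_le T) h4 hR' h1 hH) fun n ↦ ?_
    exact (memLp_smul_of_continuousOn ((Kn n).continuousOn_integral hc)
      ((Hn n).memLp_eval T ω)).1.sub (memLp_smul_of_continuousOn hJ hH).1
  · filter_upwards [h.sq_integrable, h'.sq_integrable, h.continuousOn hW.continuous,
      h'.continuousOn hW.continuous, h1, h2, h3, h4] with ω hH hK hI hJ h1 h2 h3 h4
    obtain ⟨R, -, hR⟩ := exists_bound_of_continuousOn hI
    obtain ⟨R', -, hR'⟩ := exists_bound_of_continuousOn hJ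
    refine (tendstoUniformlyOn_mul h2 h4 (R := max R R') (fun x hx ↦ (hR x hx).trans
      (le_max_left _ _)) (fun x hx ↦ (hR' x hx).trans (le_max_right _ _))).sub
      (tendstoUniformlyOn_primitive
        (fun n ↦ integrable_inner_of_memLp ((Hn n).memLp_eval T ω) ((Kn n).memLp_eval T ω))
        (integrable_inner_of_memLp hH hK)
        (tendsto_lintegral_inner h1 h3 (fun n ↦ ((Hn n).memLp_eval T ω).1)
          (fun n ↦ ((Kn n).memLp_eval T ω).1) hH hK))

lemma crossSum_comm (n : ℕ) (X Y : ℝ≥0 → ℝ) (t : ℝ≥0) :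
    crossSum T n X Y t = crossSum T n Y X t := by
  simp only [crossSum, mul_comm]

/-- Integration by parts of an Itô integral against a process with absolutely continuous paths. -/
theorem IsItoIntegral.mul_primitive (hW : IsFilteredBrownian 𝓕 P T W)
    (h : IsItoIntegral 𝓕 P T W H I) {B a : ℝ≥0 → Ω → ℝ}
    (hB : ∀ t ≤ T, AEStronglyMeasurable[𝓕 t] (B t) P)
    (ha : ∀ᵐ ω ∂P, Integrable (fun s ↦ a s ω) (leb T))
    (hBa : ∀ᵐ ω ∂P, ∀ t ≤ T, B t ω = B 0 ω + ∫ s, a s ω ∂(leb t)) :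
    IsItoIntegral 𝓕 P T W (fun s ω ↦ B s ω • H s ω)
      (fun t ω ↦ B t ω * I t ω - ∫ s, I s ω * a s ω ∂(leb t)) := by
  have hBc : ∀ᵐ ω ∂P, ContinuousOn (fun t ↦ B t ω) (Set.Iic T) := by
    filter_upwards [ha, hBa] with ω ha hBa
    exact (continuousOn_const.add (continuousOn_primitive ha)).congr fun t ht ↦ hBa t ht
  refine isItoIntegral_of_tendsto hW.continuous hW.adapted
    (fun n ↦ h.step hW.continuous hW.adapted hB n) ?_ ?_ ?_
  · filter_upwards [h.sq_integrable, hBc] with ω hH hB using memLp_smul_of_continuousOn hB hH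
  · filter_upwards [h.sq_integrable, hBc] with ω hH hB using tendsto_stepProc_smul hB hH
  · filter_upwards [hBc, h.continuousOn hW.continuous, ha, hBa, h.zero_ae] with ω hB hI ha hBa h0
    have h1 := tendstoUniformlyOn_crossSum_zero hI ha hBa
    have h2 := tendstoUniformlyOn_riemannSum hI ha hBa
    have h3 : TendstoUniformlyOn (fun (_ : ℕ) t ↦ B t ω * I t ω) (fun t ↦ B t ω * I t ω) atTop
        (Set.Iic T) := by
      rw [Metric.tendstoUniformlyOn_iff]
      intro ε hε
      simp [hε]
    refine ((h3.sub h2).sub h1).congr_right (g := fun t ↦ B t ω * I t ω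
      - ∫ s, I s ω * a s ω ∂(leb t)) (fun t _ ↦ by simp) |>.congr ?_
    refine Eventually.of_forall fun n t ht ↦ ?_
    -- The Riemann sum of `B` against `I` is traded for that of `I` against `B` and a cross sum,
    -- whose limits are known because `B` is absolutely continuous.
    have h4 := mul_sub_eq_riemannSum n (fun r ↦ B r ω) (fun r ↦ I r ω) ht
    simp only [h0, mul_zero, sub_zero] at h4
    simp only [Pi.sub_apply]
    rw [h4, crossSum_comm]
    ring

/-! ### Itô processes -/

/-- `X_t = X_0 + ∫₀ᵗ H dW + ∫₀ᵗ a ds` for `t ∈ [0, T]`. -/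
structure IsItoProcess (𝓕 : Filtration ℝ≥0 mΩ) (P : Measure Ω) (T : ℝ≥0) (W : ℝ≥0 → Ω → Vec m)
    (X : ℝ≥0 → Ω → ℝ) (H : ℝ≥0 → Ω → Vec m) (a : ℝ≥0 → Ω → ℝ) : Prop where
  adapted : ∀ t ≤ T, AEStronglyMeasurable[𝓕 t] (X t) P
  drift_integrable : ∀ᵐ ω ∂P, Integrable (fun s ↦ a s ω) (leb T)
  isItoIntegral : IsItoIntegral 𝓕 P T W H (fun t ω ↦ X t ω - X 0 ω - ∫ s, a s ω ∂(leb t))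

variable {X Y a b : ℝ≥0 → Ω → ℝ}

lemma leb_zero : leb 0 = 0 := by
  rw [← Measure.measure_univ_eq_zero, leb_univ]; rfl

lemma integrable_mul_of_continuousOn {u g : ℝ≥0 → ℝ} (hu : ContinuousOn u (Set.Iic T))
    (hg : Integrable g (leb T)) : Integrable (fun s ↦ u s * g s) (leb T) := by
  obtain ⟨R, -, hR⟩ := exists_bound_of_continuousOn hu
  refine hg.bdd_mul (c := R) (aestronglyMeasurable_of_continuousOn hu) ?_
  filter_upwards [ae_leb_le T] with s hs using hR s hs

lemma IsItoProcess.continuousOn (hW : IsFilteredBrownian 𝓕 P T W)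
    (hX : IsItoProcess 𝓕 P T W X H a) :
    ∀ᵐ ω ∂P, ContinuousOn (fun t ↦ X t ω) (Set.Iic T) := by
  filter_upwards [hX.isItoIntegral.continuousOn hW.continuous, hX.drift_integrable] with ω h ha
  exact ((h.add (continuousOn_primitive ha)).add (continuousOn_const (c := X 0 ω))).congr
    fun t ht ↦ by simp

/-- The structure asks no joint measurability of the drift `a`; the drift part is adapted because it
is `X` minus its Itô integral. -/
lemma IsItoProcess.adapted_drift (hW : IsFilteredBrownian 𝓕 P T W)
    (hX : IsItoProcess 𝓕 P T W X H a) {t : ℝ≥0} (ht : t ≤ T) :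
    AEStronglyMeasurable[𝓕 t] (fun ω ↦ X 0 ω + ∫ s, a s ω ∂(leb t)) P := by
  obtain ⟨f, hf, hf'⟩ := hX.adapted t ht
  obtain ⟨g, hg, hg'⟩ := hX.isItoIntegral.aestronglyMeasurable hW.adapted ht
  refine ⟨fun ω ↦ f ω - g ω, hf.sub hg, ?_⟩
  filter_upwards [hf', hg'] with ω h1 h2
  rw [← h1, ← h2]; ring

/-- This is the limit of summation by parts, the cross sums vanishing since both paths are
absolutely continuous. -/
lemma mul_primitive_eq {U V a b : ℝ≥0 → ℝ} (ha : Integrable a (leb T)) (hb : Integrable b (leb T))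
    (hU : ∀ t ≤ T, U t = U 0 + ∫ s, a s ∂(leb t)) (hV : ∀ t ≤ T, V t = V 0 + ∫ s, b s ∂(leb t))
    {t : ℝ≥0} (ht : t ≤ T) :
    U t * V t - U 0 * V 0 = ∫ s, U s * b s ∂(leb t) + ∫ s, V s * a s ∂(leb t) := by
  have hUc : ContinuousOn U (Set.Iic T) :=
    (continuousOn_const.add (continuousOn_primitive ha)).congr hU
  have hVc : ContinuousOn V (Set.Iic T) :=
    (continuousOn_const.add (continuousOn_primitive hb)).congr hV
  have h := (((tendstoUniformlyOn_riemannSum hUc hb hV).tendsto_at (Set.mem_Iic.2 ht)).add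
    ((tendstoUniformlyOn_riemannSum hVc ha hU).tendsto_at (Set.mem_Iic.2 ht))).add
    ((tendstoUniformlyOn_crossSum_zero hUc hb hV).tendsto_at (Set.mem_Iic.2 ht))
  rw [add_zero] at h
  refine tendsto_nhds_unique (tendsto_const_nhds.congr fun n ↦ ?_) h
  exact mul_sub_eq_riemannSum n U V ht

/-- The product rule for Itô processes. -/
theorem IsItoProcess.mul (hW : IsFilteredBrownian 𝓕 P T W) (hX : IsItoProcess 𝓕 P T W X H a)
    (hY : IsItoProcess 𝓕 P T W Y K b) :
    IsItoProcess 𝓕 P T W (fun t ω ↦ X t ω * Y t ω) (fun s ω ↦ X s ω • K s ω + Y s ω • H s ω)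
      (fun s ω ↦ X s ω * b s ω + Y s ω * a s ω + inner ℝ (H s ω) (K s ω)) := by
  have hI := hX.isItoIntegral
  have hJ := hY.isItoIntegral
  refine ⟨fun t ht ↦ ?_, ?_, ?_⟩
  · obtain ⟨f, hf, hf'⟩ := hX.adapted t ht
    obtain ⟨g, hg, hg'⟩ := hY.adapted t ht
    exact ⟨fun ω ↦ f ω * g ω, hf.mul hg, hf'.mul hg'⟩
  · filter_upwards [hX.continuousOn hW, hY.continuousOn hW, hX.drift_integrable,
      hY.drift_integrable, hI.sq_integrable, hJ.sq_integrable] with ω hXc hYc ha hb hH hK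
    exact ((integrable_mul_of_continuousOn hXc hb).add (integrable_mul_of_continuousOn hYc ha)).add
      (integrable_inner_of_memLp hH hK)
  · have h1 := hI.mul hW hJ
    have h2 := hJ.mul_primitive hW (B := fun t ω ↦ X 0 ω + ∫ s, a s ω ∂(leb t)) (a := a)
      (fun t ht ↦ hX.adapted_drift hW ht) hX.drift_integrable
      (Eventually.of_forall fun ω t _ ↦ by simp [leb_zero])
    have h3 := hI.mul_primitive hW (B := fun t ω ↦ Y 0 ω + ∫ s, b s ω ∂(leb t)) (a := b)
      (fun t ht ↦ hY.adapted_drift hW ht) hY.drift_integrable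
      (Eventually.of_forall fun ω t _ ↦ by simp [leb_zero])
    refine ((h1.add hW.continuous hW.adapted h2).add hW.continuous hW.adapted h3).congr
      (Eventually.of_forall fun ω ↦ Eventually.of_forall fun s ↦ ?_) ?_
    · module
    · filter_upwards [hX.continuousOn hW, hY.continuousOn hW, hX.drift_integrable,
        hY.drift_integrable, hI.sq_integrable, hJ.sq_integrable] with ω hXc hYc ha hb hH hK t ht
      set U : ℝ≥0 → ℝ := fun t ↦ X 0 ω + ∫ s, a s ω ∂(leb t) with hU
      set V : ℝ≥0 → ℝ := fun t ↦ Y 0 ω + ∫ s, b s ω ∂(leb t) with hV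
      have hU0 : U 0 = X 0 ω := by simp [hU, leb_zero]
      have hV0 : V 0 = Y 0 ω := by simp [hV, leb_zero]
      have hUc : ContinuousOn U (Set.Iic T) := continuousOn_const.add (continuousOn_primitive ha)
      have hVc : ContinuousOn V (Set.Iic T) := continuousOn_const.add (continuousOn_primitive hb)
      have h4 := mul_primitive_eq (U := U) (V := V) ha hb (fun t _ ↦ by rw [hU0])
        (fun t _ ↦ by rw [hV0]) ht
      have e1 : ∀ s, X s ω * b s ω = U s * b s ω
          + (X s ω - X 0 ω - ∫ s, a s ω ∂(leb s)) * b s ω := fun s ↦ by simp only [hU]; ring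
      have e2 : ∀ s, Y s ω * a s ω = V s * a s ω
          + (Y s ω - Y 0 ω - ∫ s, b s ω ∂(leb s)) * a s ω := fun s ↦ by simp only [hV]; ring
      have hIc : ContinuousOn (fun s ↦ X s ω - X 0 ω - ∫ s, a s ω ∂(leb s)) (Set.Iic T) :=
        (hXc.sub continuousOn_const).sub (continuousOn_primitive ha)
      have hJc : ContinuousOn (fun s ↦ Y s ω - Y 0 ω - ∫ s, b s ω ∂(leb s)) (Set.Iic T) :=
        (hYc.sub continuousOn_const).sub (continuousOn_primitive hb)
      have i1 := integrable_leb_of_le ht (integrable_mul_of_continuousOn hXc hb)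
      have i2 := integrable_leb_of_le ht (integrable_mul_of_continuousOn hYc ha)
      have i3 := integrable_leb_of_le ht (integrable_inner_of_memLp hH hK)
      have i12 : Integrable (fun s ↦ X s ω * b s ω + Y s ω * a s ω) (leb t) := i1.add i2
      have s1 : ∫ s, X s ω * b s ω ∂(leb t) = ∫ s, U s * b s ω ∂(leb t)
          + ∫ s, (X s ω - X 0 ω - ∫ s, a s ω ∂(leb s)) * b s ω ∂(leb t) := by
        simp_rw [e1]
        exact integral_add (integrable_leb_of_le ht (integrable_mul_of_continuousOn hUc hb))
          (integrable_leb_of_le ht (integrable_mul_of_continuousOn hIc hb))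
      have s2 : ∫ s, Y s ω * a s ω ∂(leb t) = ∫ s, V s * a s ω ∂(leb t)
          + ∫ s, (Y s ω - Y 0 ω - ∫ s, b s ω ∂(leb s)) * a s ω ∂(leb t) := by
        simp_rw [e2]
        exact integral_add (integrable_leb_of_le ht (integrable_mul_of_continuousOn hVc ha))
          (integrable_leb_of_le ht (integrable_mul_of_continuousOn hJc ha))
      rw [integral_add i12 i3, integral_add i1 i2, s1, s2]
      rw [hU0, hV0] at h4
      have hUt : ∫ s, a s ω ∂(leb t) = U t - X 0 ω := by simp [hU]
      have hVt : ∫ s, b s ω ∂(leb t) = V t - Y 0 ω := by simp [hV]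
      simp only [hUt, hVt] at *
      linear_combination -h4

lemma isItoProcess_const (c : ℝ) :
    IsItoProcess 𝓕 P T W (fun _ _ ↦ c) (fun _ _ ↦ 0) (fun _ _ ↦ 0) :=
  ⟨fun _ _ ↦ ⟨_, stronglyMeasurable_const, EventuallyEq.rfl⟩,
    Eventually.of_forall fun _ ↦ integrable_zero _ _ _,
    isItoIntegral_zero.congr (Eventually.of_forall fun _ ↦ Eventually.of_forall fun _ ↦ rfl)
      (Eventually.of_forall fun _ _ _ ↦ by simp)⟩

lemma IsItoProcess.add (hW : IsFilteredBrownian 𝓕 P T W) (hX : IsItoProcess 𝓕 P T W X H a)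
    (hY : IsItoProcess 𝓕 P T W Y K b) :
    IsItoProcess 𝓕 P T W (fun t ω ↦ X t ω + Y t ω) (fun s ω ↦ H s ω + K s ω)
      (fun s ω ↦ a s ω + b s ω) := by
  refine ⟨fun t ht ↦ ?_, ?_, ?_⟩
  · obtain ⟨f, hf, hf'⟩ := hX.adapted t ht
    obtain ⟨g, hg, hg'⟩ := hY.adapted t ht
    exact ⟨fun ω ↦ f ω + g ω, hf.add hg, hf'.add hg'⟩
  · filter_upwards [hX.drift_integrable, hY.drift_integrable] with ω ha hb using ha.add hb
  · refine (hX.isItoIntegral.add hW.continuous hW.adapted hY.isItoIntegral).congr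
      (Eventually.of_forall fun _ ↦ Eventually.of_forall fun _ ↦ rfl) ?_
    filter_upwards [hX.drift_integrable, hY.drift_integrable] with ω ha hb t ht
    rw [integral_add (integrable_leb_of_le ht ha) (integrable_leb_of_le ht hb)]
    ring

lemma IsItoProcess.congr (hX : IsItoProcess 𝓕 P T W X H a)
    (h1 : ∀ t ω, X t ω = Y t ω) (h2 : ∀ t ω, H t ω = K t ω) (h3 : ∀ t ω, a t ω = b t ω) :
    IsItoProcess 𝓕 P T W Y K b := by
  obtain rfl : X = Y := funext₂ h1
  obtain rfl : H = K := funext₂ h2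
  obtain rfl : a = b := funext₂ h3
  exact hX

/-! ### Itô's formula -/

/-- Itô's formula for polynomials. -/
theorem IsItoProcess.polynomial (hW : IsFilteredBrownian 𝓕 P T W)
    (hX : IsItoProcess 𝓕 P T W X H a) (p : Polynomial ℝ) :
    IsItoProcess 𝓕 P T W (fun t ω ↦ p.eval (X t ω)) (fun s ω ↦ p.derivative.eval (X s ω) • H s ω)
      (fun s ω ↦ p.derivative.eval (X s ω) * a s ω
        + p.derivative.derivative.eval (X s ω) * (1 / 2 * ‖H s ω‖ ^ 2)) := by
  induction p using Polynomial.induction_on with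
  | C c => simpa using isItoProcess_const c
  | add p q hp hq =>
    refine (hp.add hW hq).congr (fun t ω ↦ ?_) (fun t ω ↦ ?_) fun t ω ↦ ?_
    · simp
    · simp [add_smul]
    · simp; ring
  | monomial n c ih =>
    have hp : Polynomial.C c * Polynomial.X ^ (n + 1)
        = Polynomial.C c * Polynomial.X ^ n * Polynomial.X := by rw [pow_succ, mul_assoc]
    -- The degree is raised by one through the product rule with `X` itself; the second derivative
    -- picks up the covariation term.
    refine (ih.mul hW hX).congr (fun t ω ↦ ?_) (fun t ω ↦ ?_) fun t ω ↦ ?_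
    · simp [pow_succ, mul_assoc]
    · rw [hp, smul_smul, ← add_smul]
      generalize Polynomial.C c * Polynomial.X ^ n = q
      congr 1
      simp only [Polynomial.derivative_mul, Polynomial.derivative_X, mul_one,
        Polynomial.eval_add, Polynomial.eval_mul, Polynomial.eval_X]
      ring
    · rw [hp]
      generalize Polynomial.C c * Polynomial.X ^ n = q
      simp only [Polynomial.derivative_mul, Polynomial.derivative_X, mul_one,
        Polynomial.derivative_add, Polynomial.eval_add, Polynomial.eval_mul, Polynomial.eval_X,
        real_inner_smul_left, real_inner_self_eq_norm_sq]
      ring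

/-- After the initial values and the primitives of the drifts are subtracted, which converge
uniformly, this is the closedness of the Itô integral. -/
lemma IsItoProcess.of_tendsto (hW : IsFilteredBrownian 𝓕 P T W) {Xn : ℕ → ℝ≥0 → Ω → ℝ}
    {Hn : ℕ → ℝ≥0 → Ω → Vec m} {an : ℕ → ℝ≥0 → Ω → ℝ}
    (h : ∀ n, IsItoProcess 𝓕 P T W (Xn n) (Hn n) (an n))
    (hH : ∀ᵐ ω ∂P, MemLp (fun s ↦ H s ω) 2 (leb T))
    (ha : ∀ᵐ ω ∂P, Integrable (fun s ↦ a s ω) (leb T))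
    (h1 : ∀ᵐ ω ∂P, TendstoUniformlyOn (fun n t ↦ Xn n t ω) (fun t ↦ X t ω) atTop (Set.Iic T))
    (h2 : ∀ᵐ ω ∂P, Tendsto (fun n ↦ ∫⁻ s, ‖Hn n s ω - H s ω‖ₑ ^ 2 ∂(leb T)) atTop (𝓝 0))
    (h3 : ∀ᵐ ω ∂P, Tendsto (fun n ↦ ∫⁻ s, ‖an n s ω - a s ω‖ₑ ∂(leb T)) atTop (𝓝 0)) :
    IsItoProcess 𝓕 P T W X H a := by
  refine ⟨fun t ht ↦ aestronglyMeasurable_of_ae_tendsto (fun n ↦ (h n).adapted t ht) ?_, ha, ?_⟩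
  · filter_upwards [h1] with ω h1 using h1.tendsto_at ht
  · refine isItoIntegral_of_tendsto hW.continuous hW.adapted (fun n ↦ (h n).isItoIntegral) hH h2 ?_
    filter_upwards [h1, h3, ha, ae_all_iff.2 fun n ↦ (h n).drift_integrable] with ω h1 h3 ha han
    have h0 : TendstoUniformlyOn (fun n (_ : ℝ≥0) ↦ Xn n 0 ω) (fun _ ↦ X 0 ω) atTop (Set.Iic T) := by
      rw [Metric.tendstoUniformlyOn_iff] at h1 ⊢
      intro ε hε
      filter_upwards [h1 ε hε] with n hn x _ using hn 0 (Set.mem_Iic.2 zero_le)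
    exact (h1.sub h0).sub (tendstoUniformlyOn_primitive han ha h3)

/-- The Taylor polynomial `∑ k < n, Xᵏ / k!` of the exponential function. -/
def expPoly (n : ℕ) : Polynomial ℝ :=
  ∑ k ∈ Finset.range n, Polynomial.C ((k.factorial : ℝ)⁻¹) * Polynomial.X ^ k

lemma derivative_expPoly (n : ℕ) : (expPoly (n + 1)).derivative = expPoly n := by
  unfold expPoly
  rw [Finset.sum_range_succ', Polynomial.derivative_add, Polynomial.derivative_sum]
  simp only [pow_zero, mul_one, Polynomial.derivative_C, add_zero]
  refine Finset.sum_congr rfl fun k _ ↦ ?_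
  rw [Polynomial.derivative_C_mul_X_pow, Nat.add_sub_cancel]
  congr 2
  rw [Nat.factorial_succ]
  push_cast
  field_simp

lemma tendstoUniformlyOn_expPoly (R : ℝ) :
    TendstoUniformlyOn (fun n x ↦ (expPoly n).eval x) Real.exp atTop {x | |x| ≤ R} := by
  have h := tendstoUniformlyOn_tsum_nat (f := fun n (x : ℝ) ↦ x ^ n / n.factorial)
    (u := fun n ↦ R ^ n / n.factorial) (s := {x | |x| ≤ R}) (Real.summable_pow_div_factorial R) ?_
  · refine (h.congr (Eventually.of_forall fun n x _ ↦ ?_)).congr_right fun x _ ↦ ?_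
    · simp only [expPoly, Polynomial.eval_finsetSum]
      refine Finset.sum_congr rfl fun k _ ↦ ?_
      simp
      ring
    · simp only
      rw [Real.exp_eq_exp_ℝ, NormedSpace.exp_eq_tsum_div]
  · intro n x hx
    rw [norm_div, norm_pow, Real.norm_eq_abs, Real.norm_natCast]
    have : |x| ≤ R := hx
    gcongr

lemma tendsto_lintegral_mul_of_tendstoUniformlyOn {α : Type*} [MeasurableSpace α] {μ : Measure α}
    {s : Set α} (hs : ∀ᵐ x ∂μ, x ∈ s) {u : ℕ → α → ℝ} {u' g : α → ℝ}
    (hu : TendstoUniformlyOn u u' atTop s) (hg : Integrable g μ) :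
    Tendsto (fun n ↦ ∫⁻ x, ‖u n x * g x - u' x * g x‖ₑ ∂μ) atTop (𝓝 0) := by
  rw [ENNReal.tendsto_nhds_zero]
  intro ε hε
  rcases eq_or_ne ε ∞ with rfl | hε'
  · simp
  set G := ∫⁻ x, ‖g x‖ₑ ∂μ
  have hG : G < ∞ := hg.2
  set δ : ℝ := ε.toReal / (G.toReal + 1) with hδ
  have hδ0 : 0 < δ := div_pos (ENNReal.toReal_pos hε.ne' hε') (by positivity)
  filter_upwards [Metric.tendstoUniformlyOn_iff.1 hu δ hδ0] with n hn
  calc ∫⁻ x, ‖u n x * g x - u' x * g x‖ₑ ∂μ ≤ ∫⁻ x, ENNReal.ofReal δ * ‖g x‖ₑ ∂μ := by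
        refine lintegral_mono_ae ?_
        filter_upwards [hs] with x hx
        rw [← sub_mul, enorm_mul, ← ofReal_norm (u n x - u' x)]
        gcongr
        have := hn x hx
        rw [dist_comm, dist_eq_norm] at this
        exact this.le
    _ = ENNReal.ofReal δ * G := lintegral_const_mul'' _ hg.1.enorm
    _ ≤ ε := by
        rw [← ENNReal.ofReal_toReal hG.ne, ← ENNReal.ofReal_mul hδ0.le,
          ENNReal.ofReal_le_iff_le_toReal hε', hδ, div_mul_eq_mul_div, div_le_iff₀ (by positivity)]
        exact mul_le_mul_of_nonneg_left (by linarith) ENNReal.toReal_nonneg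

lemma integrable_norm_sq_of_memLp {f : ℝ≥0 → Vec m} (hf : MemLp f 2 (leb T)) :
    Integrable (fun s ↦ 1 / 2 * ‖f s‖ ^ 2) (leb T) := by
  have := (integrable_inner_of_memLp hf hf).const_mul (1 / 2)
  simpa only [real_inner_self_eq_norm_sq] using this

/-- Itô's formula for the exponential function. -/
theorem IsItoProcess.exp (hW : IsFilteredBrownian 𝓕 P T W) (hX : IsItoProcess 𝓕 P T W X H a) :
    IsItoProcess 𝓕 P T W (fun t ω ↦ Real.exp (X t ω)) (fun s ω ↦ Real.exp (X s ω) • H s ω)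
      (fun s ω ↦ Real.exp (X s ω) * a s ω + Real.exp (X s ω) * (1 / 2 * ‖H s ω‖ ^ 2)) := by
  have key : ∀ᵐ ω ∂P, ∀ k : ℕ, TendstoUniformlyOn (fun n t ↦ (expPoly (n + k)).eval (X t ω))
      (fun t ↦ Real.exp (X t ω)) atTop (Set.Iic T) := by
    filter_upwards [hX.continuousOn hW] with ω hc k
    obtain ⟨R, -, hR⟩ := exists_bound_of_continuousOn hc
    have h := Metric.tendstoUniformlyOn_iff.1 (tendstoUniformlyOn_expPoly R)
    rw [Metric.tendstoUniformlyOn_iff]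
    intro ε hε
    filter_upwards [(tendsto_add_atTop_nat k).eventually (h ε hε)] with n hn t ht
    exact hn _ (hR t ht)
  have hexp : ∀ᵐ ω ∂P, ContinuousOn (fun t ↦ Real.exp (X t ω)) (Set.Iic T) := by
    filter_upwards [hX.continuousOn hW] with ω hc using Real.continuous_exp.comp_continuousOn hc
  -- The shift by 2 turns the first and second derivatives into `expPoly (n + 1)` and `expPoly n`.
  have h := fun n ↦ hX.polynomial hW (expPoly (n + 2))
  simp only [derivative_expPoly] at h
  refine IsItoProcess.of_tendsto hW h ?_ ?_ ?_ ?_ ?_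
  · filter_upwards [hexp, hX.isItoIntegral.sq_integrable] with ω hc hH
    exact memLp_smul_of_continuousOn hc hH
  · filter_upwards [hexp, hX.isItoIntegral.sq_integrable, hX.drift_integrable] with ω hc hH ha
    exact (integrable_mul_of_continuousOn hc ha).add
      (integrable_mul_of_continuousOn hc (integrable_norm_sq_of_memLp hH))
  · filter_upwards [key] with ω hk using hk 2
  · filter_upwards [key, hexp, hX.isItoIntegral.sq_integrable] with ω hk hc hH
    obtain ⟨R, -, hR⟩ := exists_bound_of_continuousOn hc
    exact tendsto_lintegral_sq_smul (ae_leb_le T) (hk 1) hR (f := fun _ s ↦ H s ω) (by simp) hH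
  · filter_upwards [key, hexp, hX.isItoIntegral.sq_integrable, hX.drift_integrable,
      hX.continuousOn hW] with ω hk hc hH ha hXc
    have h1 := tendsto_lintegral_mul_of_tendstoUniformlyOn (ae_leb_le T) (hk 1) ha
    have h2 := tendsto_lintegral_mul_of_tendstoUniformlyOn (ae_leb_le T) (hk 0)
      (integrable_norm_sq_of_memLp hH)
    have h3 := h1.add h2
    rw [add_zero] at h3
    refine tendsto_of_tendsto_of_tendsto_of_le_of_le tendsto_const_nhds h3 (fun _ ↦ zero_le)
      fun n ↦ ?_
    have hp : ContinuousOn (fun s ↦ (expPoly (n + 1)).eval (X s ω)) (Set.Iic T) :=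
      (expPoly (n + 1)).continuous.comp_continuousOn hXc
    have hm := ((integrable_mul_of_continuousOn hp ha).sub
      (integrable_mul_of_continuousOn hc ha)).1.enorm
    simp only [Pi.sub_apply] at hm ⊢
    rw [← lintegral_add_left' hm]
    refine lintegral_mono fun s ↦ ?_
    rw [add_sub_add_comm]
    exact enorm_add_le _ _

/-! ### Approximation of predictable processes by simple processes -/

lemma predictable_le_prod : 𝓕.predictable ≤ (inferInstance : MeasurableSpace (ℝ≥0 × Ω)) :=
  measurableSpace_le_predictable_of_measurableSet
    (fun A hA ↦ (measurableSet_singleton _).prod (𝓕.le _ A hA))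
    (fun i A hA ↦ measurableSet_Ioi.prod (𝓕.le i A hA))

/-- `f` is a limit of simple processes in `L²(λ ⊗ P)`. -/
def IsSimpleLimit (𝓕 : Filtration ℝ≥0 mΩ) (P : Measure Ω) (T : ℝ≥0) (f : ℝ≥0 × Ω → Vec m) : Prop :=
  ∀ ε : ℝ≥0∞, ε ≠ 0 → ∃ S : SimpleProcess 𝓕 m,
    eLpNorm (fun z ↦ S.eval z.1 z.2 - f z) 2 ((leb T).prod P) ≤ ε

lemma SimpleProcess.aestronglyMeasurable_eval (S : SimpleProcess 𝓕 m) {μ : Measure (ℝ≥0 × Ω)} :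
    AEStronglyMeasurable (fun z : ℝ≥0 × Ω ↦ S.eval z.1 z.2) μ :=
  S.measurable_eval.aestronglyMeasurable

lemma SimpleProcess.memLp_eval_prod (S : SimpleProcess 𝓕 m) :
    MemLp (fun z : ℝ≥0 × Ω ↦ S.eval z.1 z.2) 2 ((leb T).prod P) := by
  obtain ⟨c, -, hc⟩ := S.exists_bound
  exact MemLp.of_bound S.aestronglyMeasurable_eval c (Eventually.of_forall fun z ↦ hc z.1 z.2)

namespace IsSimpleLimit

variable {f g : ℝ≥0 × Ω → Vec m}

lemma of_eval (S : SimpleProcess 𝓕 m) (h : ∀ᵐ z ∂((leb T).prod P), S.eval z.1 z.2 = f z) :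
    IsSimpleLimit 𝓕 P T f := by
  intro ε _
  refine ⟨S, ?_⟩
  have : (fun z ↦ S.eval z.1 z.2 - f z) =ᵐ[(leb T).prod P] fun _ ↦ 0 := by
    filter_upwards [h] with z hz
    rw [hz, sub_self]
  rw [eLpNorm_congr_ae this]
  simp

/-- The class is closed under `L²` limits. -/
lemma of_forall_le (hfm : AEStronglyMeasurable f ((leb T).prod P))
    (h : ∀ ε : ℝ≥0∞, ε ≠ 0 → ∃ g, AEStronglyMeasurable g ((leb T).prod P) ∧ IsSimpleLimit 𝓕 P T g ∧
      eLpNorm (fun z ↦ g z - f z) 2 ((leb T).prod P) ≤ ε) : IsSimpleLimit 𝓕 P T f := by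
  intro ε hε
  obtain ⟨g, hgm, hg, hgf⟩ := h (ε / 2) (by simpa using hε)
  obtain ⟨S, hS⟩ := hg (ε / 2) (by simpa using hε)
  refine ⟨S, ?_⟩
  have e : (fun z : ℝ≥0 × Ω ↦ S.eval z.1 z.2 - f z)
      = (fun z ↦ S.eval z.1 z.2 - g z) + fun z ↦ g z - f z := by
    ext1 z; simp
  rw [e]
  refine (eLpNorm_add_le (S.aestronglyMeasurable_eval.sub hgm) (hgm.sub hfm) one_le_two).trans ?_
  exact (add_le_add hS hgf).trans (ENNReal.add_halves ε).le

lemma add (hf : IsSimpleLimit 𝓕 P T f) (hg : IsSimpleLimit 𝓕 P T g)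
    (hfm : AEStronglyMeasurable f ((leb T).prod P))
    (hgm : AEStronglyMeasurable g ((leb T).prod P)) :
    IsSimpleLimit 𝓕 P T (fun z ↦ f z + g z) := by
  intro ε hε
  obtain ⟨S, hS⟩ := hf (ε / 2) (by simpa using hε)
  obtain ⟨S', hS'⟩ := hg (ε / 2) (by simpa using hε)
  refine ⟨S.add S', ?_⟩
  have e : (fun z : ℝ≥0 × Ω ↦ (S.add S').eval z.1 z.2 - (f z + g z))
      = (fun z ↦ S.eval z.1 z.2 - f z) + fun z ↦ S'.eval z.1 z.2 - g z := by
    ext1 z; simp only [SimpleProcess.add_eval, Pi.add_apply]; abel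
  rw [e]
  refine (eLpNorm_add_le (S.aestronglyMeasurable_eval.sub hfm)
    (S'.aestronglyMeasurable_eval.sub hgm) one_le_two).trans ?_
  exact (add_le_add hS hS').trans (ENNReal.add_halves ε).le

lemma zero : IsSimpleLimit 𝓕 P T (fun _ ↦ (0 : Vec m)) :=
  of_eval SimpleProcess.zero (Eventually.of_forall fun z ↦ SimpleProcess.zero_eval z.1 z.2)

lemma indicator_Ioi_prod (c : Vec m) (i : ℝ≥0) {A : Set Ω} (hA : MeasurableSet[𝓕 i] A) :
    IsSimpleLimit 𝓕 P T ((Set.Ioi i ×ˢ A).indicator fun _ ↦ c) := by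
  refine of_eval (SimpleProcess.single i (max i T) (le_max_left _ _) (A.indicator fun _ ↦ c)
    (StronglyMeasurable.indicator stronglyMeasurable_const hA)
    ⟨‖c‖, fun ω ↦ norm_indicator_le_norm_self (fun _ ↦ c) ω⟩) ?_
  have h : ∀ᵐ z ∂((leb T).prod P), z.1 ≤ T := Measure.quasiMeasurePreserving_fst.ae (ae_leb_le T)
  filter_upwards [h] with z hz
  rw [SimpleProcess.single_eval]
  simp only [Set.indicator_apply, Set.mem_Ioc, le_max_iff, hz, or_true, and_true]
  by_cases h1 : i < z.1 <;> by_cases h2 : z.2 ∈ A <;> simp [h1, h2]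

/-- Indicators of predictable sets are limits of simple processes. -/
lemma indicator {s : Set (ℝ≥0 × Ω)} (hs : MeasurableSet[𝓕.predictable] s) (c : Vec m) :
    IsSimpleLimit 𝓕 P T (s.indicator fun _ ↦ c) := by
  have hmeas : ∀ {s : Set (ℝ≥0 × Ω)} (c : Vec m), MeasurableSet[𝓕.predictable] s →
      AEStronglyMeasurable (s.indicator fun _ ↦ c) ((leb T).prod P) := fun c hs ↦
    aestronglyMeasurable_const.indicator (predictable_le_prod _ hs)
  have hconst : ∀ c : Vec m, IsSimpleLimit 𝓕 P T (fun _ ↦ c) := fun c ↦ by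
    refine of_eval (SimpleProcess.single 0 T zero_le (fun _ ↦ c) stronglyMeasurable_const
      ⟨‖c‖, fun _ ↦ le_rfl⟩) ?_
    have h : ∀ᵐ z ∂((leb T).prod P), z.1 ∈ Set.Ioc 0 T :=
      Measure.quasiMeasurePreserving_fst.ae (ae_leb_mem_Ioc T)
    filter_upwards [h] with z hz
    rw [SimpleProcess.single_eval, Set.indicator_of_mem hz]
  have hpi : IsPiSystem ({s | ∃ A, MeasurableSet[𝓕 ⊥] A ∧ s = {⊥} ×ˢ A} ∪
      {s : Set (ℝ≥0 × Ω) | ∃ i A, MeasurableSet[𝓕 i] A ∧ s = Set.Ioi i ×ˢ A}) := by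
    rintro - (⟨A, hA, rfl⟩ | ⟨i, A, hA, rfl⟩) - (⟨B, hB, rfl⟩ | ⟨j, B, hB, rfl⟩) hne
    · exact Or.inl ⟨A ∩ B, hA.inter hB, by rw [Set.prod_inter_prod, Set.inter_self]⟩
    · obtain ⟨z, ⟨h1, -⟩, ⟨h2, -⟩⟩ := hne
      rw [Set.mem_singleton_iff] at h1
      rw [h1] at h2
      exact absurd (Set.mem_Ioi.1 h2) not_lt_bot
    · obtain ⟨z, ⟨h2, -⟩, ⟨h1, -⟩⟩ := hne
      rw [Set.mem_singleton_iff] at h1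
      rw [h1] at h2
      exact absurd (Set.mem_Ioi.1 h2) not_lt_bot
    · exact Or.inr ⟨max i j, A ∩ B, (𝓕.mono (le_max_left i j) A hA).inter
        (𝓕.mono (le_max_right i j) B hB), by rw [Set.prod_inter_prod, Set.Ioi_inter_Ioi]⟩
  induction s, hs using MeasurableSpace.induction_on_inter (m := 𝓕.predictable) rfl hpi
    generalizing c with
  | empty => simpa using zero
  | basic s hs =>
    rcases hs with ⟨A, hA, rfl⟩ | ⟨i, A, hA, rfl⟩
    -- Sets over the single time 0 are null for `leb T`.
    · refine of_eval SimpleProcess.zero ?_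
      have h : ∀ᵐ z ∂((leb T).prod P), z.1 ∈ Set.Ioc 0 T :=
        Measure.quasiMeasurePreserving_fst.ae (ae_leb_mem_Ioc T)
      filter_upwards [h] with z hz
      rw [SimpleProcess.zero_eval, Set.indicator_of_notMem]
      rintro ⟨h1, -⟩
      rw [Set.mem_singleton_iff] at h1
      exact hz.1.ne' h1
    · exact indicator_Ioi_prod c i hA
  | compl s hs ih =>
    -- The indicator of the complement is a constant minus an indicator; the sign is absorbed in
    -- `c`, hence the induction over all `c`.
    have h := (hconst c).add (ih (-c)) aestronglyMeasurable_const (hmeas (-c) hs)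
    convert h using 2 with z
    by_cases hz : z ∈ s <;> simp [hz]
  | iUnion f hd hf ih =>
    refine of_forall_le (hmeas c (MeasurableSet.iUnion hf)) fun ε hε ↦ ?_
    -- The measure is finite, so the tails of a disjoint union have measure tending to zero and
    -- finite unions approximate it in `L²`.
    have ht := tendsto_measure_biUnion_Ici_zero_of_pairwise_disjoint (μ := (leb T).prod P)
      (fun i ↦ (predictable_le_prod _ (hf i)).nullMeasurableSet) hd
    have ht2 : Tendsto (fun n ↦ ‖c‖ₑ * ((leb T).prod P) (⋃ i ≥ n, f i) ^ (1 / 2 : ℝ)) atTop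
        (𝓝 0) := by
      have h1 := ((ENNReal.continuous_rpow_const (y := (1 / 2 : ℝ))).tendsto 0).comp ht
      rw [ENNReal.zero_rpow_of_pos (by norm_num)] at h1
      simpa using ENNReal.Tendsto.const_mul (a := ‖c‖ₑ) h1 (Or.inr enorm_ne_top)
    obtain ⟨N, hN⟩ := ((ENNReal.tendsto_nhds_zero.1 ht2) ε (pos_iff_ne_zero.2 hε)).exists
    have key : ∀ n, AEStronglyMeasurable (fun z ↦ ∑ i ∈ Finset.range n, (f i).indicator (fun _ ↦ c) z)
        ((leb T).prod P) ∧
        IsSimpleLimit 𝓕 P T (fun z ↦ ∑ i ∈ Finset.range n, (f i).indicator (fun _ ↦ c) z) := by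
      intro n
      induction n with
      | zero => simpa using ⟨aestronglyMeasurable_const, zero⟩
      | succ n ihn =>
        simp only [Finset.sum_range_succ]
        exact ⟨ihn.1.add (hmeas c (hf n)), ihn.2.add (ih n c) ihn.1 (hmeas c (hf n))⟩
    refine ⟨_, (key N).1, (key N).2, ?_⟩
    refine le_trans (le_of_eq ?_) hN
    have e : ∀ z, ‖∑ i ∈ Finset.range N, (f i).indicator (fun _ ↦ c) z
        - (⋃ i, f i).indicator (fun _ ↦ c) z‖ = ‖(⋃ i ≥ N, f i).indicator (fun _ ↦ c) z‖ := by
      intro z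
      by_cases hz : ∃ i, z ∈ f i
      · obtain ⟨i, hi⟩ := hz
        have huniq : ∀ j, z ∈ f j → j = i := fun j hj ↦ by
          by_contra hne
          exact (Set.disjoint_left.1 (hd hne) hj) hi
        have hs : ∑ j ∈ Finset.range N, (f j).indicator (fun _ ↦ c) z
            = if i < N then c else 0 := by
          have h3 := Finset.sum_ite_eq (Finset.range N) i (fun _ ↦ c)
          simp only [Finset.mem_range] at h3
          rw [← h3]
          refine Finset.sum_congr rfl fun j _ ↦ ?_
          by_cases hij : i = j
          · subst hij; simp [hi]
          · have : z ∉ f j := fun h ↦ hij (huniq j h).symm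
            simp [this, hij]
        have h1 : z ∈ ⋃ i, f i := Set.mem_iUnion.2 ⟨i, hi⟩
        have h2 : z ∈ (⋃ i ≥ N, f i) ↔ N ≤ i := by
          simp only [Set.mem_iUnion, exists_prop]
          exact ⟨fun ⟨j, hj, hzj⟩ ↦ huniq j hzj ▸ hj, fun h ↦ ⟨i, h, hi⟩⟩
        rw [hs, Set.indicator_of_mem h1]
        by_cases hiN : i < N
        · rw [Set.indicator_of_notMem (mt h2.1 (not_le.2 hiN))]
          simp [hiN]
        · rw [Set.indicator_of_mem (h2.2 (not_lt.1 hiN))]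
          simp [hiN]
      · push Not at hz
        simp [hz]
    have hU : MeasurableSet (⋃ i ≥ N, f i) := MeasurableSet.iUnion fun i ↦
      MeasurableSet.iUnion fun _ ↦ predictable_le_prod _ (hf i)
    rw [eLpNorm_congr_norm_ae (Eventually.of_forall e),
      eLpNorm_indicator_const hU (by simp) (by simp)]
    simp

end IsSimpleLimit

/-- Square integrable predictable processes are limits of simple processes. -/
theorem isSimpleLimit_of_memLp {ρ : ℝ≥0 → Ω → Vec m} (hρ : IsStronglyPredictable 𝓕 ρ)
    (h2 : MemLp (fun z : ℝ≥0 × Ω ↦ ρ z.1 z.2) 2 ((leb T).prod P)) :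
    IsSimpleLimit 𝓕 P T (fun z ↦ ρ z.1 z.2) := by
  refine IsSimpleLimit.of_forall_le h2.1 fun ε hε ↦ ?_
  -- The measure is trimmed to the predictable σ-algebra so that the approximating step functions
  -- are themselves predictable.
  have hmem : @MemLp _ _ 𝓕.predictable _ _ (Function.uncurry ρ) 2
      (((leb T).prod P).trim predictable_le_prod) :=
    ⟨StronglyMeasurable.aestronglyMeasurable hρ, by
      rw [eLpNorm_trim predictable_le_prod hρ]; exact h2.2⟩
  obtain ⟨g, hg, -⟩ := @MemLp.exists_simpleFunc_eLpNorm_sub_lt _ 𝓕.predictable _ _ _ _ _ hmem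
    (by simp) ε hε
  have hgm : StronglyMeasurable[𝓕.predictable] g := @SimpleFunc.stronglyMeasurable _ _ 𝓕.predictable _ g
  refine ⟨g, (hgm.mono predictable_le_prod).aestronglyMeasurable, ?_, ?_⟩
  · clear hg hgm
    induction g using SimpleFunc.induction with
    | @const c s hs =>
      convert IsSimpleLimit.indicator (P := P) (T := T) hs c using 1
      ext1 z
      by_cases hz : z ∈ s <;> simp [hz]
    | @add f g _ hf hg =>
      refine hf.add hg ?_ ?_
      · exact ((@SimpleFunc.stronglyMeasurable _ _ 𝓕.predictable _ f).mono
          predictable_le_prod).aestronglyMeasurable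
      · exact ((@SimpleFunc.stronglyMeasurable _ _ 𝓕.predictable _ g).mono
          predictable_le_prod).aestronglyMeasurable
  · have e : eLpNorm (fun z : ℝ≥0 × Ω ↦ g z - ρ z.1 z.2) 2 ((leb T).prod P)
        = eLpNorm (Function.uncurry ρ - ⇑g) 2 ((leb T).prod P) := by
      rw [← eLpNorm_neg]
      congr 1
      ext1 z
      simp [Function.uncurry]
    rw [e, ← eLpNorm_trim predictable_le_prod (StronglyMeasurable.sub hρ hgm)]
    exact hg.le

/-! ### Existence of the stochastic integral -/

/-- The limit is named by a limsup because a limsup of measurable functions is measurable with no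
exceptional set; the integral built from it is then adapted outright. -/
lemma tendstoUniformlyOn_limsup_of_geometric {α : Type*} {s : Set α} {u : ℕ → α → ℝ}
    (h : ∀ᶠ n in atTop, ∀ t ∈ s, |u (n + 1) t - u n t| < (1 / 2) ^ n) :
    TendstoUniformlyOn u (fun t ↦ limsup (fun n ↦ u n t) atTop) atTop s := by
  obtain ⟨N, hN⟩ := eventually_atTop.1 h
  have key : ∀ t ∈ s, ∀ n, |u (n + N) t - limsup (fun n ↦ u n t) atTop|
      ≤ (1 / 2) ^ N * (1 / 2) ^ n / (1 - 1 / 2) := by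
    intro t ht
    have hd : ∀ n, dist (u (n + N) t) (u (n + 1 + N) t) ≤ (1 / 2) ^ N * (1 / 2) ^ n := fun n ↦ by
      rw [dist_comm, Real.dist_eq, ← pow_add, add_right_comm, add_comm N n]
      exact (hN (n + N) (Nat.le_add_left _ _) t ht).le
    obtain ⟨L, hL⟩ := cauchySeq_tendsto_of_complete
      (cauchySeq_of_le_geometric (1 / 2) ((1 / 2) ^ N) (by norm_num) hd)
    have hL' : Tendsto (fun n ↦ u n t) atTop (𝓝 L) := (tendsto_add_atTop_iff_nat N).1 hL
    rw [hL'.limsup_eq]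
    exact fun n ↦ dist_le_of_le_geometric_of_tendsto (1 / 2) ((1 / 2) ^ N) (by norm_num) hd hL n
  rw [Metric.tendstoUniformlyOn_iff]
  intro ε hε
  have h4 : Tendsto (fun n : ℕ ↦ ((1 : ℝ) / 2) ^ N * (1 / 2) ^ n / (1 - 1 / 2)) atTop (𝓝 0) := by
    have := ((tendsto_pow_atTop_nhds_zero_of_lt_one (r := (1 : ℝ) / 2) (by norm_num)
      (by norm_num)).const_mul (((1 : ℝ) / 2) ^ N)).div_const (1 - 1 / 2)
    simpa using this
  obtain ⟨n₀, hn₀⟩ := eventually_atTop.1 ((tendsto_order.1 h4).2 ε hε)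
  filter_upwards [eventually_ge_atTop (n₀ + N)] with n hn t ht
  obtain ⟨k, rfl⟩ := Nat.exists_eq_add_of_le' (le_of_add_le_right hn)
  rw [dist_comm, Real.dist_eq]
  exact (key t ht k).trans_lt (hn₀ k (by omega))

lemma eLpNorm_two_sq {α E : Type*} [MeasurableSpace α] {μ : Measure α} [NormedAddCommGroup E]
    {f : α → E} (hf : MemLp f 2 μ) :
    eLpNorm f 2 μ ^ 2 = ENNReal.ofReal (∫ x, ‖f x‖ ^ 2 ∂μ) := by
  rw [hf.eLpNorm_eq_integral_rpow_norm (by simp) (by simp)]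
  have h0 : 0 ≤ ∫ x, ‖f x‖ ^ 2 ∂μ := integral_nonneg fun _ ↦ sq_nonneg _
  simp only [ENNReal.toReal_ofNat, Real.rpow_ofNat]
  rw [← ENNReal.ofReal_pow (Real.rpow_nonneg h0 _), ← Real.rpow_natCast, ← Real.rpow_mul h0]
  norm_num

lemma eLpNorm_two_sq_eq_lintegral {α E : Type*} [MeasurableSpace α] {μ : Measure α}
    [NormedAddCommGroup E] (f : α → E) : eLpNorm f 2 μ ^ 2 = ∫⁻ x, ‖f x‖ₑ ^ 2 ∂μ := by
  rw [eLpNorm_eq_lintegral_rpow_enorm_toReal (by simp) (by simp)]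
  simp only [ENNReal.toReal_ofNat, ENNReal.rpow_ofNat]
  rw [← ENNReal.rpow_natCast, ← ENNReal.rpow_mul]
  norm_num

lemma ae_memLp_section {E : Type*} [NormedAddCommGroup E] {f : ℝ≥0 × Ω → E}
    (hf : StronglyMeasurable f) (h2 : MemLp f 2 ((leb T).prod P)) :
    ∀ᵐ ω ∂P, MemLp (fun s ↦ f (s, ω)) 2 (leb T) := by
  have hm : AEMeasurable (fun z ↦ ‖f z‖ₑ ^ 2) ((leb T).prod P) := h2.1.enorm.pow_const 2
  have h := h2.lintegral_enorm_sq_lt_top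
  rw [lintegral_prod_symm _ hm] at h
  filter_upwards [ae_lt_top' hm.lintegral_prod_left h.ne] with ω hω
  exact (memLp_two_iff (hf.comp_measurable measurable_prodMk_right).aestronglyMeasurable).2 hω

namespace SimpleProcess

/-- The negative of a simple process. -/
def neg (H : SimpleProcess 𝓕 m) : SimpleProcess 𝓕 m where
  n := H.n
  left := H.left
  right := H.right
  left_le_right := H.left_le_right
  ξ := fun k ω ↦ -H.ξ k ω
  measurable_ξ k := (H.measurable_ξ k).neg
  bounded_ξ k := by simpa using H.bounded_ξ k

/-- The difference of two simple processes. -/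
def sub (H K : SimpleProcess 𝓕 m) : SimpleProcess 𝓕 m := H.add K.neg

lemma sub_eval (H K : SimpleProcess 𝓕 m) (s : ℝ≥0) (ω : Ω) :
    (H.sub K).eval s ω = H.eval s ω - K.eval s ω := by
  rw [sub, add_eval, sub_eq_add_neg]
  congr 1
  simp only [eval, neg, ← Finset.sum_neg_distrib]
  refine Finset.sum_congr rfl fun k _ ↦ ?_
  simp only [Set.indicator_apply]
  split_ifs <;> simp

lemma sub_integral (H K : SimpleProcess 𝓕 m) (W : ℝ≥0 → Ω → Vec m) (t : ℝ≥0) (ω : Ω) :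
    (H.sub K).integral W t ω = H.integral W t ω - K.integral W t ω := by
  rw [sub, add_integral, sub_eq_add_neg]
  congr 1
  simp only [integral, neg, ← Finset.sum_neg_distrib, inner_neg_left]
  rfl

lemma eLpNorm_eval_sq (H : SimpleProcess 𝓕 m) :
    eLpNorm (fun z : ℝ≥0 × Ω ↦ H.eval z.1 z.2) 2 ((leb T).prod P) ^ 2
      = ENNReal.ofReal (∫ ω, ∫ s, ‖H.eval s ω‖ ^ 2 ∂(leb T) ∂P) := by
  have h := H.memLp_eval_prod (P := P) (T := T)
  rw [eLpNorm_two_sq h, integral_prod_symm _ h.norm.integrable_sq]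

/-- This is the isometry in the norm form needed for Cauchy estimates in `L²(P)`. -/
lemma eLpNorm_integral (hW : IsFilteredBrownian 𝓕 P T W) (H : SimpleProcess 𝓕 m) :
    eLpNorm (H.integral W T) 2 P
      = eLpNorm (fun z : ℝ≥0 × Ω ↦ H.eval z.1 z.2) 2 ((leb T).prod P) := by
  have h1 := eLpNorm_two_sq ((H.isL2Martingale hW).memLp T le_rfl)
  simp only [Real.norm_eq_abs, sq_abs] at h1
  rw [H.isometry hW, ← H.eLpNorm_eval_sq] at h1
  exact (ENNReal.pow_right_strictMono two_ne_zero).injective h1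

lemma integral_eq_zero (hW : IsFilteredBrownian 𝓕 P T W) (H : SimpleProcess 𝓕 m) :
    ∫ ω, H.integral W T ω ∂P = 0 := by
  have h := (H.isL2Martingale hW).orth 0 T zero_le le_rfl (fun _ ↦ 1) stronglyMeasurable_const
    (memLp_const _)
  simpa [integral_zero] using h

end SimpleProcess

/-- The stochastic integral of a square integrable predictable process. -/
theorem IsFilteredBrownian.exists_isItoIntegral (hW : IsFilteredBrownian 𝓕 P T W)
    {ρ : ℝ≥0 → Ω → Vec m} (hρ : IsStronglyPredictable 𝓕 ρ)
    (h2 : MemLp (fun z : ℝ≥0 × Ω ↦ ρ z.1 z.2) 2 ((leb T).prod P)) :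
    ∃ M : ℝ≥0 → Ω → ℝ, (∀ t, StronglyMeasurable[𝓕 t] (M t)) ∧ IsItoIntegral 𝓕 P T W ρ M ∧
      Integrable (M T) P ∧ ∫ ω, M T ω ∂P = 0 := by
  have hlim := isSimpleLimit_of_memLp hρ h2
  -- The rate `8^{-k}` is fast enough to survive division by `(2^{-k})² / 4` in the maximal
  -- inequality and remain summable.
  choose S hS using fun k : ℕ ↦ hlim (ENNReal.ofReal ((1 / 8) ^ k)) (by simp)
  have hcau : ∀ N j k : ℕ, N ≤ j → N ≤ k →
      eLpNorm (fun z : ℝ≥0 × Ω ↦ ((S j).sub (S k)).eval z.1 z.2) 2 ((leb T).prod P)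
        ≤ ENNReal.ofReal (2 * (1 / 8) ^ N) := by
    intro N j k hj hk
    have hb : ∀ i, N ≤ i → eLpNorm (fun z : ℝ≥0 × Ω ↦ (S i).eval z.1 z.2 - ρ z.1 z.2) 2
        ((leb T).prod P) ≤ ENNReal.ofReal ((1 / 8) ^ N) := fun i hi ↦
      (hS i).trans (ENNReal.ofReal_le_ofReal
        (pow_le_pow_of_le_one (by norm_num) (by norm_num) hi))
    have e : (fun z : ℝ≥0 × Ω ↦ ((S j).sub (S k)).eval z.1 z.2)
        = (fun z ↦ (S j).eval z.1 z.2 - ρ z.1 z.2) - fun z ↦ (S k).eval z.1 z.2 - ρ z.1 z.2 := by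
      ext1 z
      simp [SimpleProcess.sub_eval]
    rw [e, two_mul, ENNReal.ofReal_add (by positivity) (by positivity)]
    exact (eLpNorm_sub_le ((S j).aestronglyMeasurable_eval.sub h2.1)
      ((S k).aestronglyMeasurable_eval.sub h2.1) one_le_two).trans (add_le_add (hb j hj) (hb k hk))
  have hunif : ∀ᵐ ω ∂P, TendstoUniformlyOn (fun n t ↦ (S n).integral W t ω)
      (fun t ↦ limsup (fun n ↦ (S n).integral W t ω) atTop) atTop (Set.Iic T) := by
    have hP : ∀ n : ℕ, P {ω | ∃ t ≤ T, ((1 : ℝ) / 2) ^ n ≤ |((S (n + 1)).sub (S n)).integral W t ω|}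
        ≤ ENNReal.ofReal 16 * ENNReal.ofReal ((1 / 2) ^ n) := by
      intro n
      have h1 := ((S (n + 1)).sub (S n)).maximal_ineq hW (ε := (1 / 2) ^ n) (by positivity)
      rw [← SimpleProcess.eLpNorm_eval_sq] at h1
      have h2 := h1.trans (pow_le_pow_left' (hcau n (n + 1) n (Nat.le_succ n) le_rfl) 2)
      have hpos : (0 : ℝ) < ((1 / 2) ^ n) ^ 2 / 4 := by positivity
      rw [← ENNReal.ofReal_pow (by positivity), mul_comm, ← ENNReal.le_div_iff_mul_le (Or.inl (by simp))
        (Or.inl ENNReal.ofReal_ne_top), ← ENNReal.ofReal_div_of_pos hpos] at h2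
      refine h2.trans ?_
      rw [← ENNReal.ofReal_mul (by positivity)]
      refine ENNReal.ofReal_le_ofReal ?_
      rw [div_le_iff₀ hpos]
      have e8 : ((1 : ℝ) / 8) ^ n = (1 / 2) ^ n * (1 / 2) ^ n * (1 / 2) ^ n := by
        rw [← mul_pow, ← mul_pow]; norm_num
      rw [e8]
      have hr0 : (0 : ℝ) < (1 / 2) ^ n := by positivity
      have hr1 : ((1 : ℝ) / 2) ^ n ≤ 1 := pow_le_one₀ (by norm_num) (by norm_num)
      generalize ((1 : ℝ) / 2) ^ n = r at hr0 hr1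
      have : r ^ 6 ≤ r ^ 3 := pow_le_pow_of_le_one hr0.le hr1 (by norm_num)
      nlinarith
    have hBC := ae_eventually_notMem (μ := P)
      (s := fun n ↦ {ω | ∃ t ≤ T, ((1 : ℝ) / 2) ^ n ≤ |((S (n + 1)).sub (S n)).integral W t ω|})
      (by
        refine ne_top_of_le_ne_top ?_ (ENNReal.tsum_le_tsum hP)
        rw [ENNReal.tsum_mul_left]
        exact ENNReal.mul_ne_top ENNReal.ofReal_ne_top tsum_ofReal_half_pow_ne_top)
    filter_upwards [hBC] with ω hω
    refine tendstoUniformlyOn_limsup_of_geometric ?_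
    filter_upwards [hω] with n hn t ht
    simp only [not_exists, not_and, not_le, SimpleProcess.sub_integral] at hn
    exact hn t ht
  have hL2 : ∀ᵐ ω ∂P, Tendsto (fun n ↦ ∫⁻ s, ‖(S n).eval s ω - ρ s ω‖ₑ ^ 2 ∂(leb T)) atTop
      (𝓝 0) := by
    have hm : ∀ n, AEStronglyMeasurable (fun z : ℝ≥0 × Ω ↦ (S n).eval z.1 z.2 - ρ z.1 z.2)
        ((leb T).prod P) := fun n ↦ (S n).aestronglyMeasurable_eval.sub h2.1
    have hm2 : ∀ n, AEMeasurable (fun z : ℝ≥0 × Ω ↦ ‖(S n).eval z.1 z.2 - ρ z.1 z.2‖ₑ ^ 2)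
        ((leb T).prod P) := fun n ↦ (hm n).enorm.pow_const 2
    -- The squared distances have summable expectations, so almost surely their sum over `n` is
    -- finite and its terms tend to zero.
    have hsum : ∫⁻ ω, ∑' n, ∫⁻ s, ‖(S n).eval s ω - ρ s ω‖ₑ ^ 2 ∂(leb T) ∂P ≠ ∞ := by
      rw [lintegral_tsum fun n ↦ (hm2 n).lintegral_prod_left]
      refine ne_top_of_le_ne_top tsum_ofReal_half_pow_ne_top (ENNReal.tsum_le_tsum fun n ↦ ?_)
      rw [← lintegral_prod_symm _ (hm2 n)]
      rw [← eLpNorm_two_sq_eq_lintegral]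
      refine (pow_le_pow_left' (hS n) 2).trans ?_
      rw [← ENNReal.ofReal_pow (by positivity), ← pow_mul]
      refine ENNReal.ofReal_le_ofReal ?_
      calc ((1 : ℝ) / 8) ^ (n * 2) ≤ (1 / 8) ^ n :=
            pow_le_pow_of_le_one (by norm_num) (by norm_num) (by omega)
        _ ≤ (1 / 2) ^ n := by gcongr; norm_num
    filter_upwards [ae_lt_top' (AEMeasurable.tsum fun n ↦ (hm2 n).lintegral_prod_left) hsum]
      with ω hω
    exact ENNReal.tendsto_atTop_zero_of_tsum_ne_top hω.ne
  have hρ2 : ∀ᵐ ω ∂P, MemLp (fun s ↦ ρ s ω) 2 (leb T) :=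
    ae_memLp_section (hρ.mono predictable_le_prod) h2
  have hT : ∀ᵐ ω ∂P, Tendsto (fun n ↦ (S n).integral W T ω) atTop
      (𝓝 (limsup (fun n ↦ (S n).integral W T ω) atTop)) := by
    filter_upwards [hunif] with ω h using h.tendsto_at (Set.mem_Iic.2 le_rfl)
  have hM : ∀ t, StronglyMeasurable[𝓕 t] fun ω ↦ limsup (fun n ↦ (S n).integral W t ω) atTop :=
    fun t ↦ (Measurable.limsup fun n ↦
      ((S n).stronglyMeasurable_integral hW.adapted t).measurable).stronglyMeasurable
  have hST : ∀ n, MemLp ((S n).integral W T) 2 P := fun n ↦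
    ((S n).isL2Martingale hW).memLp T le_rfl
  -- Almost sure convergence at `T` does not carry expectations to the limit; by the isometry the
  -- convergence also holds in `L²`, which gives integrability and mean zero.
  have hLp : Tendsto (fun n ↦ eLpNorm ((S n).integral W T
      - fun ω ↦ limsup (fun n ↦ (S n).integral W T ω) atTop) 2 P) atTop (𝓝 0) := by
    refine Lp.cauchy_tendsto_of_tendsto (B := fun N ↦ ENNReal.ofReal (4 * (1 / 2) ^ N))
      (fun n ↦ (hST n).1) _ ?_ ?_ hT
    · simp_rw [ENNReal.ofReal_mul (by norm_num : (0 : ℝ) ≤ 4)]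
      rw [ENNReal.tsum_mul_left]
      exact ENNReal.mul_ne_top ENNReal.ofReal_ne_top tsum_ofReal_half_pow_ne_top
    · intro N j k hj hk
      have e : (S j).integral W T - (S k).integral W T = ((S j).sub (S k)).integral W T := by
        ext1 ω; simp [SimpleProcess.sub_integral]
      rw [e, SimpleProcess.eLpNorm_integral hW]
      refine (hcau N j k hj hk).trans_lt ((ENNReal.ofReal_lt_ofReal_iff (by positivity)).2 ?_)
      have : ((1 : ℝ) / 8) ^ N ≤ (1 / 2) ^ N := by gcongr; norm_num
      have : (0 : ℝ) < (1 / 2) ^ N := by positivity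
      linarith
  have hMT := (hM T).mono (𝓕.le T)
  refine ⟨fun t ω ↦ limsup (fun n ↦ (S n).integral W t ω) atTop, hM, ?_, ?_, ?_⟩
  · exact isItoIntegral_of_tendsto hW.continuous hW.adapted (fun n ↦ (S n).isItoIntegral) hρ2 hL2
      hunif
  · exact (Lp.memLp_of_cauchy_tendsto one_le_two hST _ hMT.aestronglyMeasurable hLp).integrable
      one_le_two
  · refine tendsto_nhds_unique (tendsto_integral_of_L1 (l := atTop) _ hMT.aestronglyMeasurable
      (Eventually.of_forall fun n ↦ (hST n).integrable one_le_two) ?_) ?_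
    · refine tendsto_of_tendsto_of_tendsto_of_le_of_le tendsto_const_nhds hLp (fun _ ↦ zero_le)
        fun n ↦ ?_
      refine le_trans (le_of_eq ?_) (eLpNorm_le_eLpNorm_of_exponent_le one_le_two
        ((hST n).1.sub hMT.aestronglyMeasurable))
      rw [eLpNorm_one_eq_lintegral_enorm]
      rfl
    · simp only [SimpleProcess.integral_eq_zero hW]
      exact tendsto_const_nhds

/-! ### The wealth equation -/

variable {X a : ℝ≥0 → Ω → ℝ} {ρ θ : ℝ≥0 → Ω → Vec m} {x : ℝ}

lemma Icc_zero_eq_Iic (T : ℝ≥0) : Set.Icc 0 T = Set.Iic T := by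
  ext t; simp

/-- A predictable process is progressive, hence on `[0, t] × Ω` measurable for the product with `𝓕
t`; integrating out the time variable keeps measurability in `ω`. -/
lemma stronglyMeasurable_primitive (ha : IsStronglyPredictable 𝓕 a) (t : ℝ≥0) :
    StronglyMeasurable[𝓕 t] (fun ω ↦ ∫ s, a s ω ∂(leb t)) := by
  have h := ha.isStronglyProgressive t
  have hs : ∀ ω, ∫ s, a s ω ∂(leb t)
      = ∫ s : Set.Iic t, a s ω ∂((leb t).comap Subtype.val) := fun ω ↦ by
    rw [integral_subtype_comap measurableSet_Iic (fun s ↦ a s ω), leb_restrict_Iic le_rfl]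
  simp_rw [hs]
  have : SFinite ((leb t).comap (Subtype.val : Set.Iic t → ℝ≥0)) := inferInstance
  exact @StronglyMeasurable.integral_prod_left (Set.Iic t) Ω ℝ _ (𝓕 t) _ _ _ _ (fun s ω ↦ a s ω) h

lemma IsItoProcess.of_primitive (hW : IsFilteredBrownian 𝓕 P T W) {M : ℝ≥0 → Ω → ℝ}
    (hM : IsItoIntegral 𝓕 P T W H M) (ha : IsStronglyPredictable 𝓕 a)
    (hai : ∀ᵐ ω ∂P, Integrable (fun s ↦ a s ω) (leb T)) :
    IsItoProcess 𝓕 P T W (fun t ω ↦ M t ω + ∫ s, a s ω ∂(leb t)) H a := by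
  refine ⟨fun t ht ↦ ?_, hai, ?_⟩
  · obtain ⟨f, hf, hf'⟩ := hM.aestronglyMeasurable hW.adapted ht
    refine ⟨fun ω ↦ f ω + ∫ s, a s ω ∂(leb t), hf.add (stronglyMeasurable_primitive ha t), ?_⟩
    filter_upwards [hf'] with ω h
    rw [h]
  · refine hM.congr (Eventually.of_forall fun _ ↦ Eventually.of_forall fun _ ↦ rfl) ?_
    filter_upwards [hM.zero_ae] with ω h0 t _
    simp [h0, leb_zero]

lemma IsItoProcess.const_mul (hW : IsFilteredBrownian 𝓕 P T W)
    (hX : IsItoProcess 𝓕 P T W X H a) (c : ℝ) :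
    IsItoProcess 𝓕 P T W (fun t ω ↦ c * X t ω) (fun s ω ↦ c • H s ω) (fun s ω ↦ c * a s ω) :=
  ((isItoProcess_const c).mul hW hX).congr (fun _ _ ↦ rfl) (fun _ _ ↦ by simp) (fun _ _ ↦ by simp)

lemma IsWealthProcess.isItoProcess (hX : IsWealthProcess 𝓕 P T W θ x ρ X) :
    IsItoProcess 𝓕 P T W X (fun s ω ↦ X s ω • ρ s ω)
      (fun s ω ↦ X s ω * inner ℝ (ρ s ω) (θ s ω)) := by
  obtain ⟨I, hI, hXI⟩ := hX.equation
  refine ⟨fun t ht ↦ ⟨_, hX.adapted t ht, EventuallyEq.rfl⟩, hX.drift_integrable,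
    hI.congr (Eventually.of_forall fun _ ↦ Eventually.of_forall fun _ ↦ rfl) ?_⟩
  filter_upwards [hXI, hI.zero_ae] with ω h h0 t ht
  have h1 := h 0 zero_le
  simp only [h0, leb_zero, integral_zero_measure] at h1
  rw [h t ht, h1]
  ring

lemma IsWealthProcess.initial (hX : IsWealthProcess 𝓕 P T W θ x ρ X) : ∀ᵐ ω ∂P, X 0 ω = x := by
  obtain ⟨I, hI, hXI⟩ := hX.equation
  filter_upwards [hXI, hI.zero_ae] with ω h h0
  simpa [h0, leb_zero] using h 0 zero_le

/-- The wealth process is a stochastic exponential; it is the only solution of the wealth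
equation. -/
lemma IsWealthProcess.eq_exp (hW : IsFilteredBrownian 𝓕 P T W) {U : ℝ≥0 → Ω → ℝ}
    (hU : IsItoProcess 𝓕 P T W U ρ (fun s ω ↦ inner ℝ (ρ s ω) (θ s ω) - 1 / 2 * ‖ρ s ω‖ ^ 2))
    (hU0 : ∀ᵐ ω ∂P, U 0 ω = 0) (hX : IsWealthProcess 𝓕 P T W θ x ρ X) :
    ∀ᵐ ω ∂P, ∀ t ≤ T, X t ω = x * Real.exp (U t ω) := by
  -- The process studied is `X * exp (-U)`: its `dW` coefficient cancels, so its Itô integral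
  -- vanishes by `eq_zero`, and `hd` shows that its drift cancels too. It keeps its initial value
  -- `x`.
  have h := hX.isItoProcess.mul hW ((hU.const_mul hW (-1)).exp hW)
  have h0 : ∀ᵐ ω ∂P, ∀ t ≤ T, _ := h.isItoIntegral.eq_zero hW
    (Eventually.of_forall fun ω ↦ Eventually.of_forall fun s ↦ by module)
  filter_upwards [h0, hU0, hX.initial] with ω h0 hU0 hX0 t ht
  have h1 := h0 t ht
  have hd : ∀ s, X s ω * (Real.exp (-1 * U s ω) *
        (-1 * (inner ℝ (ρ s ω) (θ s ω) - 1 / 2 * ‖ρ s ω‖ ^ 2)) +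
        Real.exp (-1 * U s ω) * (1 / 2 * ‖(-1 : ℝ) • ρ s ω‖ ^ 2)) +
      Real.exp (-1 * U s ω) * (X s ω * inner ℝ (ρ s ω) (θ s ω)) +
      inner ℝ (X s ω • ρ s ω) (Real.exp (-1 * U s ω) • (-1 : ℝ) • ρ s ω) = 0 := by
    intro s
    simp only [norm_smul, real_inner_smul_left, real_inner_smul_right, real_inner_self_eq_norm_sq,
      norm_neg, norm_one, one_mul]
    ring
  simp only [hd, integral_zero, hU0, hX0, mul_zero, Real.exp_zero, mul_one, sub_zero] at h1
  have h2 : X t ω * Real.exp (-1 * U t ω) = x := by linarith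
  rw [← h2, mul_assoc, ← Real.exp_add]
  simp

lemma integrable_driver_sections (h : MemLp (fun z : ℝ≥0 × Ω ↦ ρ z.1 z.2) 2 ((leb T).prod P))
    (h' : MemLp (fun z : ℝ≥0 × Ω ↦ θ z.1 z.2) 2 ((leb T).prod P)) :
    Integrable (fun z : ℝ≥0 × Ω ↦ inner ℝ (ρ z.1 z.2) (θ z.1 z.2) - 1 / 2 * ‖ρ z.1 z.2‖ ^ 2)
      ((leb T).prod P) :=
  (integrable_inner_of_memLp h h').sub (h.norm.integrable_sq.const_mul _)

/-- Take `U = ∫ ρ dW + ∫ (ρ·θ - ½|ρ|²) ds`. In Itô's formula for `exp U` the second order term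
cancels `-½|ρ|²`, which leaves the wealth equation. The expectation of `U T` is that of its drift
alone, as the stochastic integral has mean zero. -/
theorem IsFilteredBrownian.exists_wealth (hW : IsFilteredBrownian 𝓕 P T W) (x : ℝ)
    (hρ : IsStronglyPredictable 𝓕 ρ) (hθ : IsStronglyPredictable 𝓕 θ)
    (h : MemLp (fun z : ℝ≥0 × Ω ↦ ρ z.1 z.2) 2 ((leb T).prod P))
    (h' : MemLp (fun z : ℝ≥0 × Ω ↦ θ z.1 z.2) 2 ((leb T).prod P)) :
    ∃ U : ℝ≥0 → Ω → ℝ,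
      IsWealthProcess 𝓕 P T W θ x ρ (fun t ω ↦ x * Real.exp (U t ω)) ∧
      (∀ X, IsWealthProcess 𝓕 P T W θ x ρ X →
        ∀ᵐ ω ∂P, ∀ t ≤ T, X t ω = x * Real.exp (U t ω)) ∧
      Integrable (U T) P ∧
      ∫ ω, U T ω ∂P = ∫ z, (inner ℝ (ρ z.1 z.2) (θ z.1 z.2) - 1 / 2 * ‖ρ z.1 z.2‖ ^ 2)
        ∂((leb T).prod P) := by
  obtain ⟨M, hMm, hM, hMi, hM0⟩ := hW.exists_isItoIntegral hρ h
  have hgi := integrable_driver_sections h h'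
  have hg : IsStronglyPredictable 𝓕
      (fun s ω ↦ inner ℝ (ρ s ω) (θ s ω) - 1 / 2 * ‖ρ s ω‖ ^ 2) := by
    have h1 : StronglyMeasurable[𝓕.predictable] fun z : ℝ≥0 × Ω ↦
        inner ℝ (Function.uncurry ρ z) (Function.uncurry θ z) := StronglyMeasurable.inner hρ hθ
    have h2 : StronglyMeasurable[𝓕.predictable] fun z : ℝ≥0 × Ω ↦ 1 / 2 * ‖Function.uncurry ρ z‖ ^ 2 :=
      ((StronglyMeasurable.norm hρ).pow 2).const_mul _
    exact h1.sub h2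
  have hgs : ∀ᵐ ω ∂P, Integrable (fun s ↦ inner ℝ (ρ s ω) (θ s ω) - 1 / 2 * ‖ρ s ω‖ ^ 2) (leb T) :=
    hgi.prod_left_ae
  have hU := IsItoProcess.of_primitive hW hM hg hgs
  have hU0 : ∀ᵐ ω ∂P, M 0 ω + ∫ s, (inner ℝ (ρ s ω) (θ s ω) - 1 / 2 * ‖ρ s ω‖ ^ 2) ∂(leb 0) = 0 := by
    filter_upwards [hM.zero_ae] with ω h0
    simp [h0, leb_zero]
  refine ⟨_, ?_, fun X hX ↦ hX.eq_exp hW hU hU0, ?_, ?_⟩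
  · have hE := ((hU.exp hW).const_mul hW x).congr (Y := fun t ω ↦ x * Real.exp (M t ω
        + ∫ s, (inner ℝ (ρ s ω) (θ s ω) - 1 / 2 * ‖ρ s ω‖ ^ 2) ∂(leb t)))
      (K := fun s ω ↦ (x * Real.exp (M s ω
        + ∫ s, (inner ℝ (ρ s ω) (θ s ω) - 1 / 2 * ‖ρ s ω‖ ^ 2) ∂(leb s))) • ρ s ω)
      (b := fun s ω ↦ (x * Real.exp (M s ω
        + ∫ s, (inner ℝ (ρ s ω) (θ s ω) - 1 / 2 * ‖ρ s ω‖ ^ 2) ∂(leb s))) *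
          inner ℝ (ρ s ω) (θ s ω))
      (fun _ _ ↦ rfl) (fun _ _ ↦ smul_smul _ _ _) (fun _ _ ↦ by ring)
    refine ⟨fun t _ ↦ ?_, ?_, hE.drift_integrable, _, hE.isItoIntegral, ?_⟩
    · exact (Real.continuous_exp.comp_stronglyMeasurable
        ((hMm t).add (stronglyMeasurable_primitive hg t))).const_mul x
    · rw [Icc_zero_eq_Iic]
      exact hE.continuousOn hW
    · filter_upwards [hU0] with ω h0 t _
      simp only [h0, Real.exp_zero]
      ring
  · exact hMi.add hgi.integral_prod_right
  · rw [integral_add hMi hgi.integral_prod_right, hM0, zero_add, integral_prod_symm _ hgi]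

/-! ### Measurable selection of minimizers -/

section Selection

variable {α : Type*} [MeasurableSpace α]

/-- A nonempty compact valued multifunction whose hitting sets of closed sets are measurable. -/
structure IsCompactMultifunction (F : α → Set (Vec d)) : Prop where
  isCompact : ∀ z, IsCompact (F z)
  nonempty : ∀ z, (F z).Nonempty
  measurableSet_hit : ∀ B, IsClosed B → MeasurableSet {z | (F z ∩ B).Nonempty}

/-- Minimizing a continuous function over the values of a compact multifunction. -/
lemma IsCompactMultifunction.argmin {F : α → Set (Vec d)} (hF : IsCompactMultifunction F)
    {ψ : Vec d → ℝ} (hψ : Continuous ψ) :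
    IsCompactMultifunction (fun z ↦ {c ∈ F z | ∀ c' ∈ F z, ψ c ≤ ψ c'}) := by
  have hcl : ∀ z, IsClosed {c | ∀ c' ∈ F z, ψ c ≤ ψ c'} := fun z ↦ by
    simp only [Set.ofPred_forall]
    exact isClosed_iInter fun c' ↦ isClosed_iInter fun _ ↦ isClosed_le hψ continuous_const
  have hmin : ∀ z B, IsClosed B → (F z ∩ B).Nonempty → ∃ c ∈ F z ∩ B, ∀ c' ∈ F z ∩ B, ψ c ≤ ψ c' :=
    fun z B hB hne ↦ ((hF.isCompact z).inter_right hB).exists_isMinOn hne hψ.continuousOn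
  refine ⟨fun z ↦ (hF.isCompact z).inter_right (hcl z), fun z ↦ ?_, fun B hB ↦ ?_⟩
  · obtain ⟨c, hc, hc'⟩ := (hF.isCompact z).exists_isMinOn (hF.nonempty z) hψ.continuousOn
    exact ⟨c, hc, hc'⟩
  · have hr : ∀ r : ℝ, IsClosed {c | ψ c ≤ r} := fun r ↦ isClosed_le hψ continuous_const
    -- A minimizer lies in `B` exactly when the minimum over `F z ∩ B` does not exceed the minimum
    -- over `F z`. This is tested at rational levels, and sublevel sets are closed, so only hitting
    -- sets of closed sets occur.
    have e : {z | ({c ∈ F z | ∀ c' ∈ F z, ψ c ≤ ψ c'} ∩ B).Nonempty}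
        = ⋂ r : ℚ, {z | (F z ∩ {c | ψ c ≤ r}).Nonempty}ᶜ ∪ {z | (F z ∩ (B ∩ {c | ψ c ≤ r})).Nonempty} := by
      ext z
      simp only [Set.mem_iInter, Set.mem_union, Set.mem_compl_iff]
      constructor
      · rintro ⟨c, ⟨hc, hmin⟩, hcB⟩ r
        rw [or_iff_not_imp_left, not_not]
        rintro ⟨c', hc', hr'⟩
        exact ⟨c, hc, hcB, (hmin c' hc').trans hr'⟩
      · intro h
        obtain ⟨c₀, hc₀, hmin₀⟩ := (hF.isCompact z).exists_isMinOn (hF.nonempty z) hψ.continuousOn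
        have h' : ∀ r : ℚ, ψ c₀ ≤ r → (F z ∩ (B ∩ {c | ψ c ≤ r})).Nonempty := fun r hr ↦
          (h r).resolve_left (not_not.2 ⟨c₀, hc₀, hr⟩)
        obtain ⟨r₀, hr₀⟩ := exists_rat_gt (ψ c₀)
        obtain ⟨c₁, h1, h2, -⟩ := h' r₀ hr₀.le
        obtain ⟨c, hc, hcm⟩ := hmin z B hB ⟨c₁, h1, h2⟩
        refine ⟨c, ⟨hc.1, fun c' hc' ↦ ?_⟩, hc.2⟩
        refine le_trans ?_ (hmin₀ hc')
        by_contra! hlt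
        obtain ⟨r, hr1, hr2⟩ := exists_rat_btwn hlt
        obtain ⟨c₂, h3, h4, h5⟩ := h' r hr1.le
        exact absurd ((hcm c₂ ⟨h3, h4⟩).trans h5) (not_le.2 hr2)
    rw [e]
    exact MeasurableSet.iInter fun r ↦ (hF.measurableSet_hit _ (hr r)).compl.union
      (hF.measurableSet_hit _ (hB.inter (hr r)))

/-- A compact multifunction has a measurable selection: minimize the coordinates one after the
other. -/
theorem IsCompactMultifunction.exists_measurable {F : α → Set (Vec d)}
    (hF : IsCompactMultifunction F) : ∃ s : α → Vec d, Measurable s ∧ ∀ z, s z ∈ F z := by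
  classical
  have key : ∀ S : Finset (Fin d), ∃ F' : α → Set (Vec d), IsCompactMultifunction F' ∧
      (∀ z, F' z ⊆ F z) ∧ ∀ z, ∀ c ∈ F' z, ∀ c' ∈ F' z, ∀ i ∈ S, c i = c' i := by
    intro S
    induction S using Finset.induction_on with
    | empty => exact ⟨F, hF, fun _ ↦ subset_rfl, by simp⟩
    | insert i S _ ih =>
      obtain ⟨F', hF', hsub, heq⟩ := ih
      refine ⟨_, hF'.argmin (ψ := fun c ↦ c i) (by fun_prop), fun z c hc ↦ hsub z hc.1, ?_⟩
      intro z c hc c' hc' j hj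
      rcases Finset.mem_insert.1 hj with rfl | hj
      · exact le_antisymm (hc.2 c' hc'.1) (hc'.2 c hc.1)
      · exact heq z c hc.1 c' hc'.1 j hj
  obtain ⟨F', hF', hsub, heq⟩ := key Finset.univ
  choose s hs using hF'.nonempty
  refine ⟨s, measurable_of_isClosed fun B hB ↦ ?_, fun z ↦ hsub z (hs z)⟩
  convert hF'.measurableSet_hit B hB using 1
  ext z
  refine ⟨fun h ↦ ⟨s z, hs z, h⟩, fun ⟨c, hc, hcB⟩ ↦ ?_⟩
  have : c = s z := by
    ext i; exact heq z c hc (s z) (hs z) i (Finset.mem_univ i)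
  rwa [this] at hcB

lemma exists_mem_lt_of_dense {C D : Set (Vec d)} (hD : C ⊆ closure D) {φ : Vec d → ℝ}
    (hφ : Continuous φ) {r : ℝ} {c : Vec d} (hc : c ∈ C) (h : φ c < r) : ∃ c' ∈ D, φ c' < r := by
  obtain ⟨c', h1, h2⟩ := mem_closure_iff.1 (hD hc) {c | φ c < r} (isOpen_lt hφ continuous_const) h
  exact ⟨c', h2, h1⟩

/-- The minimizers over a closed set of a coercive Carathéodory function form a compact
multifunction. -/
lemma isCompactMultifunction_argmin {C : Set (Vec d)} (hC : IsClosed C) (hC' : C.Nonempty)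
    {φ : α → Vec d → ℝ} (hφm : ∀ c, Measurable fun z ↦ φ z c) (hφc : ∀ z, Continuous (φ z))
    (hφ : ∀ z r, Bornology.IsBounded {c | φ z c ≤ r}) :
    IsCompactMultifunction (fun z ↦ {c ∈ C | ∀ c' ∈ C, φ z c ≤ φ z c'}) := by
  have hmin : ∀ z A, IsClosed A → A.Nonempty → ∃ c ∈ A, ∀ c' ∈ A, φ z c ≤ φ z c' := by
    rintro z A hA ⟨c₀, hc₀⟩
    have hcl : IsClosed {c | φ z c ≤ φ z c₀} := isClosed_le (hφc z) continuous_const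
    have hcomp : IsCompact ({c | φ z c ≤ φ z c₀} ∩ A) :=
      (Metric.isCompact_of_isClosed_isBounded hcl (hφ z _)).inter_right hA
    obtain ⟨c, hc, hcm⟩ := hcomp.exists_isMinOn ⟨c₀, le_refl (φ z c₀), hc₀⟩ (hφc z).continuousOn
    refine ⟨c, hc.2, fun c' hc' ↦ ?_⟩
    rcases le_total (φ z c') (φ z c₀) with h | h
    · exact hcm ⟨h, hc'⟩
    · exact le_trans hc.1 h
  refine ⟨fun z ↦ ?_, fun z ↦ ?_, fun B hB ↦ ?_⟩
  · obtain ⟨c₀, hc₀⟩ := hC'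
    have hcl : IsClosed {c ∈ C | ∀ c' ∈ C, φ z c ≤ φ z c'} := by
      refine hC.inter (s₂ := {c | ∀ c' ∈ C, φ z c ≤ φ z c'}) ?_
      simp only [Set.ofPred_forall]
      exact isClosed_iInter fun c' ↦ isClosed_iInter fun _ ↦ isClosed_le (hφc z) continuous_const
    exact Metric.isCompact_of_isClosed_isBounded hcl
      ((hφ z (φ z c₀)).subset fun c hc ↦ hc.2 c₀ hc₀)
  · obtain ⟨c, hc, hcm⟩ := hmin z C hC hC'
    exact ⟨c, hc, hcm⟩
  -- Strict sublevel sets of `φ z` are open, so whether they meet `C` or `C ∩ B` is decided on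
  -- countable dense subsets. Measurability then needs `φ` only at fixed points `c`.
  · obtain ⟨D, hDsub, hDc, hD⟩ := TopologicalSpace.IsSeparable.exists_countable_dense_subset
      (TopologicalSpace.IsSeparable.of_separableSpace C)
    obtain ⟨D', hDsub', hDc', hD'⟩ := TopologicalSpace.IsSeparable.exists_countable_dense_subset
      (TopologicalSpace.IsSeparable.of_separableSpace (C ∩ B))
    have e : {z | ({c ∈ C | ∀ c' ∈ C, φ z c ≤ φ z c'} ∩ B).Nonempty}
        = ⋂ r : ℚ, (⋃ c ∈ D, {z | φ z c < r})ᶜ ∪ ⋃ c ∈ D', {z | φ z c < r} := by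
      ext z
      simp only [Set.mem_iInter, Set.mem_union, Set.mem_compl_iff, Set.mem_iUnion, exists_prop]
      constructor
      · rintro ⟨c, ⟨hc, hmin⟩, hcB⟩ r
        rw [or_iff_not_imp_left, not_not]
        rintro ⟨c', hc', hr'⟩
        exact exists_mem_lt_of_dense hD' (hφc z) ⟨hc, hcB⟩ ((hmin c' (hDsub hc')).trans_lt hr')
      · intro h
        have h' : ∀ r : ℚ, (∃ c ∈ C, φ z c < r) → ∃ c ∈ D', φ z c < r := fun r ⟨c, hc, hr⟩ ↦
          (h r).resolve_left (not_not.2 (exists_mem_lt_of_dense hD (hφc z) hc hr))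
        have hne : (C ∩ B).Nonempty := by
          obtain ⟨c₀, hc₀⟩ := hC'
          obtain ⟨r, hr⟩ := exists_rat_gt (φ z c₀)
          obtain ⟨c, hc, -⟩ := h' r ⟨c₀, hc₀, hr⟩
          exact ⟨c, hDsub' hc⟩
        obtain ⟨c, hc, hcm⟩ := hmin z (C ∩ B) (hC.inter hB) hne
        refine ⟨c, ⟨hc.1, fun c' hc' ↦ ?_⟩, hc.2⟩
        by_contra! hlt
        obtain ⟨r, hr1, hr2⟩ := exists_rat_btwn hlt
        obtain ⟨c₂, h3, h4⟩ := h' r ⟨c', hc', hr1⟩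
        exact absurd ((hcm c₂ (hDsub' h3)).trans_lt h4) (not_lt.2 hr2.le)
    rw [e]
    have hm : ∀ (r : ℚ) c, MeasurableSet {z | φ z c < r} := fun r c ↦
      measurableSet_lt (hφm c) measurable_const
    exact MeasurableSet.iInter fun r ↦ (MeasurableSet.biUnion hDc fun c _ ↦ hm r c).compl.union
      (MeasurableSet.biUnion hDc' fun c _ ↦ hm r c)

end Selection

/-- Measurable selection of minimizers of a Carathéodory function which is coercive on `G`. -/
theorem exists_measurable_argmin {α : Type*} {mα : MeasurableSpace α} {C : Set (Vec d)} (hC : IsClosed C) (hC' : C.Nonempty)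
    {φ : α → Vec d → ℝ} (hφm : ∀ c, Measurable fun z ↦ φ z c) (hφc : ∀ z, Continuous (φ z))
    {G : Set α} (hG : MeasurableSet G)
    (hφ : ∀ z ∈ G, ∀ r, Bornology.IsBounded {c | φ z c ≤ r}) :
    ∃ s : α → Vec d, Measurable s ∧ ∀ z ∈ G, s z ∈ C ∧ ∀ c ∈ C, φ z (s z) ≤ φ z c := by
  classical
  -- Outside `G` coercivity may fail, and the norm replaces `φ` there; the conclusion concerns `G`
  -- only.
  let φ' : α → Vec d → ℝ := fun z c ↦ if z ∈ G then φ z c else ‖c‖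
  have h : IsCompactMultifunction (fun z ↦ {c ∈ C | ∀ c' ∈ C, φ' z c ≤ φ' z c'}) := by
    refine isCompactMultifunction_argmin hC hC' (fun c ↦ ?_) (fun z ↦ ?_) fun z r ↦ ?_
    · exact Measurable.ite hG (hφm c) measurable_const
    · by_cases hz : z ∈ G
      · simpa [φ', hz] using hφc z
      · simpa [φ', hz] using continuous_norm
    · by_cases hz : z ∈ G
      · simpa [φ', hz] using hφ z hz r
      · simp only [φ', hz, if_false]
        refine (Metric.isBounded_closedBall (x := (0 : Vec d)) (r := r)).subset fun c hc ↦ ?_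
        simpa using hc
  obtain ⟨s, hs, hsF⟩ := h.exists_measurable
  refine ⟨s, hs, fun z hz ↦ ⟨(hsF z).1, fun c hc ↦ ?_⟩⟩
  have := (hsF z).2 c hc
  simpa [φ', hz] using this

/-! ### The market -/

variable {b : ℝ≥0 → Ω → Vec d} {σ : ℝ≥0 → Ω → Matrix (Fin d) (Fin m) ℝ} {C : Set (Vec d)}
  {ρ : ℝ≥0 → Ω → Vec m}

/-- The product of a row vector and a matrix. -/
def rowMul (A : Matrix (Fin d) (Fin m) ℝ) (c : Vec d) : Vec m := WithLp.toLp 2 (c.ofLp ᵥ* A)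

lemma continuous_rowMul : Continuous fun p : Matrix (Fin d) (Fin m) ℝ × Vec d ↦ rowMul p.1 p.2 := by
  unfold rowMul
  exact (PiLp.continuous_toLp 2 _).comp
    (Continuous.matrix_vecMul ((PiLp.continuous_ofLp 2 _).comp continuous_snd) continuous_fst)

lemma norm_sq_eq_dotProduct {k : ℕ} (v : Vec k) : ‖v‖ ^ 2 = v.ofLp ⬝ᵥ v.ofLp := by
  rw [EuclideanSpace.real_norm_sq_eq, dotProduct]
  exact Finset.sum_congr rfl fun i _ ↦ sq _

lemma norm_rowMul_sq (A : Matrix (Fin d) (Fin m) ℝ) (c : Vec d) :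
    ‖rowMul A c‖ ^ 2 = c.ofLp ⬝ᵥ ((A * Aᵀ) *ᵥ c.ofLp) := by
  rw [norm_sq_eq_dotProduct, ← Matrix.mulVec_mulVec, Matrix.dotProduct_mulVec, Matrix.mulVec_transpose]
  rfl

/-- This lower bound is the source of coercivity and of the bound on the market price of risk. -/
lemma le_norm_rowMul_sq {A : Matrix (Fin d) (Fin m) ℝ} {ε : ℝ}
    (h : (A * Aᵀ - ε • (1 : Matrix (Fin d) (Fin d) ℝ)).PosSemidef) (c : Vec d) :
    ε * ‖c‖ ^ 2 ≤ ‖rowMul A c‖ ^ 2 := by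
  have h1 := h.dotProduct_mulVec_nonneg c.ofLp
  rw [Matrix.sub_mulVec, dotProduct_sub, Matrix.smul_mulVec, Matrix.one_mulVec, dotProduct_smul,
    star_trivial, ← norm_rowMul_sq, ← norm_sq_eq_dotProduct, smul_eq_mul] at h1
  linarith

lemma norm_rowMul_sq_le {A : Matrix (Fin d) (Fin m) ℝ} {K : ℝ}
    (h : (K • (1 : Matrix (Fin d) (Fin d) ℝ) - A * Aᵀ).PosSemidef) (c : Vec d) :
    ‖rowMul A c‖ ^ 2 ≤ K * ‖c‖ ^ 2 := by
  have h1 := h.dotProduct_mulVec_nonneg c.ofLp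
  rw [Matrix.sub_mulVec, dotProduct_sub, Matrix.smul_mulVec, Matrix.one_mulVec, dotProduct_smul,
    star_trivial, ← norm_rowMul_sq, ← norm_sq_eq_dotProduct, smul_eq_mul] at h1
  linarith

lemma marketPrice_eq (t : ℝ≥0) (ω : Ω) : marketPrice b σ t ω
    = rowMul (σ t ω) (WithLp.toLp 2 ((σ t ω * (σ t ω)ᵀ)⁻¹ *ᵥ (b t ω).ofLp)) := by
  simp only [marketPrice, rowMul, Matrix.mulVec_transpose]

/-- Write `θ = σᵗʳ y` with `σ σᵗʳ y = b`. Then `|θ|² = b·y ≤ |b||y|`, while ellipticity gives `ε|y|²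
≤ |θ|²`; together `|y| ≤ |b| / ε`. -/
lemma norm_marketPrice_sq_le {ε : ℝ} (hε : 0 < ε) {t : ℝ≥0} {ω : Ω}
    (h : (σ t ω * (σ t ω)ᵀ - ε • (1 : Matrix (Fin d) (Fin d) ℝ)).PosSemidef) :
    ‖marketPrice b σ t ω‖ ^ 2 ≤ ‖b t ω‖ ^ 2 / ε := by
  set A := σ t ω with hA
  set y : Vec d := WithLp.toLp 2 ((A * Aᵀ)⁻¹ *ᵥ (b t ω).ofLp) with hy
  have hpd : (A * Aᵀ).PosDef := by
    have h1 : (ε • (1 : Matrix (Fin d) (Fin d) ℝ)).PosDef := Matrix.PosDef.one.smul hε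
    have := Matrix.PosDef.posSemidef_add h h1
    rwa [sub_add_cancel] at this
  have hinv : (A * Aᵀ) *ᵥ y.ofLp = (b t ω).ofLp := by
    rw [hy, Matrix.mulVec_mulVec, Matrix.mul_nonsing_inv _
      ((Matrix.isUnit_iff_isUnit_det _).1 hpd.isUnit), Matrix.one_mulVec]
  have h1 : ‖marketPrice b σ t ω‖ ^ 2 = inner ℝ (b t ω) y := by
    rw [marketPrice_eq, norm_rowMul_sq, ← hA, ← hy, hinv, EuclideanSpace.inner_eq_star_dotProduct]
    simp
  have h2 : ε * ‖y‖ ^ 2 ≤ ‖marketPrice b σ t ω‖ ^ 2 := by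
    rw [marketPrice_eq]; exact le_norm_rowMul_sq h y
  have h3 : inner ℝ (b t ω) y ≤ ‖b t ω‖ * ‖y‖ := real_inner_le_norm _ _
  rw [le_div_iff₀ hε]
  have h4 : 0 ≤ (‖b t ω‖ - ε * ‖y‖) ^ 2 := sq_nonneg _
  have h5 : ε * ‖y‖ ≤ ‖b t ω‖ := by
    by_contra! hlt
    have hy0 : 0 < ‖y‖ := by
      by_contra! h0
      have : ‖y‖ = 0 := le_antisymm h0 (norm_nonneg _)
      rw [this] at hlt
      simp at hlt
      exact absurd hlt (not_lt.2 (norm_nonneg _))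
    nlinarith
  nlinarith [norm_nonneg (b t ω), norm_nonneg y]

section Measurability

variable {α : Type*} {mα : MeasurableSpace α}

lemma stronglyMeasurable_rowMul {A : α → Matrix (Fin d) (Fin m) ℝ} {c : α → Vec d}
    (hA : StronglyMeasurable A) (hc : StronglyMeasurable c) :
    StronglyMeasurable fun z ↦ rowMul (A z) (c z) :=
  continuous_rowMul.comp_stronglyMeasurable (hA.prodMk hc)

/-- The inverse is the adjugate divided by the determinant. Invertibility is not needed, as scalar
inversion with `0⁻¹ = 0` is measurable. -/
lemma stronglyMeasurable_matrix_inv {B : α → Matrix (Fin d) (Fin d) ℝ}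
    (hB : StronglyMeasurable B) : StronglyMeasurable fun z ↦ (B z)⁻¹ := by
  simp only [Matrix.inv_def, Ring.inverse_eq_inv']
  have h1 : StronglyMeasurable fun z ↦ (B z).det :=
    (Continuous.matrix_det continuous_id).comp_stronglyMeasurable hB
  have h2 : StronglyMeasurable fun z ↦ (B z).adjugate :=
    (Continuous.matrix_adjugate continuous_id).comp_stronglyMeasurable hB
  exact h1.measurable.inv.stronglyMeasurable.smul h2

lemma stronglyMeasurable_marketPrice {A : α → Matrix (Fin d) (Fin m) ℝ} {v : α → Vec d}
    (hA : StronglyMeasurable A) (hv : StronglyMeasurable v) :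
    StronglyMeasurable fun z ↦ rowMul (A z) (WithLp.toLp 2 ((A z * (A z)ᵀ)⁻¹ *ᵥ (v z).ofLp)) := by
  refine stronglyMeasurable_rowMul hA ?_
  have h1 : StronglyMeasurable fun z ↦ A z * (A z)ᵀ :=
    (Continuous.matrix_mul continuous_id (Continuous.matrix_transpose continuous_id)
      ).comp_stronglyMeasurable hA
  have h2 : Continuous fun p : Matrix (Fin d) (Fin d) ℝ × Vec d ↦
      (WithLp.toLp 2 (p.1 *ᵥ p.2.ofLp) : Vec d) :=
    (PiLp.continuous_toLp 2 _).comp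
      (Continuous.matrix_mulVec continuous_fst ((PiLp.continuous_ofLp 2 _).comp continuous_snd))
  exact h2.comp_stronglyMeasurable ((stronglyMeasurable_matrix_inv h1).prodMk hv)

end Measurability

namespace IsMarket

lemma predictable_marketPrice (h : IsMarket 𝓕 P T b σ) :
    IsStronglyPredictable 𝓕 (marketPrice b σ) := by
  have e : Function.uncurry (marketPrice b σ) = fun z ↦ rowMul (Function.uncurry σ z)
      (WithLp.toLp 2 ((Function.uncurry σ z * (Function.uncurry σ z)ᵀ)⁻¹ *ᵥ
        (Function.uncurry b z).ofLp)) := by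
    ext1 z; exact marketPrice_eq z.1 z.2
  unfold IsStronglyPredictable
  rw [e]
  exact stronglyMeasurable_marketPrice h.predictable_σ h.predictable_b

lemma exists_bound_marketPrice (h : IsMarket 𝓕 P T b σ) :
    ∃ R : ℝ, ∀ᵐ z ∂((leb T).prod P), ‖marketPrice b σ z.1 z.2‖ ≤ R := by
  obtain ⟨c, hc⟩ := h.bounded_b
  obtain ⟨ε, K, hε, -, hE⟩ := h.elliptic
  refine ⟨Real.sqrt (c ^ 2 / ε), ?_⟩
  filter_upwards [hc, hE] with z hc hE
  refine Real.le_sqrt_of_sq_le ((norm_marketPrice_sq_le hε hE.1).trans ?_)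
  gcongr

lemma memLp_marketPrice (h : IsMarket 𝓕 P T b σ) :
    MemLp (fun z : ℝ≥0 × Ω ↦ marketPrice b σ z.1 z.2) 2 ((leb T).prod P) := by
  obtain ⟨R, hR⟩ := h.exists_bound_marketPrice
  exact MemLp.of_bound (h.predictable_marketPrice.mono predictable_le_prod).aestronglyMeasurable R hR

end IsMarket

/-! ### The optimization problem -/

variable {b : ℝ≥0 → Ω → Vec d} {σ : ℝ≥0 → Ω → Matrix (Fin d) (Fin m) ℝ} {C : Set (Vec d)}
  {ρ : ℝ≥0 → Ω → Vec m} {X : ℝ≥0 → Ω → ℝ} {x : ℝ}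

lemma isBounded_dist_rowMul_le {A : Matrix (Fin d) (Fin m) ℝ} {ε : ℝ} (hε : 0 < ε)
    (h : ∀ c, ε * ‖c‖ ^ 2 ≤ ‖rowMul A c‖ ^ 2) (v : Vec m) (r : ℝ) :
    Bornology.IsBounded {c | dist v (rowMul A c) ≤ r} := by
  refine (Metric.isBounded_closedBall (x := (0 : Vec d))
    (r := Real.sqrt ((‖v‖ + r) ^ 2 / ε))).subset fun c hc ↦ ?_
  rw [mem_closedBall_zero_iff]
  refine Real.le_sqrt_of_sq_le ?_
  rw [le_div_iff₀ hε, mul_comm]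
  refine (h c).trans ?_
  have h1 : ‖rowMul A c‖ ≤ ‖v‖ + r := by
    have h2 : dist v (rowMul A c) ≤ r := hc
    rw [dist_eq_norm, norm_sub_rev] at h2
    calc ‖rowMul A c‖ = ‖v + (rowMul A c - v)‖ := by rw [add_sub_cancel]
      _ ≤ ‖v‖ + ‖rowMul A c - v‖ := norm_add_le _ _
      _ ≤ ‖v‖ + r := by gcongr
  gcongr

lemma mem_proj_of_forall_le {D : Set (Vec m)} {v c : Vec m} (hc : c ∈ D)
    (h : ∀ c' ∈ D, dist v c ≤ dist v c') : c ∈ proj D v :=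
  ⟨hc, le_antisymm ((Metric.le_infDist ⟨c, hc⟩).2 fun {c'} hc' ↦ h c' hc')
    (Metric.infDist_le_dist_of_mem hc)⟩

namespace IsMarket

/-- Existence of a predictable selection of the projections. -/
theorem exists_projectionSelection (h : IsMarket 𝓕 P T b σ) (hC : IsClosed C) (hC' : C.Nonempty) :
    ∃ ρ, IsProjectionSelection 𝓕 P T b σ C ρ := by
  obtain ⟨ε, K, hε, -, hE⟩ := h.elliptic
  have hσ : StronglyMeasurable[𝓕.predictable] (Function.uncurry σ) := h.predictable_σ
  have hθ : StronglyMeasurable[𝓕.predictable] (Function.uncurry (marketPrice b σ)) :=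
    h.predictable_marketPrice
  let q := TopologicalSpace.denseSeq (Vec d)
  -- Ellipticity holds only almost everywhere, so the selection is made on the set where its lower
  -- bound holds. Testing on a dense sequence makes this set predictable; by continuity nothing is
  -- lost.
  let G : Set (ℝ≥0 × Ω) := ⋂ n, {z | ε * ‖q n‖ ^ 2 ≤ ‖rowMul (Function.uncurry σ z) (q n)‖ ^ 2}
  have hrow : ∀ c : Vec d, StronglyMeasurable[𝓕.predictable]
      fun z ↦ rowMul (Function.uncurry σ z) c := fun c ↦
    stronglyMeasurable_rowMul hσ stronglyMeasurable_const
  have hG : MeasurableSet[𝓕.predictable] G := MeasurableSet.iInter fun n ↦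
    measurableSet_le measurable_const ((hrow (q n)).norm.pow 2).measurable
  have hcont : ∀ A : Matrix (Fin d) (Fin m) ℝ, Continuous (rowMul A) := fun A ↦
    continuous_rowMul.comp (Continuous.prodMk_right A)
  have hGc : ∀ z ∈ G, ∀ c, ε * ‖c‖ ^ 2 ≤ ‖rowMul (Function.uncurry σ z) c‖ ^ 2 := by
    intro z hz
    have hcl : IsClosed {c : Vec d | ε * ‖c‖ ^ 2 ≤ ‖rowMul (Function.uncurry σ z) c‖ ^ 2} :=
      isClosed_le (by fun_prop) ((hcont _).norm.pow 2)
    have hd := (TopologicalSpace.denseRange_denseSeq (Vec d)).closure_range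
    intro c
    have hsub : closure (Set.range q) ⊆ _ := closure_minimal (s := Set.range q) (by
      rintro _ ⟨n, rfl⟩
      exact Set.mem_iInter.1 hz n) hcl
    exact hsub (hd ▸ Set.mem_univ c)
  obtain ⟨s, hs, hsC⟩ := exists_measurable_argmin (mα := 𝓕.predictable) hC hC'
    (φ := fun z c ↦ dist (Function.uncurry (marketPrice b σ) z) (rowMul (Function.uncurry σ z) c))
    (fun c ↦ (hθ.dist (hrow c)).measurable) (fun z ↦ continuous_const.dist (hcont _)) hG
    (fun z hz r ↦ isBounded_dist_rowMul_le hε (hGc z hz) _ r)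
  refine ⟨fun t ω ↦ rowMul (σ t ω) (s (t, ω)), ?_, ?_⟩
  · exact stronglyMeasurable_rowMul hσ hs.stronglyMeasurable
  · filter_upwards [hE] with z hz
    have hzG : z ∈ G := Set.mem_iInter.2 fun n ↦ le_norm_rowMul_sq hz.1 (q n)
    obtain ⟨h1, h2⟩ := hsC z hzG
    refine mem_proj_of_forall_le ⟨s z, h1, rfl⟩ ?_
    rintro _ ⟨c, hc, rfl⟩
    exact h2 c hc

/-- The distance to `C_t` is at most the distance to `cσ` for one fixed `c ∈ C`, and `cσ` is bounded
by the upper bound on `σ σᵗʳ`. -/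
lemma exists_bound_infDist (h : IsMarket 𝓕 P T b σ) (hC' : C.Nonempty) :
    ∃ R : ℝ, ∀ᵐ z ∂((leb T).prod P),
      Metric.infDist (marketPrice b σ z.1 z.2) (constraintSet C σ z.1 z.2) ≤ R := by
  obtain ⟨R, hR⟩ := h.exists_bound_marketPrice
  obtain ⟨ε, K, hε, -, hE⟩ := h.elliptic
  obtain ⟨c, hc⟩ := hC'
  refine ⟨R + Real.sqrt (K * ‖c‖ ^ 2), ?_⟩
  filter_upwards [hR, hE] with z hz hE
  have hmem : rowMul (σ z.1 z.2) c ∈ constraintSet C σ z.1 z.2 := ⟨c, hc, rfl⟩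
  refine (Metric.infDist_le_dist_of_mem hmem).trans ?_
  rw [dist_eq_norm]
  exact (norm_sub_le _ _).trans (add_le_add hz (Real.le_sqrt_of_sq_le (norm_rowMul_sq_le hE.2 c)))

/-- Predictable selections of the projections are admissible. -/
theorem isAdmissible_of_projectionSelection (h : IsMarket 𝓕 P T b σ) (hC' : C.Nonempty)
    (hρ : IsProjectionSelection 𝓕 P T b σ C ρ) : IsAdmissible 𝓕 P T σ C ρ := by
  obtain ⟨R, hR⟩ := h.exists_bound_marketPrice
  obtain ⟨R', hR'⟩ := h.exists_bound_infDist hC'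
  have hm : AEStronglyMeasurable (fun z : ℝ≥0 × Ω ↦ ρ z.1 z.2) ((leb T).prod P) :=
    (hρ.1.mono predictable_le_prod).aestronglyMeasurable
  have hb : ∀ᵐ z ∂((leb T).prod P), ‖ρ z.1 z.2‖ ≤ R + R' := by
    filter_upwards [hR, hR', hρ.2] with z h1 h2 h3
    have h4 : ‖ρ z.1 z.2 - marketPrice b σ z.1 z.2‖ ≤ R' := by
      rw [← dist_eq_norm, dist_comm, h3.2]; exact h2
    calc ‖ρ z.1 z.2‖ = ‖marketPrice b σ z.1 z.2 + (ρ z.1 z.2 - marketPrice b σ z.1 z.2)‖ := by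
          rw [add_sub_cancel]
      _ ≤ R + R' := (norm_add_le _ _).trans (add_le_add h1 h4)
  refine ⟨hρ.1, ?_, ?_⟩
  · have h2 := (MemLp.of_bound (p := 2) hm _ hb).lintegral_enorm_sq_lt_top
    rwa [lintegral_prod_symm _ (hm.enorm.pow_const 2)] at h2
  · filter_upwards [hρ.2] with z hz using hz.1

end IsMarket

lemma IsAdmissible.memLp (h : IsAdmissible 𝓕 P T σ C ρ) :
    MemLp (fun z : ℝ≥0 × Ω ↦ ρ z.1 z.2) 2 ((leb T).prod P) := by
  have hm : AEStronglyMeasurable (fun z : ℝ≥0 × Ω ↦ ρ z.1 z.2) ((leb T).prod P) :=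
    (h.predictable.mono predictable_le_prod).aestronglyMeasurable
  rw [memLp_two_iff hm, lintegral_prod_symm _ (hm.enorm.pow_const 2)]
  exact h.sq_integrable

/-- Completing the square turns the maximization of expected log utility into the minimization of
the distance to `θ`. -/
lemma inner_sub_half_norm_sq {k : ℕ} (r v : Vec k) :
    inner ℝ r v - 1 / 2 * ‖r‖ ^ 2 = 1 / 2 * ‖v‖ ^ 2 - 1 / 2 * dist v r ^ 2 := by
  rw [dist_eq_norm, norm_sub_sq_real, real_inner_comm]
  ring

namespace IsMarket

/-- Measurability of the distance to the random set is not shown directly: along a predictable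
projection the distance is attained, so the driver agrees almost everywhere with an integrable
expression in that projection. -/
theorem integrable_driver (h : IsMarket 𝓕 P T b σ) (hC : IsClosed C) (hC' : C.Nonempty) :
    Integrable (fun z : ℝ≥0 × Ω ↦ driver b σ C z.1 z.2) ((leb T).prod P) := by
  obtain ⟨ρ, hρ⟩ := h.exists_projectionSelection hC hC'
  have hA := h.isAdmissible_of_projectionSelection hC' hρ
  refine (integrable_driver_sections hA.memLp h.memLp_marketPrice).neg.congr ?_
  filter_upwards [hρ.2] with z hz
  simp only [Pi.neg_apply, driver, inner_sub_half_norm_sq, hz.2]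
  ring

lemma integral_inner_le (h : IsMarket 𝓕 P T b σ) (hC : IsClosed C) (hC' : C.Nonempty)
    (hρ : IsAdmissible 𝓕 P T σ C ρ) :
    ∫ z, (inner ℝ (ρ z.1 z.2) (marketPrice b σ z.1 z.2) - 1 / 2 * ‖ρ z.1 z.2‖ ^ 2)
      ∂((leb T).prod P) ≤ -∫ z, driver b σ C z.1 z.2 ∂((leb T).prod P) := by
  rw [← integral_neg]
  refine integral_mono_ae (integrable_driver_sections hρ.memLp h.memLp_marketPrice)
    (h.integrable_driver hC hC').neg ?_
  filter_upwards [hρ.mem_constraint] with z hz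
  simp only [driver, inner_sub_half_norm_sq]
  have h1 := Metric.infDist_le_dist_of_mem (x := marketPrice b σ z.1 z.2) hz
  have h2 : Metric.infDist (marketPrice b σ z.1 z.2) (constraintSet C σ z.1 z.2) ^ 2
      ≤ dist (marketPrice b σ z.1 z.2) (ρ z.1 z.2) ^ 2 :=
    pow_le_pow_left₀ Metric.infDist_nonneg h1 2
  linarith

lemma integral_inner_eq (hρ : IsProjectionSelection 𝓕 P T b σ C ρ) :
    ∫ z, (inner ℝ (ρ z.1 z.2) (marketPrice b σ z.1 z.2) - 1 / 2 * ‖ρ z.1 z.2‖ ^ 2)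
      ∂((leb T).prod P) = -∫ z, driver b σ C z.1 z.2 ∂((leb T).prod P) := by
  rw [← integral_neg]
  refine integral_congr_ae ?_
  filter_upwards [hρ.2] with z hz
  simp only [driver, inner_sub_half_norm_sq, hz.2]
  ring

end IsMarket

/-- The logarithm of the terminal wealth of an admissible strategy. -/
theorem IsMarket.log_wealth (hW : IsFilteredBrownian 𝓕 P T W) (h : IsMarket 𝓕 P T b σ)
    (hx : 0 < x) (hρ : IsAdmissible 𝓕 P T σ C ρ) :
    ∃ X, IsWealthProcess 𝓕 P T W (marketPrice b σ) x ρ X ∧ (∀ t ω, 0 < X t ω) ∧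
      Integrable (fun ω ↦ Real.log (X T ω)) P ∧
      ∫ ω, Real.log (X T ω) ∂P = Real.log x + ∫ z, (inner ℝ (ρ z.1 z.2) (marketPrice b σ z.1 z.2)
        - 1 / 2 * ‖ρ z.1 z.2‖ ^ 2) ∂((leb T).prod P) ∧
      ∀ Y, IsWealthProcess 𝓕 P T W (marketPrice b σ) x ρ Y → ∀ᵐ ω ∂P, ∀ t ≤ T, Y t ω = X t ω := by
  obtain ⟨U, hU, huniq, hUi, hUe⟩ := hW.exists_wealth x hρ.predictable h.predictable_marketPrice
    hρ.memLp h.memLp_marketPrice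
  have hlog : ∀ ω, Real.log (x * Real.exp (U T ω)) = Real.log x + U T ω := fun ω ↦ by
    rw [Real.log_mul hx.ne' (Real.exp_ne_zero _), Real.log_exp]
  refine ⟨_, hU, fun t ω ↦ mul_pos hx (Real.exp_pos _), ?_, ?_, huniq⟩
  · simp only [hlog]
    exact (integrable_const _).add hUi
  · simp only [hlog]
    rw [integral_add (integrable_const _) hUi, hUe]
    simp

/-- By uniqueness, any wealth process has the same terminal value as the explicit exponential. -/
lemma IsMarket.integral_log (hW : IsFilteredBrownian 𝓕 P T W) (h : IsMarket 𝓕 P T b σ)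
    (hx : 0 < x) (hρ : IsAdmissible 𝓕 P T σ C ρ)
    (hX : IsWealthProcess 𝓕 P T W (marketPrice b σ) x ρ X) :
    ∫ ω, Real.log (X T ω) ∂P = Real.log x + ∫ z, (inner ℝ (ρ z.1 z.2) (marketPrice b σ z.1 z.2)
        - 1 / 2 * ‖ρ z.1 z.2‖ ^ 2) ∂((leb T).prod P) := by
  obtain ⟨Y, -, -, -, hY, huniq⟩ := h.log_wealth hW hx hρ
  rw [← hY]
  refine integral_congr_ae ?_
  filter_upwards [huniq X hX] with ω hω
  rw [hω T le_rfl]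

/-- The upper bound is the pointwise inequality between the distance to `ρ_t` and the distance to
`C_t`; a predictable projection turns it into an equality, so the bound is attained. -/
theorem IsMarket.isGreatest_expectedUtilities (hW : IsFilteredBrownian 𝓕 P T W)
    (h : IsMarket 𝓕 P T b σ) (hC : IsClosed C) (hC' : C.Nonempty) (hx : 0 < x) :
    IsGreatest (expectedUtilities 𝓕 P T W b σ C x)
      (Real.log x - ∫ z, driver b σ C z.1 z.2 ∂((leb T).prod P)) := by
  constructor
  · obtain ⟨ρ, hρ⟩ := h.exists_projectionSelection hC hC'
    have hA := h.isAdmissible_of_projectionSelection hC' hρ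
    obtain ⟨X, hX, -⟩ := h.log_wealth hW hx hA
    refine ⟨ρ, X, hA, hX, ?_⟩
    rw [h.integral_log hW hx hA hX, integral_inner_eq hρ, sub_eq_add_neg]
  · rintro _ ⟨ρ, X, hρ, hX, rfl⟩
    rw [h.integral_log hW hx hρ hX, sub_eq_add_neg]
    exact add_le_add le_rfl (h.integral_inner_le hC hC' hρ)

end LogUtility

end

/-! ### The main theorem -/

theorem mainTheorem5 {Ω : Type*} [MeasurableSpace Ω] (P : Measure Ω) [IsProbabilityMeasure P]
    (d m : ℕ) (hdm : d ≤ m) (T : ℝ≥0) (hT : 0 < T)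
    (W : ℝ≥0 → Ω → LogUtility.Vec m) (hW : LogUtility.IsBrownianMotion W T P)
    (𝓕 : Filtration ℝ≥0 ‹MeasurableSpace Ω›)
    (h𝓕 : 𝓕 = LogUtility.augmentedFiltration W hW.measurable P)
    (b : ℝ≥0 → Ω → LogUtility.Vec d) (σ : ℝ≥0 → Ω → Matrix (Fin d) (Fin m) ℝ)
    (hmarket : LogUtility.IsMarket 𝓕 P T b σ)
    (C : Set (LogUtility.Vec d)) (hC : IsClosed C) (hC' : C.Nonempty)
    (x : ℝ) (hx : 0 < x) :
    -- every admissible strategy has a unique wealth process; it is positive and the expected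
    -- logarithmic utility is well defined and finite
    (∀ ρ, LogUtility.IsAdmissible 𝓕 P T σ C ρ →
      (∃ X, LogUtility.IsWealthProcess 𝓕 P T W (LogUtility.marketPrice b σ) x ρ X) ∧
      ∀ X, LogUtility.IsWealthProcess 𝓕 P T W (LogUtility.marketPrice b σ) x ρ X →
        (∀ᵐ ω ∂P, ∀ t ≤ T, 0 < X t ω) ∧
        Integrable (fun ω ↦ Real.log (X T ω)) P ∧
        ∀ X', LogUtility.IsWealthProcess 𝓕 P T W (LogUtility.marketPrice b σ) x ρ X' →
          ∀ᵐ ω ∂P, ∀ t ≤ T, X t ω = X' t ω) ∧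
    -- the value function
    Integrable (fun z : ℝ≥0 × Ω ↦ LogUtility.driver b σ C z.1 z.2) ((LogUtility.leb T).prod P) ∧
    BddAbove (LogUtility.expectedUtilities 𝓕 P T W b σ C x) ∧
    LogUtility.valueFunction 𝓕 P T W b σ C x =
      Real.log x - ∫ ω, ∫ s, LogUtility.driver b σ C s ω ∂(LogUtility.leb T) ∂P ∧
    -- predictable selections exist, and every one of them is an optimal strategy
    (∃ ρ, LogUtility.IsProjectionSelection 𝓕 P T b σ C ρ) ∧
    (∀ ρ, LogUtility.IsProjectionSelection 𝓕 P T b σ C ρ →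
      LogUtility.IsAdmissible 𝓕 P T σ C ρ ∧
      ∀ X, LogUtility.IsWealthProcess 𝓕 P T W (LogUtility.marketPrice b σ) x ρ X →
        ∫ ω, Real.log (X T ω) ∂P = LogUtility.valueFunction 𝓕 P T W b σ C x) := by
  have hB : LogUtility.IsFilteredBrownian 𝓕 P T W := hW.isFilteredBrownian h𝓕
  have hgr := hmarket.isGreatest_expectedUtilities hB hC hC' hx
  have hint := hmarket.integrable_driver hC hC'
  have hval : LogUtility.valueFunction 𝓕 P T W b σ C x =
      Real.log x - ∫ z, LogUtility.driver b σ C z.1 z.2 ∂((LogUtility.leb T).prod P) := hgr.csSup_eq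
  refine ⟨fun ρ hρ ↦ ?_, hint, hgr.bddAbove, ?_, hmarket.exists_projectionSelection hC hC',
    fun ρ hρ ↦ ?_⟩
  · obtain ⟨X, hX, hpos, hlog, -, huniq⟩ := hmarket.log_wealth hB hx hρ
    refine ⟨⟨X, hX⟩, fun Y hY ↦ ⟨?_, ?_, fun Z hZ ↦ ?_⟩⟩
    · filter_upwards [huniq Y hY] with ω hω t ht
      rw [hω t ht]
      exact hpos t ω
    · refine hlog.congr ?_
      filter_upwards [huniq Y hY] with ω hω
      rw [hω T le_rfl]
    · filter_upwards [huniq Y hY, huniq Z hZ] with ω h1 h2 t ht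
      rw [h1 t ht, h2 t ht]
  -- Fubini, available since the driver is integrable on the product, gives the iterated integral
  -- with time innermost.
  · rw [hval, integral_prod_symm _ hint]
  · have hA := hmarket.isAdmissible_of_projectionSelection hC' hρ
    refine ⟨hA, fun X hX ↦ ?_⟩
    rw [hval, hmarket.integral_log hB hx hA hX, LogUtility.IsMarket.integral_inner_eq hρ,
      sub_eq_add_neg]
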